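/- Let $1<p<\infty$, let $\Omega\subseteq\mathbb{R}^n$, $n\ge 2$, be a bounded open set having $C^1$ boundary, and let $\gamma_1,\gamma_2$ be positive continuous functions on $\overline{\Omega}$. Let $X=W^{1,p}(\Omega;\mathbb{C})/W^{1,p}_0(\Omega;\mathbb{C})$ be the space of complex-valued boundary data, where $W^{1,p}_0(\Omega;\mathbb{C})$ is the closure of $C_c^\infty(\Omega;\mathbb{C})$ in $W^{1,p}(\Omega;\mathbb{C})$, and let $X'$ be its dual. For a positive $\gamma\in C(\overline{\Omega})$, the Dirichlet-to-Neumann map $\Lambda_\gamma^{\mathbb{C}}:X\to X'$ is given by $$\langle \Lambda_\gamma^{\mathbb{C}}(f),g\rangle=\int_\Omega \gamma\,|\nabla u_f|^{p-2}\,\nabla u_f\cdot\nabla v\,dx ,$$ where $v\in W^{1,p}(\Omega;\mathbb{C})$ is any representative of $g\in X$ and $u_f\in W^{1,p}(\Omega;\mathbb{C})$ is the unique weak solution of $\operatorname{div}(\gamma|\nabla u|^{p-2}\nabla u)=0$ in $\Omega$ with $u=f$ on $\partial\Omega$; that is, $u_f$ represents the class $f$ and $\int_\Omega \gamma\,|\nabla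 u_f|^{p-2}\,\nabla u_f\cdot\nabla\varphi\,dx=0$ for all $\varphi\in W^{1,p}_0(\Omega;\mathbb{C})$. If $\Lambda_{\gamma_1}^{\mathbb{C}}=\Lambda_{\gamma_2}^{\mathbb{C}}$, then $\gamma_1|_{\partial\Omega}=\gamma_2|_{\partial\Omega}$. -/

import Mathlib

open MeasureTheory Set Filter Topology
open scoped ContDiff ENNReal

noncomputable section

namespace PCalderon

/-- Euclidean space `ℝⁿ`. -/
abbrev E (n : ℕ) : Type := EuclideanSpace ℝ (Fin n)

/-- Complex vectors `ℂⁿ` with the Euclidean (Hermitian) norm; gradients take values here. -/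
abbrev CVec (n : ℕ) : Type := EuclideanSpace ℂ (Fin n)

instance fact_one_le_ofReal (p : ℝ) [hp : Fact (1 < p)] : Fact ((1 : ℝ≥0∞) ≤ ENNReal.ofReal p) :=
  ⟨by
    rw [← ENNReal.ofReal_one]
    exact ENNReal.ofReal_le_ofReal hp.out.le⟩

/-- `Ω` has `C¹` boundary: near each boundary point there is a `C¹` function `ρ` with nonvanishing
gradient such that `Ω` is given by `ρ > 0` and `∂Ω` by `ρ = 0`
(locally, `∂Ω` is a `C¹` hypersurface and `Ω` lies on one side of it). -/
def HasC1Boundary {n : ℕ} (Ω : Set (E n)) : Prop :=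
  ∀ x₀ ∈ frontier Ω, ∃ U : Set (E n), IsOpen U ∧ x₀ ∈ U ∧ ∃ ρ : E n → ℝ, ContDiff ℝ 1 ρ ∧
    (∀ x ∈ U, fderiv ℝ ρ x ≠ 0) ∧
    (∀ x ∈ U, x ∈ Ω ↔ 0 < ρ x) ∧
    (∀ x ∈ U, x ∈ frontier Ω ↔ ρ x = 0)

/-- `φ ∈ C_c^∞(Ω; F)`. -/
def IsTest {n : ℕ} {F : Type*} [NormedAddCommGroup F] [NormedSpace ℝ F]
    (Ω : Set (E n)) (φ : E n → F) : Prop :=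
  ContDiff ℝ ∞ φ ∧ HasCompactSupport φ ∧ tsupport φ ⊆ Ω

/-- The classical partial derivative `∂φ/∂x_i`. -/
def partialD {n : ℕ} {F : Type*} [NormedAddCommGroup F] [NormedSpace ℝ F]
    (φ : E n → F) (i : Fin n) (x : E n) : F :=
  fderiv ℝ φ x (EuclideanSpace.single i 1)

/-- The classical gradient of a complex valued function. -/
def classicalGrad {n : ℕ} (φ : E n → ℂ) (x : E n) : CVec n :=
  WithLp.toLp 2 fun i => partialD φ i x

/-- `L^p(Ω; ℂ) × L^p(Ω; ℂⁿ)`, the space of pairs (function, candidate for its weak gradient). -/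
abbrev LpPair {n : ℕ} (Ω : Set (E n)) (p : ℝ) : Type :=
  Lp ℂ (ENNReal.ofReal p) (volume.restrict Ω) × Lp (CVec n) (ENNReal.ofReal p) (volume.restrict Ω)

/-- `G` is the weak gradient of `u` in `Ω`. -/
def IsWeakGrad {n : ℕ} (Ω : Set (E n)) (u : E n → ℂ) (G : E n → CVec n) : Prop :=
  ∀ φ : E n → ℝ, IsTest Ω φ → ∀ i : Fin n,
    ∫ x in Ω, partialD φ i x • u x = - ∫ x in Ω, φ x • G x i

lemma IsTest.continuous_partialD {n : ℕ} {Ω : Set (E n)} {φ : E n → ℝ} (h : IsTest Ω φ)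
    (i : Fin n) : Continuous (partialD φ i) :=
  (h.1.continuous_fderiv (by simp)).clm_apply continuous_const

lemma IsTest.hasCompactSupport_partialD {n : ℕ} {Ω : Set (E n)} {φ : E n → ℝ} (h : IsTest Ω φ)
    (i : Fin n) : HasCompactSupport (partialD φ i) :=
  h.2.1.fderiv_apply ℝ _

lemma integrable_smul_of_Lp {n : ℕ} {Ω : Set (E n)} {p : ℝ} [Fact (1 < p)] {F : Type*}
    [NormedAddCommGroup F] [NormedSpace ℝ F] {φ : E n → ℝ} (hc : Continuous φ)
    (hs : HasCompactSupport φ) (u : Lp F (ENNReal.ofReal p) (volume.restrict Ω)) :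
    Integrable (fun x => φ x • u x) (volume.restrict Ω) :=
  (((Lp.memLp u).locallyIntegrable
      (fact_one_le_ofReal p).out).integrable_smul_left_of_hasCompactSupport hc hs)

lemma integrable_smul_apply_of_Lp {n : ℕ} {Ω : Set (E n)} {p : ℝ} [Fact (1 < p)]
    {φ : E n → ℝ} (hc : Continuous φ) (hs : HasCompactSupport φ)
    (G : Lp (CVec n) (ENNReal.ofReal p) (volume.restrict Ω)) (i : Fin n) :
    Integrable (fun x => φ x • G x i) (volume.restrict Ω) :=
  ((EuclideanSpace.proj i : CVec n →L[ℂ] ℂ).restrictScalars ℝ).integrable_comp (integrable_smul_of_Lp hc hs G)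

/-- The Sobolev space `W^{1,p}(Ω; ℂ)`: functions `u ∈ L^p` together with their weak gradient
`∇u ∈ L^p` (which is determined by `u`), normed by `max (‖u‖_{L^p}, ‖∇u‖_{L^p})`. -/
def W1p {n : ℕ} (Ω : Set (E n)) (p : ℝ) [Fact (1 < p)] : Submodule ℂ (LpPair Ω p) where
  carrier := {w | IsWeakGrad Ω w.1 w.2}
  zero_mem' := by
    intro φ _ i
    have h1 : ∫ x in Ω, partialD φ i x •
        ((0 : LpPair Ω p).1 : E n → ℂ) x = 0 := by
      apply integral_eq_zero_of_ae
      filter_upwards [Lp.coeFn_zero ℂ (ENNReal.ofReal p) (volume.restrict Ω)] with x hx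
      simp only [Prod.fst_zero, hx, Pi.zero_apply, smul_zero]
    have h2 : ∫ x in Ω, φ x • ((0 : LpPair Ω p).2 : E n → CVec n) x i = 0 := by
      apply integral_eq_zero_of_ae
      filter_upwards [Lp.coeFn_zero (CVec n) (ENNReal.ofReal p) (volume.restrict Ω)] with x hx
      simp only [Prod.snd_zero, hx, Pi.zero_apply, PiLp.zero_apply, smul_zero]
    rw [h1, h2, neg_zero]
  add_mem' := by
    intro a b ha hb φ hφ i
    have e1 : ∫ x in Ω, partialD φ i x • ((a + b).1 : E n → ℂ) x
        = ∫ x in Ω, (partialD φ i x • (a.1 : E n → ℂ) x + partialD φ i x • (b.1 : E n → ℂ) x) := by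
      apply integral_congr_ae
      filter_upwards [Lp.coeFn_add a.1 b.1] with x hx
      simp only [Prod.fst_add, hx, Pi.add_apply, smul_add]
    have e2 : ∫ x in Ω, φ x • ((a + b).2 : E n → CVec n) x i
        = ∫ x in Ω, (φ x • (a.2 : E n → CVec n) x i + φ x • (b.2 : E n → CVec n) x i) := by
      apply integral_congr_ae
      filter_upwards [Lp.coeFn_add a.2 b.2] with x hx
      simp only [Prod.snd_add, hx, Pi.add_apply, PiLp.add_apply, smul_add]
    have hc := hφ.continuous_partialD i
    have hs := hφ.hasCompactSupport_partialD i
    rw [e1, e2, integral_add (integrable_smul_of_Lp hc hs a.1) (integrable_smul_of_Lp hc hs b.1),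
      integral_add (integrable_smul_apply_of_Lp hφ.1.continuous hφ.2.1 a.2 i)
        (integrable_smul_apply_of_Lp hφ.1.continuous hφ.2.1 b.2 i), ha φ hφ i, hb φ hφ i, neg_add]
  smul_mem' := by
    intro c a ha φ hφ i
    have e1 : ∫ x in Ω, partialD φ i x • ((c • a).1 : E n → ℂ) x
        = ∫ x in Ω, c * (partialD φ i x • (a.1 : E n → ℂ) x) := by
      apply integral_congr_ae
      filter_upwards [Lp.coeFn_smul c a.1] with x hx
      simp [hx, mul_left_comm]
    have e2 : ∫ x in Ω, φ x • ((c • a).2 : E n → CVec n) x i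
        = ∫ x in Ω, c * (φ x • (a.2 : E n → CVec n) x i) := by
      apply integral_congr_ae
      filter_upwards [Lp.coeFn_smul c a.2] with x hx
      simp [hx, mul_left_comm]
    rw [e1, e2, integral_const_mul, integral_const_mul, ha φ hφ i, mul_neg]

/-- The weak gradient `∇u` of `u ∈ W^{1,p}(Ω; ℂ)`. -/
def grad {n : ℕ} {Ω : Set (E n)} {p : ℝ} [Fact (1 < p)] (u : W1p Ω p) : E n → CVec n :=
  (u : LpPair Ω p).2

/-- The elements of `W^{1,p}(Ω; ℂ)` given by test functions in `C_c^∞(Ω; ℂ)`. -/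
def testSubmodule {n : ℕ} (Ω : Set (E n)) (p : ℝ) [Fact (1 < p)] : Submodule ℂ (W1p Ω p) where
  carrier := {w | ∃ φ : E n → ℂ, IsTest Ω φ ∧
    ((w : LpPair Ω p).1 : E n → ℂ) =ᵐ[volume.restrict Ω] φ ∧
    grad w =ᵐ[volume.restrict Ω] classicalGrad φ}
  zero_mem' := by
    refine ⟨0, ⟨contDiff_const, HasCompactSupport.zero, by simp⟩,
      Lp.coeFn_zero ℂ (ENNReal.ofReal p) (volume.restrict Ω), ?_⟩
    refine (Lp.coeFn_zero (CVec n) (ENNReal.ofReal p) (volume.restrict Ω)).trans (.of_forall ?_)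
    intro x
    ext i
    simp [classicalGrad, partialD]
  add_mem' := by
    rintro a b ⟨φ, hφ, a1, a2⟩ ⟨ψ, hψ, b1, b2⟩
    refine ⟨φ + ψ, ⟨hφ.1.add hψ.1, hφ.2.1.add hψ.2.1,
      (tsupport_add φ ψ).trans (union_subset hφ.2.2 hψ.2.2)⟩, ?_, ?_⟩
    · exact (Lp.coeFn_add _ _).trans (a1.add b1)
    · refine (Lp.coeFn_add _ _).trans ((a2.add b2).trans (.of_forall ?_))
      intro x
      ext i
      have h1 := (hφ.1.differentiable (by simp)) x
      have h2 := (hψ.1.differentiable (by simp)) x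
      simp [classicalGrad, partialD, fderiv_add h1 h2]
  smul_mem' := by
    rintro c a ⟨φ, hφ, a1, a2⟩
    refine ⟨c • φ, ⟨contDiff_const.smul hφ.1, hφ.2.1.smul_left (f := fun _ => c),
      (tsupport_smul_subset_right (fun _ => c) φ).trans hφ.2.2⟩, ?_, ?_⟩
    · exact (Lp.coeFn_smul _ _).trans (a1.const_smul c)
    · refine (Lp.coeFn_smul _ _).trans ((a2.const_smul c).trans (.of_forall ?_))
      intro x
      ext i
      have h1 := (hφ.1.differentiable (by simp)) x
      simp [classicalGrad, partialD, fderiv_const_smul h1 c]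

/-- `W^{1,p}_0(Ω; ℂ)`, the closure of `C_c^∞(Ω; ℂ)` in `W^{1,p}(Ω; ℂ)`. -/
def W1p0 {n : ℕ} (Ω : Set (E n)) (p : ℝ) [Fact (1 < p)] : Submodule ℂ (W1p Ω p) :=
  (testSubmodule Ω p).topologicalClosure

/-- The trace space `X = W^{1,p}(Ω; ℂ) / W^{1,p}_0(Ω; ℂ)` of boundary data, with the
quotient norm. -/
abbrev TraceSpace {n : ℕ} (Ω : Set (E n)) (p : ℝ) [Fact (1 < p)] : Type :=
  W1p Ω p ⧸ W1p0 Ω p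

/-- The boundary value `u|_{∂Ω} ∈ X` of `u ∈ W^{1,p}(Ω; ℂ)`. -/
def trace {n : ℕ} {Ω : Set (E n)} {p : ℝ} [Fact (1 < p)] (u : W1p Ω p) : TraceSpace Ω p :=
  Submodule.Quotient.mk u

/-- The (bilinear) form `∫_Ω γ |∇u|^{p-2} ∇u · ∇v dx`. -/
def energyPairing {n : ℕ} {Ω : Set (E n)} {p : ℝ} [Fact (1 < p)] (γ : E n → ℝ)
    (u v : W1p Ω p) : ℂ :=
  ∫ x in Ω, (γ x * ‖grad u x‖ ^ (p - 2)) • ∑ i, grad u x i * grad v x i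

/-- `u` is a weak solution of `div (γ |∇u|^{p-2} ∇u) = 0` in `Ω`. -/
def IsWeakSolution {n : ℕ} {Ω : Set (E n)} {p : ℝ} [Fact (1 < p)] (γ : E n → ℝ)
    (u : W1p Ω p) : Prop :=
  ∀ φ ∈ W1p0 Ω p, energyPairing γ u φ = 0

/-- `ℓ ∈ X'` is the current of the solution with boundary values `f`: there is a weak solution `u`
with `u|_{∂Ω} = f` such that `⟨ℓ, g⟩ = ∫_Ω γ |∇u|^{p-2} ∇u · ∇v dx` for every `g = v|_{∂Ω}`. -/
def IsCurrent {n : ℕ} {Ω : Set (E n)} {p : ℝ} [Fact (1 < p)] (γ : E n → ℝ)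
    (f : TraceSpace Ω p) (ℓ : StrongDual ℂ (TraceSpace Ω p)) : Prop :=
  ∃ u : W1p Ω p, trace u = f ∧ IsWeakSolution γ u ∧
    ∀ v : W1p Ω p, ℓ (trace v) = energyPairing γ u v

open Classical in
/-- The Dirichlet-to-Neumann map `Λ_γ^ℂ : X → X'` on complex valued boundary data, sending `f` to
the current of the solution with boundary values `f`. For the coefficients `γ` considered here
(measurable, bounded, and bounded below by a positive constant) the solution exists and is unique,
so that the first branch applies and pins the value. -/
def dnMap {n : ℕ} (Ω : Set (E n)) (p : ℝ) [Fact (1 < p)] (γ : E n → ℝ) :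
    TraceSpace Ω p → StrongDual ℂ (TraceSpace Ω p) := fun f =>
  if h : ∃ ℓ, IsCurrent γ f ℓ then h.choose else 0

end PCalderon

end

/-! The argument is variational. Testing the weak equation with the conjugate of the solution shows
that the real part of `⟨Λ_γ f, conj f⟩` is the energy `∫ γ |∇u_f|^p`, and by convexity a weak
solution minimizes the energy in its boundary class. Equal Dirichlet-to-Neumann maps therefore give
equal minimal energies for every boundary datum (`exists_solution_energy_le`).

Suppose `γ₁(x₀) > γ₂(x₀)` at a boundary point, and separate them by constants with `γ₂ ≤ b < a ≤ γ₁`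
near `x₀`. Take a datum `v` supported in a tiny ball around `x₀`, let `u` be the `γ₁`-solution with
this datum, and use `χ u` as a competitor for `γ₂`, where `χ` cuts off at a small fixed radius `r`.
Up to a factor `1 + κ`, the `γ₂`-energy of `χ u` is at most `b / a` times the `γ₁`-energy of `u`,
plus an error `∫ |u|^p |∇χ|^p`. If the error is small relative to the energy of `u`, the competitor
has strictly less energy than the common minimum, which is absurd. Exchanging the coefficients gives
equality.

The error is small for two reasons. A logarithmic cutoff has `|∇χ| ≤ ε / |x - x₀|`, up to
regularization (`exists_log_cutoff`). A Hardy inequality controls `|u|^p / |x - x₀|^p` on a shell by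
`|∇u|^p` (`exists_hardy`). Its constant must not depend on the inner radius `δ` of the shell,
because `δ` is chosen after `ε`, which depends on that constant. It follows from the divergence
theorem for a vector field tangent to the spheres around `x₀`: multiplying such a field by a radial
cutoff adds nothing to its divergence, so the weight costs nothing (`divergence_tangential`,
`exists_hardyField`). The divergence has a good sign on `Ω` because a `C¹` domain lies
asymptotically in a half space at `x₀`.

Finally, `u` must have positive energy. Elements of `W^{1,p}_0` have gradients of mean zero, so it
suffices that some derivative of `v` has nonzero integral over `Ω`. Such a `v` exists in every ball
around `x₀`, since both `Ω` and its exterior accumulate there (`exists_integral_partialD_ne_zero`).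
-/

noncomputable section

namespace PCalderon

/-! ### Pointwise inequalities for `‖·‖ ^ p`: Young, tangent, uniform convexity. -/

section Pointwise

variable {p : ℝ}

/-- Young's inequality in absorbing form: if `a` dominates `2 K b` the product is at most half of `a
^ p`, and otherwise `a` can be replaced by `2 K b`. It absorbs half of the left side in the Hardy
inequality. -/
lemma exists_mul_rpow_le_half (hp : 1 < p) {K : ℝ} (hK : 0 ≤ K) :
    ∃ C : ℝ, 0 ≤ C ∧ ∀ a b : ℝ, 0 ≤ a → 0 ≤ b →
      K * a ^ (p - 1) * b ≤ 1 / 2 * a ^ p + C * b ^ p := by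
  refine ⟨K * (2 * K) ^ (p - 1), by positivity, fun a b ha hb => ?_⟩
  rcases ha.eq_or_lt with rfl | ha
  · rw [Real.zero_rpow (by linarith), Real.zero_rpow (by linarith)]
    simp only [mul_zero, zero_mul, zero_add]
    positivity
  rcases hb.eq_or_lt with rfl | hb
  · simp only [mul_zero]
    positivity
  have e1 : a ^ p = a ^ (p - 1) * a := by
    rw [← Real.rpow_add_one ha.ne']; ring_nf
  have e2 : b ^ p = b ^ (p - 1) * b := by
    rw [← Real.rpow_add_one hb.ne']; ring_nf
  by_cases h : 2 * K * b ≤ a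
  · have h1 : 0 ≤ a ^ (p - 1) := by positivity
    have h2 : 0 ≤ K * (2 * K) ^ (p - 1) * b ^ p := by positivity
    rw [e1]
    nlinarith [mul_le_mul_of_nonneg_left h h1]
  · push Not at h
    have h1 : a ^ (p - 1) ≤ (2 * K * b) ^ (p - 1) :=
      Real.rpow_le_rpow ha.le h.le (by linarith)
    rw [Real.mul_rpow (by positivity) hb.le] at h1
    have h2 : 0 ≤ 1 / 2 * a ^ p := by positivity
    have h3 : K * a ^ (p - 1) * b ≤ K * ((2 * K) ^ (p - 1) * b ^ (p - 1)) * b := by gcongr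
    rw [e2]
    linarith

/-- The coefficient of `a ^ p` must be as close to one as desired, because the final comparison only
has the gap between two values of the coefficients to spend. Either `b ≤ τ a` with `(1 + τ) ^ p ≤ 1
+ κ`, or `a` is at most `b / τ`. -/
lemma exists_add_rpow_le (hp : 1 < p) {κ : ℝ} (hκ : 0 < κ) :
    ∃ C : ℝ, 0 ≤ C ∧ ∀ a b : ℝ, 0 ≤ a → 0 ≤ b → (a + b) ^ p ≤ (1 + κ) * a ^ p + C * b ^ p := by
  obtain ⟨τ, hτ, hτ1⟩ : ∃ τ : ℝ, 0 < τ ∧ (1 + τ) ^ p ≤ 1 + κ := by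
    have hc : Tendsto (fun τ : ℝ => (1 + τ) ^ p) (𝓝[>] 0) (𝓝 1) := by
      have : ContinuousAt (fun τ : ℝ => (1 + τ) ^ p) 0 :=
        (continuousAt_const.add continuousAt_id).rpow_const (Or.inr (by linarith))
      have h := this.tendsto
      simp only [add_zero, Real.one_rpow] at h
      exact h.mono_left nhdsWithin_le_nhds
    obtain ⟨τ, h1, h2⟩ := ((hc.eventually_le_const (show (1 : ℝ) < 1 + κ by linarith)).and
      self_mem_nhdsWithin).exists
    exact ⟨τ, h2, h1⟩
  refine ⟨(1 + 1 / τ) ^ p, by positivity, fun a b ha hb => ?_⟩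
  by_cases h : b ≤ τ * a
  · calc (a + b) ^ p ≤ ((1 + τ) * a) ^ p :=
          Real.rpow_le_rpow (by positivity) (by linarith) (by linarith)
      _ = (1 + τ) ^ p * a ^ p := Real.mul_rpow (by positivity) ha
      _ ≤ (1 + κ) * a ^ p := by gcongr
      _ ≤ _ := le_add_of_nonneg_right (by positivity)
  · push Not at h
    have h1 : a ≤ 1 / τ * b := by
      rw [one_div, ← div_eq_inv_mul, le_div_iff₀ hτ]; linarith
    calc (a + b) ^ p ≤ ((1 + 1 / τ) * b) ^ p :=
          Real.rpow_le_rpow (by positivity) (by linarith) (by linarith)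
      _ = (1 + 1 / τ) ^ p * b ^ p := Real.mul_rpow (by positivity) hb
      _ ≤ _ := le_add_of_nonneg_left (by positivity)

variable {F : Type*} [NormedAddCommGroup F]

lemma rpow_sub_two_mul_sq (hp : 1 < p) (t : ℝ) (ht : 0 ≤ t) : t ^ (p - 2) * t ^ 2 = t ^ p := by
  rcases ht.eq_or_lt with rfl | ht
  · rw [Real.zero_rpow (by linarith : p ≠ 0)]; simp
  · rw [← Real.rpow_natCast t 2, ← Real.rpow_add ht]; norm_num

lemma rpow_sub_two_mul_self (hp : 1 < p) (t : ℝ) (ht : 0 ≤ t) : t ^ (p - 2) * t = t ^ (p - 1) := by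
  rcases ht.eq_or_lt with rfl | ht
  · rw [Real.zero_rpow (by linarith : p - 1 ≠ 0)]; simp
  · rw [← Real.rpow_add_one ht.ne']; ring_nf

lemma rpow_sub_one_mul_le (hp : 1 < p) {a b : ℝ} (ha : 0 ≤ a) (hb : 0 ≤ b) :
    p * (b ^ (p - 1) * a) ≤ a ^ p + (p - 1) * b ^ p := by
  have hq : p.HolderConjugate (p / (p - 1)) := Real.HolderConjugate.conjExponent hp
  have h := Real.young_inequality_of_nonneg ha (Real.rpow_nonneg hb (p - 1)) hq
  have e : (b ^ (p - 1)) ^ (p / (p - 1)) = b ^ p := by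
    rw [← Real.rpow_mul hb]; congr 1; field_simp [(by linarith : p - 1 ≠ 0)]
  rw [e] at h
  have hp0 : 0 < p := by linarith
  have h2 := mul_le_mul_of_nonneg_left h hp0.le
  have e2 : p * (a ^ p / p + b ^ p / (p / (p - 1))) = a ^ p + (p - 1) * b ^ p := by
    have : p - 1 ≠ 0 := by linarith
    field_simp
  rw [e2] at h2
  linarith

open scoped InnerProductSpace in
/-- The tangent inequality for the convex function `‖·‖ ^ p`. -/
lemma norm_rpow_add_inner_le [InnerProductSpace ℝ F] (hp : 1 < p) (a b : F) :
    ‖b‖ ^ p + p * (‖b‖ ^ (p - 2) * ⟪b, a - b⟫_ℝ) ≤ ‖a‖ ^ p := by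
  have h1 : ‖b‖ ^ (p - 2) * ⟪b, a⟫_ℝ ≤ ‖b‖ ^ (p - 1) * ‖a‖ := by
    rw [← rpow_sub_two_mul_self hp _ (norm_nonneg b), mul_assoc]
    exact mul_le_mul_of_nonneg_left (real_inner_le_norm b a) (by positivity)
  have h2 := rpow_sub_one_mul_le hp (norm_nonneg a) (norm_nonneg b)
  have h3 := rpow_sub_two_mul_sq hp _ (norm_nonneg b)
  rw [inner_sub_right, real_inner_self_eq_norm_sq, mul_sub, h3]
  have hp0 : 0 < p := by linarith
  nlinarith [mul_le_mul_of_nonneg_left h1 hp0.le]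

/-- The convexity defect of `‖·‖ ^ p` at the midpoint. -/
def convexDefect [NormedSpace ℝ F] (p : ℝ) (a b : F) : ℝ :=
  1 / 2 * (‖a‖ ^ p + ‖b‖ ^ p) - ‖(1 / 2 : ℝ) • (a + b)‖ ^ p

lemma norm_half_add_le [NormedSpace ℝ F] (a b : F) :
    ‖(1 / 2 : ℝ) • (a + b)‖ ≤ 1 / 2 * ‖a‖ + 1 / 2 * ‖b‖ := by
  rw [norm_smul, Real.norm_of_nonneg (by norm_num), ← mul_add]
  gcongr
  exact norm_add_le a b

lemma convexDefect_nonneg [NormedSpace ℝ F] (hp : 1 < p) (a b : F) : 0 ≤ convexDefect p a b := by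
  have h1 := (convexOn_rpow hp.le).2 (norm_nonneg a) (norm_nonneg b)
    (by norm_num : (0 : ℝ) ≤ 1 / 2) (by norm_num : (0 : ℝ) ≤ 1 / 2) (by norm_num)
  simp only [smul_eq_mul] at h1
  have h2 : ‖(1 / 2 : ℝ) • (a + b)‖ ^ p ≤ (1 / 2 * ‖a‖ + 1 / 2 * ‖b‖) ^ p :=
    Real.rpow_le_rpow (norm_nonneg _) (norm_half_add_le a b) (by linarith)
  unfold convexDefect
  linarith

/-- If the norms differ, strict convexity of `t ↦ t ^ p` applies. If they agree, the midpoint of two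
distinct points of a sphere lies strictly inside it, since an inner product norm is strictly convex.
-/
lemma convexDefect_pos [InnerProductSpace ℝ F] (hp : 1 < p) {a b : F} (hab : a ≠ b) :
    0 < convexDefect p a b := by
  have h2 : ‖(1 / 2 : ℝ) • (a + b)‖ ^ p ≤ (1 / 2 * ‖a‖ + 1 / 2 * ‖b‖) ^ p :=
    Real.rpow_le_rpow (norm_nonneg _) (norm_half_add_le a b) (by linarith)
  by_cases hn : ‖a‖ = ‖b‖
  · have h3 : ‖(1 / 2 : ℝ) • (a + b)‖ < ‖a‖ := by
      rw [smul_add]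
      exact norm_combo_lt_of_ne le_rfl hn.symm.le hab (by norm_num) (by norm_num) (by norm_num)
    have h4 : ‖(1 / 2 : ℝ) • (a + b)‖ ^ p < ‖a‖ ^ p :=
      Real.rpow_lt_rpow (norm_nonneg _) h3 (by linarith)
    unfold convexDefect
    rw [← hn]
    linarith
  · have h1 := (strictConvexOn_rpow hp).2 (norm_nonneg a) (norm_nonneg b) hn
      (by norm_num : (0 : ℝ) < 1 / 2) (by norm_num : (0 : ℝ) < 1 / 2) (by norm_num)
    simp only [smul_eq_mul] at h1
    unfold convexDefect
    linarith

lemma continuous_convexDefect [NormedSpace ℝ F] (hp : 1 < p) :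
    Continuous fun z : F × F => convexDefect p z.1 z.2 := by
  unfold convexDefect
  have h : ∀ g : F × F → F, Continuous g → Continuous fun z => ‖g z‖ ^ p := fun g hg =>
    hg.norm.rpow_const fun _ => Or.inr (by linarith)
  exact (continuous_const.mul ((h _ continuous_fst).add (h _ continuous_snd))).sub
    (h _ (continuous_const.smul (continuous_fst.add continuous_snd)))

lemma convexDefect_smul [NormedSpace ℝ F] {t : ℝ} (ht : 0 ≤ t) (a b : F) :
    convexDefect p (t • a) (t • b) = t ^ p * convexDefect p a b := by
  unfold convexDefect
  rw [← smul_add, smul_comm, norm_smul, norm_smul, norm_smul t ((1 / 2 : ℝ) • (a + b)),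
    Real.norm_of_nonneg ht, Real.mul_rpow ht (norm_nonneg _), Real.mul_rpow ht (norm_nonneg _),
    Real.mul_rpow ht (norm_nonneg _)]
  ring

/-- Uniform convexity of `‖·‖ ^ p`, in a form that is integrated easily. -/
lemma exists_norm_sub_rpow_le [InnerProductSpace ℝ F] [FiniteDimensional ℝ F] (hp : 1 < p)
    {ε : ℝ} (hε : 0 < ε) :
    ∃ C : ℝ, 0 ≤ C ∧ ∀ a b : F,
      ‖a - b‖ ^ p ≤ ε * (‖a‖ ^ p + ‖b‖ ^ p) + C * convexDefect p a b := by
  have hp0 : 0 < p := by linarith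
  -- Both sides are homogeneous of degree `p`, so unit vectors of `F × F` suffice. On the compact
  -- part where `‖a - b‖ ^ p ≥ ε` the defect has a positive minimum `d`. Elsewhere the `ε` term
  -- alone suffices, because the maximum norm being one forces `‖a‖ ^ p + ‖b‖ ^ p ≥ 1`.
  set K : Set (F × F) := Metric.sphere 0 1 ∩ {z | ε ≤ ‖z.1 - z.2‖ ^ p} with hK
  have hKc : IsCompact K := by
    refine (isCompact_sphere _ _).inter_right (isClosed_le continuous_const ?_)
    exact (continuous_fst.sub continuous_snd).norm.rpow_const fun _ => Or.inr hp0.le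
  obtain ⟨d, hd, hdK⟩ : ∃ d : ℝ, 0 < d ∧ ∀ z ∈ K, d ≤ convexDefect p z.1 z.2 := by
    rcases K.eq_empty_or_nonempty with he | hne
    · exact ⟨1, one_pos, by simp [he]⟩
    · obtain ⟨z, hz, hmin⟩ := hKc.exists_isMinOn hne (continuous_convexDefect hp).continuousOn
      refine ⟨_, convexDefect_pos hp (a := z.1) (b := z.2) ?_, fun w hw => hmin hw⟩
      intro h
      have := hz.2
      simp only [mem_ofPred_eq, h, sub_self, norm_zero, Real.zero_rpow hp0.ne'] at this
      linarith
  -- On the unit sphere `‖a - b‖ ≤ 2`, so the defect times `2 ^ p / d` already dominates.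
  refine ⟨2 ^ p / d, by positivity, ?_⟩
  have key : ∀ z : F × F, ‖z‖ = 1 → ‖z.1 - z.2‖ ^ p ≤
      ε * (‖z.1‖ ^ p + ‖z.2‖ ^ p) + 2 ^ p / d * convexDefect p z.1 z.2 := by
    intro z hz
    have h1 : ‖z.1‖ ≤ 1 := hz ▸ norm_fst_le z
    have h2 : ‖z.2‖ ≤ 1 := hz ▸ norm_snd_le z
    by_cases h : ε ≤ ‖z.1 - z.2‖ ^ p
    · have h3 := hdK z ⟨by simpa using hz, h⟩
      have h4 : ‖z.1 - z.2‖ ^ p ≤ 2 ^ p :=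
        Real.rpow_le_rpow (norm_nonneg _) ((norm_sub_le _ _).trans (by linarith)) hp0.le
      have h5 : 2 ^ p ≤ 2 ^ p / d * convexDefect p z.1 z.2 := by
        rw [div_mul_eq_mul_div, le_div_iff₀ hd]
        gcongr
      have : 0 ≤ ε * (‖z.1‖ ^ p + ‖z.2‖ ^ p) := by positivity
      linarith
    · push Not at h
      have h3 : 1 ≤ ‖z.1‖ ^ p + ‖z.2‖ ^ p := by
        have h5 : 0 ≤ ‖z.1‖ ^ p := by positivity
        have h6 : 0 ≤ ‖z.2‖ ^ p := by positivity
        rw [Prod.norm_def] at hz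
        rcases max_choice ‖z.1‖ ‖z.2‖ with h4 | h4 <;> rw [h4] at hz
        · rw [hz, Real.one_rpow] at *; linarith
        · rw [hz, Real.one_rpow] at *; linarith
      have h4 := convexDefect_nonneg hp z.1 z.2
      have : 0 ≤ 2 ^ p / d * convexDefect p z.1 z.2 := by positivity
      nlinarith
  intro a b
  by_cases h0 : ‖(a, b)‖ = 0
  · rw [norm_eq_zero, Prod.mk_eq_zero] at h0
    simp [h0.1, h0.2, convexDefect, Real.zero_rpow hp0.ne']
  set t := ‖(a, b)‖ with ht
  have htp : 0 < t := lt_of_le_of_ne (norm_nonneg _) (Ne.symm h0)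
  have h := key (t⁻¹ • (a, b)) (by rw [norm_smul, norm_inv, norm_norm, inv_mul_cancel₀ h0])
  simp only [Prod.smul_fst, Prod.smul_snd] at h
  have hti : 0 ≤ t⁻¹ := by positivity
  rw [convexDefect_smul hti, ← smul_sub, norm_smul, norm_smul, norm_smul, Real.norm_of_nonneg hti,
    Real.mul_rpow hti (norm_nonneg _), Real.mul_rpow hti (norm_nonneg _),
    Real.mul_rpow hti (norm_nonneg _)] at h
  have htp' : 0 < t⁻¹ ^ p := by positivity
  refine le_of_mul_le_mul_left ?_ htp'
  linarith

lemma rpow_sub_two_mul_mul_le (hp : 1 < p) {a b : ℝ} (ha : 0 ≤ a) (hb : 0 ≤ b) :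
    a ^ (p - 2) * (a * b) ≤ a ^ p + b ^ p := by
  have h := rpow_sub_one_mul_le hp hb ha
  have h2 : 0 ≤ a ^ p := by positivity
  have h3 : 0 ≤ b ^ p := by positivity
  have h4 : 0 ≤ a ^ (p - 1) * b := by positivity
  rw [← mul_assoc, rpow_sub_two_mul_self hp a ha]
  by_contra! hcon
  nlinarith

/-- For `p < 2` the factor `‖a‖ ^ (p - 2)` blows up near zero, but the product is `1 / p` times a
directional derivative of `‖·‖ ^ p`, which is `C¹` for `p > 1`. -/
lemma continuous_norm_rpow_mul_inner [InnerProductSpace ℝ F]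
    (hp : 1 < p) (b : F) : Continuous fun a : F => ‖a‖ ^ (p - 2) * inner ℝ a b := by
  have hp0 : p ≠ 0 := by linarith
  have h1 : Continuous fun a : F => fderiv ℝ (fun x : F => ‖x‖ ^ p) a b :=
    ((contDiff_norm_rpow hp).continuous_fderiv (by simp)).clm_apply continuous_const
  refine (h1.const_smul p⁻¹).congr fun a => ?_
  rw [Pi.smul_apply, fderiv_norm_rpow a hp]
  simp only [smul_apply, innerSL_apply_apply, smul_eq_mul]
  field_simp

end Pointwise

/-! ### Weighted `p`-energies on `L^p`. -/

section LpEnergy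

variable {α : Type*} [MeasurableSpace α] {μ : Measure α} {F : Type*} [NormedAddCommGroup F]
  {p : ℝ} [hp : Fact (1 < p)]

lemma ofReal_ne_zero_of_fact : ENNReal.ofReal p ≠ 0 := by
  have := hp.out
  simp only [ne_eq, ENNReal.ofReal_eq_zero, not_le]; linarith

lemma toReal_ofReal_of_fact : (ENNReal.ofReal p).toReal = p :=
  ENNReal.toReal_ofReal (by have := hp.out; linarith)

lemma integrable_norm_rpow_of_memLp {f : α → F} (hf : MemLp f (ENNReal.ofReal p) μ) :
    Integrable (fun x => ‖f x‖ ^ p) μ := by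
  have := hf.integrable_norm_rpow ofReal_ne_zero_of_fact ENNReal.ofReal_ne_top
  rwa [toReal_ofReal_of_fact] at this

lemma integrable_weight_mul_norm_rpow {q : α → ℝ} {M : ℝ} (hq : AEStronglyMeasurable q μ)
    (hM : ∀ᵐ x ∂μ, ‖q x‖ ≤ M) {f : α → F} (hf : MemLp f (ENNReal.ofReal p) μ) :
    Integrable (fun x => q x * ‖f x‖ ^ p) μ :=
  (integrable_norm_rpow_of_memLp hf).bdd_mul hq hM

lemma norm_rpow_eq_integral (f : Lp F (ENNReal.ofReal p) μ) : ‖f‖ ^ p = ∫ x, ‖f x‖ ^ p ∂μ := by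
  have h0 : 0 ≤ ∫ x, ‖f x‖ ^ p ∂μ := integral_nonneg fun x => by positivity
  rw [Lp.norm_def, (Lp.memLp f).eLpNorm_eq_integral_rpow_norm ofReal_ne_zero_of_fact
    ENNReal.ofReal_ne_top, toReal_ofReal_of_fact (p := p), ENNReal.toReal_ofReal (by positivity),
    ← Real.rpow_mul h0, inv_mul_cancel₀ (by have := hp.out; linarith), Real.rpow_one]

variable [NormedSpace ℝ F]

/-- Multiplication by `q ^ (1 / p)` is a bounded operator `T` on `L^p`, and the integral is `‖T f‖ ^
p`. -/
lemma continuous_integral_weight_mul_norm_rpow {q : α → ℝ} {M : ℝ} (hq : AEStronglyMeasurable q μ)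
    (hM : ∀ᵐ x ∂μ, ‖q x‖ ≤ M) (h0 : ∀ᵐ x ∂μ, 0 ≤ q x) :
    Continuous fun f : Lp F (ENNReal.ofReal p) μ => ∫ x, q x * ‖f x‖ ^ p ∂μ := by
  have hp0 : 0 < p := by have := hp.out; linarith
  have hm : AEStronglyMeasurable (fun x => q x ^ (1 / p)) μ :=
    (hq.aemeasurable.pow_const _).aestronglyMeasurable
  have hb : MemLp (fun x => q x ^ (1 / p)) ∞ μ := by
    refine memLp_top_of_bound hm (M ^ (1 / p)) ?_
    filter_upwards [hM, h0] with x h1 h2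
    rw [Real.norm_of_nonneg (by positivity)]
    rw [Real.norm_of_nonneg h2] at h1
    exact Real.rpow_le_rpow h2 h1 (by positivity)
  let T : Lp F (ENNReal.ofReal p) μ →L[ℝ] Lp F (ENNReal.ofReal p) μ :=
    (ContinuousLinearMap.lsmul ℝ ℝ : ℝ →L[ℝ] F →L[ℝ] F).holderL μ ∞ (ENNReal.ofReal p)
      (ENNReal.ofReal p) (hb.toLp _)
  have hT : ∀ f, ∫ x, q x * ‖f x‖ ^ p ∂μ = ‖T f‖ ^ p := by
    intro f
    rw [norm_rpow_eq_integral]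
    apply integral_congr_ae
    filter_upwards [ContinuousLinearMap.coeFn_holder (r := ENNReal.ofReal p)
      (ContinuousLinearMap.lsmul ℝ ℝ : ℝ →L[ℝ] F →L[ℝ] F) (hb.toLp _) f, hb.coeFn_toLp, h0]
      with x h1 h2 h3
    have : T f x = (q x ^ (1 / p)) • f x := by
      rw [← h2]; exact h1
    rw [this, norm_smul, Real.norm_of_nonneg (by positivity),
      Real.mul_rpow (by positivity) (norm_nonneg _), ← Real.rpow_mul h3, one_div,
      inv_mul_cancel₀ hp0.ne', Real.rpow_one]
  simp_rw [hT]
  exact T.continuous.norm.rpow_const fun _ => Or.inr hp0.le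

end LpEnergy

/-! ### Weak gradients, smooth elements of `W^{1,p}`, and `W^{1,p}_0` as a closure. -/

section Basic

variable {n : ℕ} {Ω : Set (E n)} {p : ℝ} [hp : Fact (1 < p)]


/-- The function underlying `u ∈ W^{1,p}(Ω; ℂ)`. -/
def val (u : W1p Ω p) : E n → ℂ := (u : LpPair Ω p).1

lemma memLp_val (u : W1p Ω p) : MemLp (val u) (ENNReal.ofReal p) (volume.restrict Ω) :=
  Lp.memLp _

lemma memLp_grad (u : W1p Ω p) : MemLp (grad u) (ENNReal.ofReal p) (volume.restrict Ω) :=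
  Lp.memLp _

lemma val_sub (u v : W1p Ω p) : val (u - v) =ᵐ[volume.restrict Ω] fun x => val u x - val v x :=
  Lp.coeFn_sub _ _

lemma grad_sub (u v : W1p Ω p) :
    grad (u - v) =ᵐ[volume.restrict Ω] fun x => grad u x - grad v x :=
  Lp.coeFn_sub _ _

lemma grad_add (u v : W1p Ω p) :
    grad (u + v) =ᵐ[volume.restrict Ω] fun x => grad u x + grad v x :=
  Lp.coeFn_add _ _

lemma grad_smul (c : ℂ) (u : W1p Ω p) :
    grad (c • u) =ᵐ[volume.restrict Ω] fun x => c • grad u x :=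
  Lp.coeFn_smul _ _

lemma IsWeakGrad.congr {u u' : E n → ℂ} {G G' : E n → CVec n} (h : IsWeakGrad Ω u G)
    (hu : u' =ᵐ[volume.restrict Ω] u) (hG : G' =ᵐ[volume.restrict Ω] G) : IsWeakGrad Ω u' G' := by
  intro φ hφ i
  have e1 : ∫ x in Ω, partialD φ i x • u' x = ∫ x in Ω, partialD φ i x • u x :=
    integral_congr_ae (by filter_upwards [hu] with x hx; rw [hx])
  have e2 : ∫ x in Ω, φ x • G' x i = ∫ x in Ω, φ x • G x i :=
    integral_congr_ae (by filter_upwards [hG] with x hx; rw [hx])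
  rw [e1, e2, h φ hφ i]

lemma continuous_partialD {F : Type*} [NormedAddCommGroup F] [NormedSpace ℝ F] {φ : E n → F}
    (h : ContDiff ℝ 1 φ) (i : Fin n) : Continuous (partialD φ i) :=
  (h.continuous_fderiv (by simp)).clm_apply continuous_const

lemma hasCompactSupport_partialD {F : Type*} [NormedAddCommGroup F] [NormedSpace ℝ F]
    {φ : E n → F} (h : HasCompactSupport φ) (i : Fin n) : HasCompactSupport (partialD φ i) :=
  h.fderiv_apply ℝ _

lemma continuous_classicalGrad {φ : E n → ℂ} (h : ContDiff ℝ 1 φ) :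
    Continuous (classicalGrad φ) :=
  (PiLp.continuous_toLp 2 _).comp (continuous_pi fun i => continuous_partialD h i)

lemma hasCompactSupport_classicalGrad {φ : E n → ℂ} (h : HasCompactSupport φ) :
    HasCompactSupport (classicalGrad φ) := by
  refine (h.fderiv (𝕜 := ℝ)).mono fun x hx => ?_
  rw [Function.mem_support] at hx ⊢
  contrapose! hx
  ext i
  simp [classicalGrad, partialD, hx]

lemma partialD_mul {φ χ : E n → ℝ} (hφ : ContDiff ℝ 1 φ) (hχ : ContDiff ℝ 1 χ) (i : Fin n)
    (x : E n) : partialD (fun y => φ y * χ y) i x = partialD φ i x * χ x + φ x * partialD χ i x := by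
  unfold partialD
  rw [fderiv_fun_mul (hφ.differentiable (by simp) x) (hχ.differentiable (by simp) x)]
  simp only [add_apply, smul_apply, smul_eq_mul]
  ring

lemma setIntegral_eq_integral_of_tsupport {F G : Type*} [NormedAddCommGroup F] [NormedSpace ℝ F]
    [Zero G]
    {φ : E n → G} (hφ : tsupport φ ⊆ Ω) {f : E n → F} (hf : ∀ x, x ∉ tsupport φ → f x = 0) :
    ∫ x in Ω, f x = ∫ x, f x :=
  setIntegral_eq_integral_of_forall_compl_eq_zero fun x hx => hf x fun h => hx (hφ h)

lemma partialD_eq_zero_of_notMem_tsupport {F : Type*} [NormedAddCommGroup F] [NormedSpace ℝ F]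
    {φ : E n → F} {x : E n} (hx : x ∉ tsupport φ) (i : Fin n) : partialD φ i x = 0 := by
  have : fderiv ℝ φ x = 0 := by
    by_contra h
    exact hx (support_fderiv_subset ℝ (Function.mem_support.2 h))
  simp [partialD, this]

/-- Integration by parts against a compactly supported function. -/
lemma integral_smul_partialD {F : Type*} [NormedAddCommGroup F] [NormedSpace ℝ F] {f : E n → ℝ}
    {g : E n → F} (hf : ContDiff ℝ 1 f) (hg : ContDiff ℝ 1 g) (hfc : HasCompactSupport f)
    (i : Fin n) : ∫ x, partialD f i x • g x = - ∫ x, f x • partialD g i x := by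
  rw [eq_neg_iff_add_eq_zero, add_comm, ← eq_neg_iff_add_eq_zero]
  refine integral_smul_fderiv_eq_neg_fderiv_smul_of_integrable ?_ ?_ ?_
    (fun x _ => hf.differentiable (by simp) x) (fun x _ => hg.differentiable (by simp) x)
  · exact ((continuous_partialD hf i).smul hg.continuous).integrable_of_hasCompactSupport
      ((hasCompactSupport_partialD hfc i).smul_right)
  · exact (hf.continuous.smul (continuous_partialD hg i)).integrable_of_hasCompactSupport
      (hfc.smul_right)
  · exact (hf.continuous.smul hg.continuous).integrable_of_hasCompactSupport hfc.smul_right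

lemma isWeakGrad_classicalGrad {v : E n → ℂ} (hv : ContDiff ℝ 1 v) :
    IsWeakGrad Ω v (classicalGrad v) := by
  intro φ hφ i
  rw [setIntegral_eq_integral_of_tsupport hφ.2.2, setIntegral_eq_integral_of_tsupport hφ.2.2]
  · exact integral_smul_partialD (hφ.1.of_le (by simp)) hv hφ.2.1 i
  · intro x hx; rw [image_eq_zero_of_notMem_tsupport hx, zero_smul]
  · intro x hx; rw [partialD_eq_zero_of_notMem_tsupport hx, zero_smul]

lemma memLp_restrict_of_continuous {F : Type*} [NormedAddCommGroup F] {f : E n → F} {q : ℝ≥0∞}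
    (hf : Continuous f) (hc : HasCompactSupport f) : MemLp f q (volume.restrict Ω) :=
  (hf.memLp_of_hasCompactSupport hc).restrict Ω

/-- The element of `W^{1,p}(Ω; ℂ)` given by a compactly supported `C^∞` function on `ℝⁿ`. -/
def ofSmooth (Ω : Set (E n)) (p : ℝ) [Fact (1 < p)] (v : E n → ℂ) (hv : ContDiff ℝ ∞ v)
    (hc : HasCompactSupport v) : W1p Ω p :=
  have h1 : ContDiff ℝ 1 v := hv.of_le (by simp)
  have h2 : MemLp v (ENNReal.ofReal p) (volume.restrict Ω) :=
    memLp_restrict_of_continuous hv.continuous hc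
  have h3 : MemLp (classicalGrad v) (ENNReal.ofReal p) (volume.restrict Ω) :=
    memLp_restrict_of_continuous (continuous_classicalGrad h1) (hasCompactSupport_classicalGrad hc)
  ⟨(h2.toLp v, h3.toLp (classicalGrad v)),
    (isWeakGrad_classicalGrad h1).congr h2.coeFn_toLp h3.coeFn_toLp⟩

lemma val_ofSmooth {v : E n → ℂ} (hv : ContDiff ℝ ∞ v) (hc : HasCompactSupport v) :
    val (ofSmooth Ω p v hv hc) =ᵐ[volume.restrict Ω] v :=
  (memLp_restrict_of_continuous hv.continuous hc).coeFn_toLp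

lemma grad_ofSmooth {v : E n → ℂ} (hv : ContDiff ℝ ∞ v) (hc : HasCompactSupport v) :
    grad (ofSmooth Ω p v hv hc) =ᵐ[volume.restrict Ω] classicalGrad v :=
  (memLp_restrict_of_continuous (continuous_classicalGrad (hv.of_le (by simp)))
    (hasCompactSupport_classicalGrad hc)).coeFn_toLp

/-- A closed condition which holds for test functions holds in `W^{1,p}_0`. -/
lemma W1p0_induction {P : W1p Ω p → Prop} (hP : IsClosed {u | P u})
    (h : ∀ u ∈ testSubmodule Ω p, P u) : ∀ u ∈ W1p0 Ω p, P u := fun _ hu =>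
  closure_minimal (s := (testSubmodule Ω p : Set (W1p Ω p))) (t := {u | P u}) h hP hu

lemma mapsTo_W1p0 {T : W1p Ω p → W1p Ω p} (hT : Continuous T)
    (h : ∀ u ∈ testSubmodule Ω p, T u ∈ testSubmodule Ω p) : ∀ u ∈ W1p0 Ω p, T u ∈ W1p0 Ω p :=
  fun _ hu => map_mem_closure hT hu h

lemma isClosed_W1p0 : IsClosed (W1p0 Ω p : Set (W1p Ω p)) :=
  Submodule.isClosed_topologicalClosure _

lemma trace_eq_trace_iff {u v : W1p Ω p} : trace u = trace v ↔ u - v ∈ W1p0 Ω p :=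
  Submodule.Quotient.eq _

end Basic

/-! ### Complex conjugation on `W^{1,p}`. -/

section Conj

variable {n : ℕ} {Ω : Set (E n)} {p : ℝ} [hp : Fact (1 < p)]

/-- Componentwise complex conjugation on `ℂⁿ`. -/
def conjVec (n : ℕ) : CVec n →L[ℝ] CVec n :=
  LinearMap.toContinuousLinearMap
    { toFun := fun z => WithLp.toLp 2 fun i => starRingEnd ℂ (z i)
      map_add' := fun a b => by ext i; simp
      map_smul' := fun c a => by ext i; simp }

lemma conjVec_apply (z : CVec n) (i : Fin n) : conjVec n z i = starRingEnd ℂ (z i) := rfl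

lemma conjVec_conjVec (z : CVec n) : conjVec n (conjVec n z) = z := by
  ext i; simp [conjVec_apply]

/-- Complex conjugation on pairs of `L^p` functions. -/
def conjPair (Ω : Set (E n)) (p : ℝ) [Fact (1 < p)] : LpPair Ω p →L[ℝ] LpPair Ω p :=
  (ContinuousLinearMap.compLpL _ _ Complex.conjCLE.toContinuousLinearMap).prodMap
    (ContinuousLinearMap.compLpL _ _ (conjVec n))

lemma conjPair_fst (w : LpPair Ω p) :
    ((conjPair Ω p w).1 : E n → ℂ) =ᵐ[volume.restrict Ω] fun x => starRingEnd ℂ (w.1 x) :=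
  ContinuousLinearMap.coeFn_compLpL _ _

lemma conjPair_snd (w : LpPair Ω p) :
    ((conjPair Ω p w).2 : E n → CVec n) =ᵐ[volume.restrict Ω] fun x => conjVec n (w.2 x) :=
  ContinuousLinearMap.coeFn_compLpL _ _

lemma IsWeakGrad.conj {u : E n → ℂ} {G : E n → CVec n} (h : IsWeakGrad Ω u G) :
    IsWeakGrad Ω (fun x => starRingEnd ℂ (u x)) (fun x => conjVec n (G x)) := by
  intro φ hφ i
  have := congrArg (starRingEnd ℂ) (h φ hφ i)
  rw [map_neg, ← integral_conj, ← integral_conj] at this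
  simpa [conjVec_apply] using this

/-- Complex conjugation on `W^{1,p}(Ω; ℂ)`. -/
def conj (u : W1p Ω p) : W1p Ω p :=
  ⟨conjPair Ω p u, (IsWeakGrad.conj u.2).congr (conjPair_fst _) (conjPair_snd _)⟩

lemma grad_conj (u : W1p Ω p) :
    grad (conj u) =ᵐ[volume.restrict Ω] fun x => conjVec n (grad u x) :=
  conjPair_snd _

lemma val_conj (u : W1p Ω p) :
    val (conj u) =ᵐ[volume.restrict Ω] fun x => starRingEnd ℂ (val u x) :=
  conjPair_fst _

lemma continuous_conj : Continuous (conj : W1p Ω p → W1p Ω p) :=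
  ((conjPair Ω p).continuous.comp continuous_subtype_val).subtype_mk _

lemma conj_sub (u v : W1p Ω p) : conj (u - v) = conj u - conj v :=
  Subtype.ext (map_sub (conjPair Ω p) (u : LpPair Ω p) v)

lemma IsTest.conj {φ : E n → ℂ} (h : IsTest Ω φ) : IsTest Ω fun x => starRingEnd ℂ (φ x) := by
  have hs : Function.support (fun x => starRingEnd ℂ (φ x)) = Function.support φ := by
    ext x; simp
  have ht : tsupport (fun x => starRingEnd ℂ (φ x)) = tsupport φ := by
    rw [tsupport, hs, tsupport]
  exact ⟨Complex.conjCLE.contDiff.comp h.1, by unfold HasCompactSupport; rw [ht]; exact h.2.1,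
    by rw [ht]; exact h.2.2⟩

lemma classicalGrad_conj {φ : E n → ℂ} (h : ContDiff ℝ 1 φ) (x : E n) :
    classicalGrad (fun x => starRingEnd ℂ (φ x)) x = conjVec n (classicalGrad φ x) := by
  ext i
  have : HasFDerivAt (fun x => starRingEnd ℂ (φ x))
      (Complex.conjCLE.toContinuousLinearMap.comp (fderiv ℝ φ x)) x :=
    Complex.conjCLE.toContinuousLinearMap.hasFDerivAt.comp x
      (h.differentiable (by simp) x).hasFDerivAt
  simp [classicalGrad, partialD, conjVec_apply, this.fderiv]

/-- The pairing is bilinear, so real inner products of gradients appear only after conjugating the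
second argument. Weak equations can be tested with conjugates because of this lemma. -/
lemma conj_mem_W1p0 {u : W1p Ω p} (hu : u ∈ W1p0 Ω p) : conj u ∈ W1p0 Ω p := by
  refine mapsTo_W1p0 continuous_conj ?_ u hu
  rintro u ⟨φ, hφ, h1, h2⟩
  refine ⟨_, hφ.conj, (val_conj u).trans ?_, (grad_conj u).trans ?_⟩
  · filter_upwards [h1] with x hx
    rw [← hx]; rfl
  · filter_upwards [h2] with x hx
    rw [hx, classicalGrad_conj (hφ.1.of_le (by simp))]

end Conj

/-! ### Multiplication by smooth cutoff functions. -/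

section Mul

variable {n : ℕ} {Ω : Set (E n)} {p : ℝ} [hp : Fact (1 < p)]

lemma contDiff_ofReal {k : WithTop ℕ∞} {χ : E n → ℝ} (h : ContDiff ℝ k χ) :
    ContDiff ℝ k fun x => (χ x : ℂ) :=
  Complex.ofRealCLM.contDiff.comp h

lemma partialD_ofReal {χ : E n → ℝ} (h : ContDiff ℝ 1 χ) (i : Fin n) (x : E n) :
    partialD (fun x => (χ x : ℂ)) i x = ((partialD χ i x : ℝ) : ℂ) := by
  have : HasFDerivAt (fun x => (χ x : ℂ)) (Complex.ofRealCLM.comp (fderiv ℝ χ x)) x :=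
    Complex.ofRealCLM.hasFDerivAt.comp x (h.differentiable (by simp) x).hasFDerivAt
  simp [partialD, this.fderiv]

lemma hasCompactSupport_ofReal {χ : E n → ℝ} (h : HasCompactSupport χ) :
    HasCompactSupport fun x => (χ x : ℂ) :=
  h.comp_left (g := fun r : ℝ => (r : ℂ)) Complex.ofReal_zero

lemma memLp_top_of_continuous {F : Type*} [NormedAddCommGroup F] {f : E n → F}
    (hf : Continuous f) (hc : HasCompactSupport f) : MemLp f ⊤ (volume.restrict Ω) :=
  memLp_restrict_of_continuous hf hc

/-- Multiplication of a pair `(u, G)` by `χ` according to the product rule: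
`(χ u, χ G + u ∇χ)`. -/
def mulPair (Ω : Set (E n)) (p : ℝ) [Fact (1 < p)] (χ : E n → ℝ) (hχ : ContDiff ℝ ∞ χ)
    (hc : HasCompactSupport χ) : LpPair Ω p →L[ℂ] LpPair Ω p :=
  have h1 : ContDiff ℝ 1 fun x => (χ x : ℂ) := contDiff_ofReal (hχ.of_le (by simp))
  have hc' := hasCompactSupport_ofReal hc
  let X : Lp ℂ ⊤ (volume.restrict Ω) := (memLp_top_of_continuous h1.continuous hc').toLp _
  let Y : Lp (CVec n) ⊤ (volume.restrict Ω) :=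
    (memLp_top_of_continuous (continuous_classicalGrad h1)
      (hasCompactSupport_classicalGrad hc')).toLp _
  ContinuousLinearMap.prod
    (((ContinuousLinearMap.lsmul ℂ ℂ : ℂ →L[ℂ] ℂ →L[ℂ] ℂ).holderL _ ⊤ (ENNReal.ofReal p)
      (ENNReal.ofReal p) X).comp (ContinuousLinearMap.fst ℂ _ _))
    ((((ContinuousLinearMap.lsmul ℂ ℂ : ℂ →L[ℂ] CVec n →L[ℂ] CVec n).holderL _ ⊤ (ENNReal.ofReal p)
      (ENNReal.ofReal p) X).comp (ContinuousLinearMap.snd ℂ _ _)) +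
    (((ContinuousLinearMap.lsmul ℂ ℂ : ℂ →L[ℂ] CVec n →L[ℂ] CVec n).flip.holderL _ ⊤
      (ENNReal.ofReal p) (ENNReal.ofReal p) Y).comp (ContinuousLinearMap.fst ℂ _ _)))

variable {χ : E n → ℝ} (hχ : ContDiff ℝ ∞ χ) (hc : HasCompactSupport χ)

lemma mulPair_fst (w : LpPair Ω p) :
    ((mulPair Ω p χ hχ hc w).1 : E n → ℂ) =ᵐ[volume.restrict Ω] fun x => (χ x : ℂ) * w.1 x := by
  have h1 : ContDiff ℝ 1 fun x => (χ x : ℂ) := contDiff_ofReal (hχ.of_le (by simp))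
  have hX := (memLp_top_of_continuous (Ω := Ω) h1.continuous
    (hasCompactSupport_ofReal hc)).coeFn_toLp
  refine (ContinuousLinearMap.coeFn_holder _ _ _).trans ?_
  filter_upwards [hX] with x hx
  rw [hx]; rfl

lemma mulPair_snd (w : LpPair Ω p) :
    ((mulPair Ω p χ hχ hc w).2 : E n → CVec n) =ᵐ[volume.restrict Ω]
      fun x => (χ x : ℂ) • w.2 x + w.1 x • classicalGrad (fun y => (χ y : ℂ)) x := by
  have h1 : ContDiff ℝ 1 fun x => (χ x : ℂ) := contDiff_ofReal (hχ.of_le (by simp))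
  have hc' := hasCompactSupport_ofReal hc
  have hX := (memLp_top_of_continuous (Ω := Ω) h1.continuous hc').coeFn_toLp
  have hY := (memLp_top_of_continuous (Ω := Ω) (continuous_classicalGrad h1)
    (hasCompactSupport_classicalGrad hc')).coeFn_toLp
  refine (Lp.coeFn_add _ _).trans ?_
  refine (Filter.EventuallyEq.add (ContinuousLinearMap.coeFn_holder _ _ _)
    (ContinuousLinearMap.coeFn_holder _ _ _)).trans ?_
  filter_upwards [hX, hY] with x hx hy
  rw [Pi.add_apply, hx, hy]; rfl

lemma IsTest.mul_real {φ : E n → ℝ} (hφ : IsTest Ω φ) (hχ : ContDiff ℝ ∞ χ) :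
    IsTest Ω fun x => φ x * χ x :=
  ⟨hφ.1.mul hχ, hφ.2.1.mul_right, (tsupport_mul_subset_left).trans hφ.2.2⟩

/-- Testing the weak gradient of `w` with `φ χ` instead of `φ` and expanding `∂ᵢ(φ χ)` produces
exactly the two terms of the product rule. -/
lemma isWeakGrad_mulPair {w : LpPair Ω p} (h : IsWeakGrad Ω w.1 w.2) :
    IsWeakGrad Ω (mulPair Ω p χ hχ hc w).1 (mulPair Ω p χ hχ hc w).2 := by
  refine IsWeakGrad.congr ?_ (mulPair_fst hχ hc w) (mulPair_snd hχ hc w)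
  intro φ hφ i
  have hφ1 : ContDiff ℝ 1 φ := hφ.1.of_le (by simp)
  have hχ1 : ContDiff ℝ 1 χ := hχ.of_le (by simp)
  have key := h _ (hφ.mul_real hχ) i
  have ht := hφ.mul_real hχ
  have i0 : Integrable (fun x => partialD (fun y => φ y * χ y) i x • w.1 x) (volume.restrict Ω) :=
    integrable_smul_of_Lp (ht.continuous_partialD i) (ht.hasCompactSupport_partialD i) w.1
  have i1 : Integrable (fun x => (φ x * partialD χ i x) • w.1 x) (volume.restrict Ω) :=
    integrable_smul_of_Lp (hφ.1.continuous.mul (continuous_partialD hχ1 i)) hφ.2.1.mul_right w.1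
  have i2 : Integrable (fun x => (φ x * χ x) • w.2 x i) (volume.restrict Ω) :=
    integrable_smul_apply_of_Lp ht.1.continuous ht.2.1 w.2 i
  have e1 : ∫ x in Ω, partialD φ i x • ((χ x : ℂ) * w.1 x) =
      ∫ x in Ω, (partialD (fun y => φ y * χ y) i x • w.1 x -
        (φ x * partialD χ i x) • w.1 x) := by
    congr 1 with x
    rw [partialD_mul hφ1 hχ1]
    simp only [Complex.real_smul, Complex.ofReal_add, Complex.ofReal_mul]
    ring
  have e2 : ∫ x in Ω, φ x •
        ((χ x : ℂ) • w.2 x + w.1 x • classicalGrad (fun y => (χ y : ℂ)) x) i =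
      ∫ x in Ω, ((φ x * χ x) • w.2 x i + (φ x * partialD χ i x) • w.1 x) := by
    congr 1 with x
    simp only [classicalGrad, partialD_ofReal hχ1, PiLp.add_apply, PiLp.smul_apply, smul_eq_mul,
      Complex.real_smul, Complex.ofReal_mul]
    ring
  rw [e1, e2, integral_sub i0 i1, integral_add i2 i1, key]
  ring

/-- Multiplication by a real `χ ∈ C_c^∞(ℝⁿ)` on `W^{1,p}(Ω; ℂ)`. -/
def mulSmooth : W1p Ω p →L[ℂ] W1p Ω p :=
  ((mulPair Ω p χ hχ hc).comp (W1p Ω p).subtypeL).codRestrict (W1p Ω p)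
    fun u => isWeakGrad_mulPair hχ hc u.2

lemma val_mulSmooth (u : W1p Ω p) :
    val (mulSmooth hχ hc u) =ᵐ[volume.restrict Ω] fun x => (χ x : ℂ) * val u x :=
  mulPair_fst hχ hc _

lemma grad_mulSmooth (u : W1p Ω p) :
    grad (mulSmooth hχ hc u) =ᵐ[volume.restrict Ω]
      fun x => (χ x : ℂ) • grad u x + val u x • classicalGrad (fun y => (χ y : ℂ)) x :=
  mulPair_snd hχ hc _

lemma classicalGrad_mul {φ : E n → ℂ} (hφ : ContDiff ℝ 1 φ) (hχ : ContDiff ℝ 1 χ) (x : E n) :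
    classicalGrad (fun x => (χ x : ℂ) * φ x) x =
      (χ x : ℂ) • classicalGrad φ x + φ x • classicalGrad (fun y => (χ y : ℂ)) x := by
  ext i
  simp only [classicalGrad, partialD, PiLp.add_apply, PiLp.smul_apply, smul_eq_mul]
  rw [fderiv_fun_mul ((contDiff_ofReal hχ).differentiable (by simp) x)
    (hφ.differentiable (by simp) x)]
  simp

/-- No vanishing of `χ` on the boundary is needed: `χ φ` is supported where `φ` is. This makes a
cut-off solution an admissible competitor. -/
lemma mulSmooth_mem_W1p0 {u : W1p Ω p} (hu : u ∈ W1p0 Ω p) : mulSmooth hχ hc u ∈ W1p0 Ω p := by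
  refine mapsTo_W1p0 (mulSmooth hχ hc).continuous ?_ u hu
  rintro u ⟨φ, hφ, h1, h2⟩
  refine ⟨fun x => (χ x : ℂ) * φ x, ⟨(contDiff_ofReal hχ).mul hφ.1, hφ.2.1.mul_left,
    (tsupport_mul_subset_right).trans hφ.2.2⟩, (val_mulSmooth hχ hc u).trans ?_,
    (grad_mulSmooth hχ hc u).trans ?_⟩
  · filter_upwards [h1] with x hx
    rw [← hx]; rfl
  · filter_upwards [h1, h2] with x hx hy
    rw [classicalGrad_mul (hφ.1.of_le (by simp)) (hχ.of_le (by simp)), ← hx, ← hy]; rfl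

end Mul

/-! ### Hardy and Poincaré inequalities from vector fields of positive divergence. -/

section Hardy

variable {n : ℕ} {Ω : Set (E n)} {p : ℝ}

lemma clm_apply_eq_sum {F : Type*} [NormedAddCommGroup F] [NormedSpace ℝ F] (L : E n →L[ℝ] F)
    (v : E n) : L v = ∑ i, v i • L (EuclideanSpace.single i 1) := by
  conv_lhs => rw [← (EuclideanSpace.basisFun (Fin n) ℝ).sum_repr v]
  simp

lemma fderiv_apply_eq_sum {F : Type*} [NormedAddCommGroup F] [NormedSpace ℝ F] (g : E n → F)
    (x v : E n) : fderiv ℝ g x v = ∑ i, v i • partialD g i x :=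
  clm_apply_eq_sum _ _

lemma norm_fderiv_apply_le (φ : E n → ℂ) (x v : E n) :
    ‖fderiv ℝ φ x v‖ ≤ ‖v‖ * ‖classicalGrad φ x‖ := by
  rw [fderiv_apply_eq_sum, EuclideanSpace.norm_eq, EuclideanSpace.norm_eq]
  refine (norm_sum_le _ _).trans ?_
  simp_rw [norm_smul]
  exact Real.sum_mul_le_sqrt_mul_sqrt _ _ _

/-- The divergence of a vector field. -/
def divergence (V : E n → E n) (x : E n) : ℝ := ∑ i, partialD (fun y => V y i) i x

/-- `V` is a vector field on `Ω` with `div V ≥ η σ ^ p` and `|V| ≤ K η σ ^ (p - 1)`. -/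
structure HardyField (Ω : Set (E n)) (p K : ℝ) (V : E n → E n) (η σ : E n → ℝ) : Prop where
  contDiff : ContDiff ℝ 1 V
  continuous_weight : Continuous η
  continuous_scale : Continuous σ
  weight_nonneg : ∀ x, 0 ≤ η x
  scale_nonneg : ∀ x, 0 ≤ σ x
  le_divergence : ∀ x ∈ Ω, η x * σ x ^ p ≤ divergence V x
  norm_le : ∀ x ∈ Ω, ‖V x‖ ≤ K * (η x * σ x ^ (p - 1))

lemma contDiff_coord {V : E n → E n} (hV : ContDiff ℝ 1 V) (i : Fin n) :
    ContDiff ℝ 1 fun y => V y i :=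
  (EuclideanSpace.proj (𝕜 := ℝ) i).contDiff.comp hV

lemma continuous_divergence {V : E n → E n} (hV : ContDiff ℝ 1 V) : Continuous (divergence V) :=
  continuous_finsetSum _ fun i _ => continuous_partialD (contDiff_coord hV i) i

lemma integral_divergence_mul {V : E n → E n} (hV : ContDiff ℝ 1 V) {g : E n → ℝ}
    (hg : ContDiff ℝ 1 g) (hc : HasCompactSupport g) :
    ∫ x, divergence V x * g x = - ∫ x, fderiv ℝ g x (V x) := by
  have h1 : ∀ i : Fin n, ∫ x, partialD g i x • V x i = - ∫ x, g x • partialD (fun y => V y i) i x :=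
    fun i => integral_smul_partialD hg (contDiff_coord hV i) hc i
  have i1 : ∀ i : Fin n, Integrable fun x => partialD g i x • V x i := fun i =>
    ((continuous_partialD hg i).smul (contDiff_coord hV i).continuous).integrable_of_hasCompactSupport
      (hasCompactSupport_partialD hc i).smul_right
  have i2 : ∀ i : Fin n, Integrable fun x => g x • partialD (fun y => V y i) i x := fun i =>
    (hg.continuous.smul (continuous_partialD (contDiff_coord hV i) i)).integrable_of_hasCompactSupport
      hc.smul_right
  have e1 : ∀ x, divergence V x * g x = ∑ i, g x • partialD (fun y => V y i) i x := by
    intro x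
    rw [divergence, Finset.sum_mul]
    exact Finset.sum_congr rfl fun i _ => mul_comm _ _
  have e2 : ∀ x, fderiv ℝ g x (V x) = ∑ i, partialD g i x • V x i := by
    intro x
    simp only [fderiv_apply_eq_sum, smul_eq_mul, mul_comm]
  simp_rw [e1, e2]
  rw [integral_finsetSum _ fun i _ => i2 i, integral_finsetSum _ fun i _ => i1 i,
    ← Finset.sum_neg_distrib]
  refine Finset.sum_congr rfl fun i _ => ?_
  rw [h1 i, neg_neg]

lemma neg_fderiv_norm_rpow_le (hp : 1 < p) {φ : E n → ℂ} (hφ : ContDiff ℝ 1 φ) (x v : E n) :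
    - fderiv ℝ (fun y => ‖φ y‖ ^ p) x v ≤ p * (‖φ x‖ ^ (p - 1) * (‖v‖ * ‖classicalGrad φ x‖)) := by
  rw [(hφ.differentiable (by simp)).fderiv_norm_rpow hp]
  simp only [ContinuousLinearMap.comp_apply, smul_apply, innerSL_apply_apply, smul_eq_mul]
  have h1 := (neg_le_abs _).trans (abs_real_inner_le_norm (φ x) (fderiv ℝ φ x v))
  have h2 := norm_fderiv_apply_le φ x v
  have h3 : 0 ≤ p * ‖φ x‖ ^ (p - 2) := by positivity
  rw [← rpow_sub_two_mul_self hp _ (norm_nonneg (φ x))]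
  calc -(p * ‖φ x‖ ^ (p - 2) * inner ℝ (φ x) (fderiv ℝ φ x v))
      = p * ‖φ x‖ ^ (p - 2) * -(inner ℝ (φ x) (fderiv ℝ φ x v)) := by ring
    _ ≤ p * ‖φ x‖ ^ (p - 2) * (‖φ x‖ * (‖v‖ * ‖classicalGrad φ x‖)) := by gcongr; exact h1.trans (by gcongr)
    _ = _ := by ring

/-- A Hardy inequality for test functions with constant depending only on `p` and `K`. -/
lemma exists_hardy_test (hp : 1 < p) (hΩo : IsOpen Ω) {K : ℝ} (hK : 0 ≤ K) :
    ∃ C : ℝ, 0 ≤ C ∧ ∀ V η σ, HardyField Ω p K V η σ → ∀ φ : E n → ℂ, IsTest Ω φ →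
      ∫ x in Ω, (η x * σ x ^ p) * ‖φ x‖ ^ p ≤ C * ∫ x in Ω, η x * ‖classicalGrad φ x‖ ^ p := by
  have hp0 : 0 < p := by linarith
  -- The factor `p` comes from differentiating `|φ| ^ p`. Since `C` depends only on `p` and `K`, so
  -- does the Hardy constant `2 * C`, the 2 coming from absorbing half of the left side.
  obtain ⟨C, hC, hCab⟩ := exists_mul_rpow_le_half hp (K := p * K) (by positivity)
  refine ⟨2 * C, by positivity, fun V η σ h φ hφ => ?_⟩
  have hφ1 : ContDiff ℝ 1 φ := hφ.1.of_le (by simp)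
  have hcp : ∀ {f : E n → ℝ}, Continuous f → Continuous fun x => f x ^ p := fun hf =>
    hf.rpow_const fun _ => Or.inr hp0.le
  set g : E n → ℝ := fun y => ‖φ y‖ ^ p with hg_def
  have hg : ContDiff ℝ 1 g := (contDiff_norm_rpow hp).comp hφ1
  have hgs : Function.support g ⊆ Function.support φ := by
    intro x hx
    rw [Function.mem_support] at hx ⊢
    contrapose! hx
    simp [hg_def, hx, hp0.ne']
  have hgc : HasCompactSupport g := hφ.2.1.mono hgs
  have hgt : tsupport g ⊆ Ω := (closure_mono hgs).trans hφ.2.2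
  have hgi : ∀ {f : E n → ℝ}, Continuous f → Integrable fun x => f x * g x := fun hf =>
    (hf.mul hg.continuous).integrable_of_hasCompactSupport hgc.mul_left
  have iL : Integrable fun x => (η x * σ x ^ p) * g x :=
    hgi (h.continuous_weight.mul (hcp h.continuous_scale))
  have iG : Integrable fun x => η x * ‖classicalGrad φ x‖ ^ p := by
    refine (h.continuous_weight.mul
      (hcp (continuous_classicalGrad hφ1).norm)).integrable_of_hasCompactSupport ?_
    refine (hasCompactSupport_classicalGrad hφ.2.1).mono fun x hx => ?_
    rw [Function.mem_support] at hx ⊢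
    contrapose! hx
    simp [hx, hp0.ne']
  have iD : Integrable fun x => divergence V x * g x := hgi (continuous_divergence h.contDiff)
  have iF : Integrable fun x => - fderiv ℝ g x (V x) := by
    refine (((hg.continuous_fderiv (by simp)).clm_apply
      h.contDiff.continuous).integrable_of_hasCompactSupport ?_).neg
    refine (hgc.fderiv (𝕜 := ℝ)).mono fun x hx => ?_
    rw [Function.mem_support] at hx ⊢
    contrapose! hx
    simp [hx]
  have hm := hΩo.measurableSet
  -- Bound the weight by `div V`, integrate by parts against `g = |φ| ^ p`, and use the bound on
  -- `|V|`. The weight `η` then factors out and Young's inequality applies to `σ |φ|` and `|∇φ|`.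
  have key : ∫ x in Ω, (η x * σ x ^ p) * g x ≤
      ∫ x in Ω, (1 / 2 * ((η x * σ x ^ p) * g x) + C * (η x * ‖classicalGrad φ x‖ ^ p)) := by
    calc ∫ x in Ω, (η x * σ x ^ p) * g x ≤ ∫ x in Ω, divergence V x * g x := by
          refine setIntegral_mono_on iL.integrableOn iD.integrableOn hm fun x hx => ?_
          exact mul_le_mul_of_nonneg_right (h.le_divergence x hx) (by positivity)
      _ = ∫ x, divergence V x * g x := setIntegral_eq_integral_of_tsupport hgt fun x hx => by
          rw [image_eq_zero_of_notMem_tsupport hx, mul_zero]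
      _ = ∫ x, - fderiv ℝ g x (V x) := by
          rw [integral_divergence_mul h.contDiff hg hgc, integral_neg]
      _ = ∫ x in Ω, - fderiv ℝ g x (V x) := by
          symm
          refine setIntegral_eq_integral_of_tsupport hgt fun x hx => ?_
          have : fderiv ℝ g x = 0 := by
            by_contra h'
            exact hx (support_fderiv_subset ℝ (Function.mem_support.2 h'))
          simp [this]
      _ ≤ _ := by
          refine setIntegral_mono_on iF.integrableOn
            ((iL.const_mul _).add (iG.const_mul _)).integrableOn hm fun x hx => ?_
          have hη := h.weight_nonneg x
          have hσ := h.scale_nonneg x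
          calc - fderiv ℝ g x (V x)
              ≤ p * (‖φ x‖ ^ (p - 1) * (‖V x‖ * ‖classicalGrad φ x‖)) :=
                neg_fderiv_norm_rpow_le hp hφ1 x (V x)
            _ ≤ p * (‖φ x‖ ^ (p - 1) * ((K * (η x * σ x ^ (p - 1))) * ‖classicalGrad φ x‖)) := by
                gcongr; exact h.norm_le x hx
            _ = η x * (p * K * (σ x * ‖φ x‖) ^ (p - 1) * ‖classicalGrad φ x‖) := by
                rw [Real.mul_rpow hσ (norm_nonneg _)]; ring
            _ ≤ η x * (1 / 2 * (σ x * ‖φ x‖) ^ p + C * ‖classicalGrad φ x‖ ^ p) := by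
                gcongr
                exact hCab _ _ (by positivity) (norm_nonneg _)
            _ = _ := by rw [Real.mul_rpow hσ (norm_nonneg _)]; ring
  rw [integral_add (iL.const_mul _).integrableOn (iG.const_mul _).integrableOn,
    integral_const_mul, integral_const_mul] at key
  linarith

variable [hp : Fact (1 < p)]

lemma continuous_val_energy {q : E n → ℝ} {M : ℝ} (hq : Continuous q)
    (hΩo : IsOpen Ω) (hM : ∀ x ∈ Ω, q x ≤ M) (h0 : ∀ x, 0 ≤ q x) :
    Continuous fun u : W1p Ω p => ∫ x in Ω, q x * ‖val u x‖ ^ p :=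
  (continuous_integral_weight_mul_norm_rpow (p := p) (μ := volume.restrict Ω) (F := ℂ)
    hq.aestronglyMeasurable (M := M) ((ae_restrict_mem hΩo.measurableSet).mono fun x hx => by
      rw [Real.norm_of_nonneg (h0 x)]; exact hM x hx) (.of_forall h0)).comp
    (continuous_fst.comp continuous_subtype_val)

lemma continuous_grad_energy {q : E n → ℝ} {M : ℝ}
    (hq : AEStronglyMeasurable q (volume.restrict Ω))
    (hΩo : IsOpen Ω) (hM : ∀ x ∈ Ω, q x ≤ M) (h0 : ∀ x ∈ Ω, 0 ≤ q x) :
    Continuous fun u : W1p Ω p => ∫ x in Ω, q x * ‖grad u x‖ ^ p :=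
  (continuous_integral_weight_mul_norm_rpow (p := p) (μ := volume.restrict Ω) (F := CVec n)
    hq (M := M) ((ae_restrict_mem hΩo.measurableSet).mono fun x hx => by
      rw [Real.norm_of_nonneg (h0 x hx)]; exact hM x hx)
      ((ae_restrict_mem hΩo.measurableSet).mono h0)).comp
    (continuous_snd.comp continuous_subtype_val)

/-- The Hardy inequality in `W^{1,p}_0`. -/
lemma exists_hardy (p : ℝ) [hp : Fact (1 < p)] (hΩo : IsOpen Ω) {K : ℝ} (hK : 0 ≤ K) :
    ∃ C : ℝ, 0 ≤ C ∧ ∀ V η σ, HardyField Ω p K V η σ →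
      (∃ M, ∀ x ∈ Ω, η x ≤ M) → (∃ M, ∀ x ∈ Ω, σ x ≤ M) → ∀ u ∈ W1p0 Ω p,
      ∫ x in Ω, (η x * σ x ^ p) * ‖val u x‖ ^ p ≤ C * ∫ x in Ω, η x * ‖grad u x‖ ^ p := by
  have hp0 : 0 < p := by have := hp.out; linarith
  obtain ⟨C, hC, hCV⟩ := exists_hardy_test hp.out hΩo hK
  refine ⟨C, hC, fun V η σ h ⟨M, hM⟩ ⟨M', hM'⟩ => W1p0_induction ?_ ?_⟩
  -- Boundedness of `η` and `σ` enters only here: it makes both sides continuous in `u`, so that the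
  -- inequality passes to the closure.
  · refine isClosed_le (continuous_val_energy (M := M * M' ^ p) ?_ hΩo ?_ ?_) (continuous_const.mul
      (continuous_grad_energy h.continuous_weight.aestronglyMeasurable hΩo hM
        fun x _ => h.weight_nonneg x))
    · exact h.continuous_weight.mul (h.continuous_scale.rpow_const fun _ => Or.inr hp0.le)
    · intro x hx
      have h1 := h.weight_nonneg x
      have h2 := h.scale_nonneg x
      exact mul_le_mul (hM x hx) (Real.rpow_le_rpow h2 (hM' x hx) hp0.le) (by positivity)
        (h1.trans (hM x hx))
    · intro x
      have h1 := h.weight_nonneg x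
      have h2 := h.scale_nonneg x
      positivity
  · rintro u ⟨φ, hφ, h1, h2⟩
    have e1 : ∫ x in Ω, (η x * σ x ^ p) * ‖val u x‖ ^ p =
        ∫ x in Ω, (η x * σ x ^ p) * ‖φ x‖ ^ p :=
      integral_congr_ae (by filter_upwards [h1] with x hx; rw [← hx]; rfl)
    have e2 : ∫ x in Ω, η x * ‖grad u x‖ ^ p = ∫ x in Ω, η x * ‖classicalGrad φ x‖ ^ p :=
      integral_congr_ae (by filter_upwards [h2] with x hx; rw [hx])
    rw [e1, e2]
    exact hCV V η σ h φ hφ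

/-- The Poincaré inequality in `W^{1,p}_0`. -/
lemma exists_poincare (p : ℝ) [hp : Fact (1 < p)] (hn : 0 < n) (hΩo : IsOpen Ω)
    (hΩb : Bornology.IsBounded Ω) :
    ∃ C : ℝ, 0 ≤ C ∧ ∀ u ∈ W1p0 Ω p,
      ‖(u : LpPair Ω p).1‖ ^ p ≤ C * ‖(u : LpPair Ω p).2‖ ^ p := by
  obtain ⟨R, hR⟩ := hΩb.exists_norm_le
  obtain ⟨C, hC, h⟩ := exists_hardy (n := n) p hΩo (K := 2 * |R|) (by positivity)
  refine ⟨C, hC, fun u hu => ?_⟩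
  have i0 : Fin n := ⟨0, hn⟩
  -- Poincaré is Hardy with `η = σ = 1`, for which a field of divergence one that is bounded on `Ω`
  -- suffices.
  let V : E n → E n := fun x => (x i0 + |R|) • EuclideanSpace.single i0 1
  have hV : HardyField Ω p (2 * |R|) V (fun _ => 1) (fun _ => 1) := by
    refine ⟨?_, continuous_const, continuous_const, fun _ => zero_le_one, fun _ => zero_le_one,
      ?_, ?_⟩
    · exact ((EuclideanSpace.proj (𝕜 := ℝ) i0).contDiff.add contDiff_const).smul contDiff_const
    · intro x _
      have hd : ∀ i, partialD (fun y => V y i) i x = if i = i0 then 1 else 0 := by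
        intro i
        have : HasFDerivAt (fun y => V y i)
            ((EuclideanSpace.single i0 (1 : ℝ) i) • (EuclideanSpace.proj (𝕜 := ℝ) i0)) x := by
          have := ((EuclideanSpace.proj (𝕜 := ℝ) i0).hasFDerivAt (x := x)).add_const |R|
          exact (this.mul_const (EuclideanSpace.single i0 (1 : ℝ) i))
        rw [partialD, this.fderiv]
        by_cases hi : i = i0
        · subst hi; simp
        · simp [hi]
      simp [divergence, hd]
    · intro x hx
      have h1 : |x i0| ≤ |R| :=
        ((PiLp.norm_apply_le x i0).trans (hR x hx)).trans (le_abs_self R)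
      simp only [V, norm_smul, PiLp.norm_single, norm_one, mul_one, Real.one_rpow]
      rw [Real.norm_eq_abs]
      exact (abs_add_le _ _).trans (by rw [abs_abs]; linarith)
  have := h V _ _ hV ⟨1, fun _ _ => le_rfl⟩ ⟨1, fun _ _ => le_rfl⟩ u hu
  simp only [one_mul, Real.one_rpow] at this
  rw [norm_rpow_eq_integral, norm_rpow_eq_integral]
  exact this

end Hardy

/-- Measurable coefficients on `Ω` with positive lower and upper bounds `c`, `M`. -/
structure IsCoeff {n : ℕ} (Ω : Set (E n)) (γ : E n → ℝ) (c M : ℝ) : Prop where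
  isOpen : IsOpen Ω
  aestronglyMeasurable : AEStronglyMeasurable γ (volume.restrict Ω)
  pos : 0 < c
  le : ∀ x ∈ Ω, c ≤ γ x
  le_bound : ∀ x ∈ Ω, γ x ≤ M

/-! ### The energy, its first variation, and weak solutions as minimizers. -/

section Pairing

variable {n : ℕ} {Ω : Set (E n)} {p : ℝ} [hp : Fact (1 < p)] {γ : E n → ℝ} {c M : ℝ}

lemma IsCoeff.nonneg (h : IsCoeff Ω γ c M) : ∀ x ∈ Ω, 0 ≤ γ x := fun x hx =>
  h.pos.le.trans (h.le x hx)

lemma IsCoeff.ae_mem (h : IsCoeff Ω γ c M) : ∀ᵐ x ∂volume.restrict Ω, x ∈ Ω :=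
  ae_restrict_mem h.isOpen.measurableSet

lemma IsCoeff.ae_norm_le (h : IsCoeff Ω γ c M) : ∀ᵐ x ∂volume.restrict Ω, ‖γ x‖ ≤ M :=
  h.ae_mem.mono fun x hx => by rw [Real.norm_of_nonneg (h.nonneg x hx)]; exact h.le_bound x hx

/-- The `p`-energy `∫_Ω γ |∇u|^p dx`. -/
def energy (γ : E n → ℝ) (u : W1p Ω p) : ℝ := ∫ x in Ω, γ x * ‖grad u x‖ ^ p

lemma IsCoeff.integrable_mul_norm_rpow (h : IsCoeff Ω γ c M) {F : Type*} [NormedAddCommGroup F]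
    {G : E n → F} (hG : MemLp G (ENNReal.ofReal p) (volume.restrict Ω)) :
    Integrable (fun x => γ x * ‖G x‖ ^ p) (volume.restrict Ω) :=
  integrable_weight_mul_norm_rpow h.aestronglyMeasurable h.ae_norm_le hG

lemma IsCoeff.energy_nonneg (h : IsCoeff Ω γ c M) (u : W1p Ω p) : 0 ≤ energy γ u :=
  integral_nonneg_of_ae (h.ae_mem.mono fun x hx => by
    have := h.nonneg x hx
    simp only [Pi.zero_apply]
    positivity)

lemma IsCoeff.continuous_energy (h : IsCoeff Ω γ c M) :
    Continuous (energy γ : W1p Ω p → ℝ) :=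
  continuous_grad_energy h.aestronglyMeasurable h.isOpen h.le_bound h.nonneg

lemma norm_sum_mul_le (a b : CVec n) : ‖∑ i, a i * b i‖ ≤ ‖a‖ * ‖b‖ := by
  rw [EuclideanSpace.norm_eq, EuclideanSpace.norm_eq]
  refine (norm_sum_le _ _).trans ?_
  simp_rw [norm_mul]
  exact Real.sum_mul_le_sqrt_mul_sqrt _ _ _

lemma re_sum_mul (a b : CVec n) : (∑ i, a i * b i).re = inner ℝ a (conjVec n b) := by
  simp only [PiLp.inner_apply, Complex.inner, conjVec_apply, Complex.re_sum, Complex.mul_re,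
    Complex.conj_re, Complex.conj_im]
  exact Finset.sum_congr rfl fun i _ => by ring

lemma integrable_norm_rpow_add_norm_rpow {F : Type*} [NormedAddCommGroup F] {G H : E n → F}
    (hG : MemLp G (ENNReal.ofReal p) (volume.restrict Ω))
    (hH : MemLp H (ENNReal.ofReal p) (volume.restrict Ω)) :
    Integrable (fun x => ‖G x‖ ^ p + ‖H x‖ ^ p) (volume.restrict Ω) :=
  (integrable_norm_rpow_of_memLp hG).add (integrable_norm_rpow_of_memLp hH)

lemma IsCoeff.norm_integrand_le (h : IsCoeff Ω γ c M) {x : E n} (hx : x ∈ Ω) (a b : CVec n) :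
    ‖(γ x * ‖a‖ ^ (p - 2)) • ∑ i, a i * b i‖ ≤ M * (‖a‖ ^ p + ‖b‖ ^ p) := by
  have h0 := h.nonneg x hx
  rw [norm_smul, Real.norm_of_nonneg (by positivity), mul_assoc]
  refine mul_le_mul (h.le_bound x hx) ?_ (by positivity) (h0.trans (h.le_bound x hx))
  exact (mul_le_mul_of_nonneg_left (norm_sum_mul_le a b) (by positivity)).trans
    (rpow_sub_two_mul_mul_le hp.out (norm_nonneg a) (norm_nonneg b))

lemma aestronglyMeasurable_coord {μ : Measure (E n)} {G : E n → CVec n}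
    (hG : AEStronglyMeasurable G μ) (i : Fin n) : AEStronglyMeasurable (fun x => G x i) μ :=
  (EuclideanSpace.proj (𝕜 := ℂ) i).continuous.comp_aestronglyMeasurable hG

lemma IsCoeff.integrable_integrand (h : IsCoeff Ω γ c M) {G H : E n → CVec n}
    (hG : MemLp G (ENNReal.ofReal p) (volume.restrict Ω))
    (hH : MemLp H (ENNReal.ofReal p) (volume.restrict Ω)) :
    Integrable (fun x => (γ x * ‖G x‖ ^ (p - 2)) • ∑ i, G x i * H x i) (volume.restrict Ω) := by
  refine ((integrable_norm_rpow_add_norm_rpow hG hH).const_mul M).mono' ?_ ?_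
  · refine AEStronglyMeasurable.smul (h.aestronglyMeasurable.mul
      (hG.1.norm.aemeasurable.pow_const _).aestronglyMeasurable) ?_
    refine Finset.aestronglyMeasurable_fun_sum _ fun i _ => ?_
    exact (aestronglyMeasurable_coord hG.1 i).mul (aestronglyMeasurable_coord hH.1 i)
  · exact h.ae_mem.mono fun x hx => h.norm_integrand_le hx _ _

lemma IsCoeff.norm_energyPairing_le (h : IsCoeff Ω γ c M) (u v : W1p Ω p) :
    ‖energyPairing γ u v‖ ≤
      M * (‖(u : LpPair Ω p).2‖ ^ p + ‖(v : LpPair Ω p).2‖ ^ p) := by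
  rw [norm_rpow_eq_integral, norm_rpow_eq_integral,
    ← integral_add (integrable_norm_rpow_of_memLp (Lp.memLp _))
      (integrable_norm_rpow_of_memLp (Lp.memLp _)), ← integral_const_mul]
  exact norm_integral_le_of_norm_le
    ((integrable_norm_rpow_add_norm_rpow (memLp_grad u) (memLp_grad v)).const_mul M)
    (h.ae_mem.mono fun x hx => h.norm_integrand_le hx _ _)

lemma IsCoeff.energyPairing_add (h : IsCoeff Ω γ c M) (u v w : W1p Ω p) :
    energyPairing γ u (v + w) = energyPairing γ u v + energyPairing γ u w := by
  unfold energyPairing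
  rw [← integral_add (h.integrable_integrand (memLp_grad u) (memLp_grad v))
    (h.integrable_integrand (memLp_grad u) (memLp_grad w))]
  refine integral_congr_ae ((grad_add v w).mono fun x hx => ?_)
  simp only [hx, PiLp.add_apply, mul_add, Finset.sum_add_distrib, smul_add]

lemma energyPairing_smul (γ : E n → ℝ) (u : W1p Ω p) (a : ℂ) (v : W1p Ω p) :
    energyPairing γ u (a • v) = a * energyPairing γ u v := by
  unfold energyPairing
  rw [← integral_const_mul]
  refine integral_congr_ae ((grad_smul a v).mono fun x hx => ?_)
  simp only [hx, PiLp.smul_apply, smul_eq_mul, Complex.real_smul, Finset.mul_sum]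
  exact Finset.sum_congr rfl fun i _ => by ring

/-- The linear functional `v ↦ ∫_Ω γ |∇u|^{p-2} ∇u · ∇v dx`. -/
def IsCoeff.pairingLinear (h : IsCoeff Ω γ c M) (u : W1p Ω p) : W1p Ω p →ₗ[ℂ] ℂ where
  toFun := energyPairing γ u
  map_add' := h.energyPairing_add u
  map_smul' := energyPairing_smul γ u

/-- The available bound on the pairing is not homogeneous in `v`, so it is used on the unit ball
only and linearity does the rest. -/
lemma IsCoeff.continuous_pairingLinear (h : IsCoeff Ω γ c M) (u : W1p Ω p) :
    Continuous (h.pairingLinear u) := by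
  refine AddMonoidHomClass.continuous_of_bound (h.pairingLinear u)
    (|M| * (‖(u : LpPair Ω p).2‖ ^ p + 1) / 1) fun v => ?_
  refine LinearMap.bound_of_ball_bound' one_pos _ _ (fun z hz => ?_) v
  have hz1 : ‖(z : LpPair Ω p).2‖ ≤ 1 :=
    (norm_snd_le (z : LpPair Ω p)).trans (by simpa using hz)
  calc ‖energyPairing γ u z‖ ≤ M * (‖(u : LpPair Ω p).2‖ ^ p + ‖(z : LpPair Ω p).2‖ ^ p) :=
        h.norm_energyPairing_le u z
    _ ≤ |M| * (‖(u : LpPair Ω p).2‖ ^ p + ‖(z : LpPair Ω p).2‖ ^ p) := by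
        gcongr; exact le_abs_self M
    _ ≤ _ := by
        gcongr
        exact Real.rpow_le_one (norm_nonneg _) hz1 (by have := hp.out; linarith)

/-- Being a weak solution says that the pairing functional kills `W^{1,p}_0`, hence it descends to
the quotient, with continuity inherited through the quotient topology. -/
lemma IsCoeff.exists_current (h : IsCoeff Ω γ c M) {u : W1p Ω p} (hu : IsWeakSolution γ u) :
    ∃ ℓ : StrongDual ℂ (TraceSpace Ω p), ∀ v : W1p Ω p, ℓ (trace v) = energyPairing γ u v := by
  refine ⟨⟨(W1p0 Ω p).liftQ (h.pairingLinear u) fun φ hφ => hu φ hφ, ?_⟩, fun v => rfl⟩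
  exact (Submodule.isOpenQuotientMap_mkQ (W1p0 Ω p)).isQuotientMap.continuous_iff.2
    (h.continuous_pairingLinear u)

lemma IsCoeff.re_energyPairing (h : IsCoeff Ω γ c M) (u v : W1p Ω p) :
    (energyPairing γ u v).re =
      ∫ x in Ω, γ x * (‖grad u x‖ ^ (p - 2) * inner ℝ (grad u x) (conjVec n (grad v x))) := by
  have := integral_re (𝕜 := ℂ) (h.integrable_integrand (memLp_grad u) (memLp_grad v))
  refine this.symm.trans ?_
  congr 1 with x
  simp only [RCLike.re_eq_complex_re, Complex.smul_re, re_sum_mul, smul_eq_mul, mul_assoc]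

lemma IsCoeff.re_energyPairing_conj (h : IsCoeff Ω γ c M) (u v : W1p Ω p) :
    (energyPairing γ u (conj v)).re =
      ∫ x in Ω, γ x * (‖grad u x‖ ^ (p - 2) * inner ℝ (grad u x) (grad v x)) := by
  rw [h.re_energyPairing]
  refine integral_congr_ae ((grad_conj v).mono fun x hx => ?_)
  simp only [hx, conjVec_conjVec]

lemma IsCoeff.re_energyPairing_conj_self (h : IsCoeff Ω γ c M) (u : W1p Ω p) :
    (energyPairing γ u (conj u)).re = energy γ u := by
  rw [h.re_energyPairing_conj, energy]
  congr 1 with x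
  rw [real_inner_self_eq_norm_sq, rpow_sub_two_mul_sq hp.out _ (norm_nonneg _)]

lemma IsCoeff.integrable_inner (h : IsCoeff Ω γ c M) {G H : E n → CVec n}
    (hG : MemLp G (ENNReal.ofReal p) (volume.restrict Ω))
    (hH : MemLp H (ENNReal.ofReal p) (volume.restrict Ω)) :
    Integrable (fun x => γ x * (‖G x‖ ^ (p - 2) * inner ℝ (G x) (H x)))
      (volume.restrict Ω) := by
  have hH' : MemLp (fun x => conjVec n (H x)) (ENNReal.ofReal p) (volume.restrict Ω) :=
    (conjVec n).comp_memLp' hH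
  refine (h.integrable_integrand hG hH').re.congr (.of_forall fun x => ?_)
  simp only [RCLike.re_eq_complex_re, Complex.smul_re, re_sum_mul, smul_eq_mul, mul_assoc,
    conjVec_conjVec]

/-- The tangent inequality for the energy. -/
lemma IsCoeff.energy_add_pairing_le (h : IsCoeff Ω γ c M) (u w : W1p Ω p) :
    energy γ u + p * (energyPairing γ u (conj (w - u))).re ≤ energy γ w := by
  rw [h.re_energyPairing_conj, energy, energy, ← integral_const_mul,
    ← integral_add (h.integrable_mul_norm_rpow (memLp_grad u))
      ((h.integrable_inner (memLp_grad u) (memLp_grad (w - u))).const_mul p)]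
  refine integral_mono_ae ((h.integrable_mul_norm_rpow (memLp_grad u)).add
    ((h.integrable_inner (memLp_grad u) (memLp_grad (w - u))).const_mul p))
    (h.integrable_mul_norm_rpow (memLp_grad w)) ?_
  filter_upwards [h.ae_mem, grad_sub w u] with x hx h1
  simp only [h1]
  have := mul_le_mul_of_nonneg_left
    (norm_rpow_add_inner_le hp.out (grad w x) (grad u x)) (h.nonneg x hx)
  linarith

/-- The first-order term of the tangent inequality vanishes, because the conjugate of `w - u` is
again an admissible test function. -/
lemma IsCoeff.energy_le_of_isWeakSolution (h : IsCoeff Ω γ c M) {u w : W1p Ω p}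
    (hu : IsWeakSolution γ u) (hw : w - u ∈ W1p0 Ω p) : energy γ u ≤ energy γ w := by
  have := h.energy_add_pairing_le u w
  rw [hu _ (conj_mem_W1p0 hw)] at this
  simpa using this

/-- The energy is never differentiated. The tangent inequality based at `u + t φ` and evaluated at
`u`, together with minimality, gives a nonnegative pairing of `u + t φ` with the conjugate of `φ`
for each `t > 0`. Dominated convergence then lets `t` tend to zero. -/
lemma IsCoeff.pairing_nonneg_of_minimizer (h : IsCoeff Ω γ c M) {u φ : W1p Ω p}
    (hmin : ∀ t : ℝ, energy γ u ≤ energy γ (u + (t : ℂ) • φ)) :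
    0 ≤ (energyPairing γ u (conj φ)).re := by
  rw [h.re_energyPairing_conj]
  obtain ⟨C, hC, hCab⟩ := exists_add_rpow_le hp.out one_pos
  set H : ℝ → E n → ℝ := fun t x => γ x *
    (‖grad u x + (t : ℂ) • grad φ x‖ ^ (p - 2) *
      inner ℝ (grad u x + (t : ℂ) • grad φ x) (grad φ x)) with hH
  have hG : ∀ t : ℝ, MemLp (fun x => grad u x + (t : ℂ) • grad φ x) (ENNReal.ofReal p)
      (volume.restrict Ω) := fun t => 
    (memLp_grad u).add (g := fun x => (t : ℂ) • grad φ x) ((memLp_grad φ).const_smul (t : ℂ))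
  have hpos : ∀ t : ℝ, 0 < t → 0 ≤ ∫ x in Ω, H t x := by
    intro t ht
    have h1 := h.energy_add_pairing_le (u + (t : ℂ) • φ) u
    have h2 := hmin t
    rw [h.re_energyPairing_conj] at h1
    have e : ∫ x in Ω, γ x * (‖grad (u + (t : ℂ) • φ) x‖ ^ (p - 2) *
        inner ℝ (grad (u + (t : ℂ) • φ) x) (grad (u - (u + (t : ℂ) • φ)) x)) =
        ∫ x in Ω, (-t) * H t x := by
      refine integral_congr_ae ?_
      filter_upwards [grad_sub u (u + (t : ℂ) • φ), grad_add u ((t : ℂ) • φ),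
        grad_smul (t : ℂ) φ] with x e1 e2 e3
      simp only [e1, e2, e3, hH]
      have e4 : grad u x - (grad u x + (t : ℂ) • grad φ x) = (-t) • grad φ x := by
        ext i; simp
      rw [e4, inner_smul_right]
      ring
    rw [e, integral_const_mul] at h1
    have hp0 : 0 < p := by have := hp.out; linarith
    by_contra! hcon
    have : 0 < p * (-t * ∫ x in Ω, H t x) := by
      apply mul_pos hp0
      nlinarith
    linarith
  have hlim : Tendsto (fun t => ∫ x in Ω, H t x) (𝓝[>] 0) (𝓝 (∫ x in Ω, H 0 x)) := by
    refine tendsto_integral_filter_of_dominated_convergence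
      (fun x => M * ((2 * ‖grad u x‖ ^ p + C * ‖grad φ x‖ ^ p) + ‖grad φ x‖ ^ p)) ?_ ?_ ?_ ?_
    · exact .of_forall fun t => (h.integrable_inner (hG t) (memLp_grad φ)).1
    · have hlt : ∀ᶠ t : ℝ in 𝓝[>] 0, t ∈ Ioo (0 : ℝ) 1 := Ioo_mem_nhdsGT one_pos
      filter_upwards [hlt] with t ht
      filter_upwards [h.ae_mem] with x hx
      have h0 := h.nonneg x hx
      simp only [hH]
      rw [norm_mul, Real.norm_of_nonneg h0]
      refine mul_le_mul (h.le_bound x hx) ?_ (norm_nonneg _) (h0.trans (h.le_bound x hx))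
      set a := grad u x + (t : ℂ) • grad φ x with ha
      have ha' : ‖a‖ ≤ ‖grad u x‖ + ‖grad φ x‖ := by
        refine (norm_add_le _ _).trans ?_
        gcongr
        rw [norm_smul, Complex.norm_real, Real.norm_of_nonneg ht.1.le]
        exact mul_le_of_le_one_left (norm_nonneg _) ht.2.le
      calc ‖‖a‖ ^ (p - 2) * inner ℝ a (grad φ x)‖
          = ‖a‖ ^ (p - 2) * ‖inner ℝ a (grad φ x)‖ := by
            rw [norm_mul, Real.norm_of_nonneg (by positivity)]
        _ ≤ ‖a‖ ^ (p - 2) * (‖a‖ * ‖grad φ x‖) := by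
            gcongr; exact norm_inner_le_norm _ _
        _ ≤ ‖a‖ ^ p + ‖grad φ x‖ ^ p :=
            rpow_sub_two_mul_mul_le hp.out (norm_nonneg _) (norm_nonneg _)
        _ ≤ (‖grad u x‖ + ‖grad φ x‖) ^ p + ‖grad φ x‖ ^ p := by
            gcongr
            have := hp.out; linarith
        _ ≤ _ := by
            gcongr
            exact (hCab _ _ (norm_nonneg _) (norm_nonneg _)).trans (by norm_num)
    · exact ((((integrable_norm_rpow_of_memLp (memLp_grad u)).const_mul 2).add
        ((integrable_norm_rpow_of_memLp (memLp_grad φ)).const_mul C)).add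
        (integrable_norm_rpow_of_memLp (memLp_grad φ))).const_mul M
    · refine .of_forall fun x => ?_
      have hc : Continuous fun t : ℝ => H t x := by
        refine continuous_const.mul ((continuous_norm_rpow_mul_inner hp.out (grad φ x)).comp
          (continuous_const.add ?_))
        exact Complex.continuous_ofReal.smul continuous_const
      exact (hc.tendsto 0).mono_left nhdsWithin_le_nhds
  have h0 : 0 ≤ ∫ x in Ω, H 0 x :=
    ge_of_tendsto hlim (by filter_upwards [self_mem_nhdsWithin] with t ht using hpos t ht)
  simpa [hH] using h0

lemma conj_conj (u : W1p Ω p) : conj (conj u) = u := by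
  refine Subtype.ext (Prod.ext (Lp.ext ?_) (Lp.ext ?_))
  · filter_upwards [val_conj (conj u), val_conj u] with x h1 h2
    rw [h2, Complex.conj_conj] at h1
    exact h1
  · filter_upwards [grad_conj (conj u), grad_conj u] with x h1 h2
    rw [h2, conjVec_conjVec] at h1
    exact h1

/-- Since `W^{1,p}_0` is a complex subspace, replacing `φ` by `-φ` makes the real part vanish, and
replacing it by `i φ` makes the imaginary part vanish. -/
lemma IsCoeff.isWeakSolution_of_minimizer (h : IsCoeff Ω γ c M) {u : W1p Ω p}
    (hmin : ∀ φ ∈ W1p0 Ω p, energy γ u ≤ energy γ (u + φ)) : IsWeakSolution γ u := by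
  have h1 : ∀ φ ∈ W1p0 Ω p, 0 ≤ (energyPairing γ u φ).re := by
    intro φ hφ
    have := h.pairing_nonneg_of_minimizer (u := u) (φ := conj φ) fun t =>
      hmin _ (Submodule.smul_mem _ _ (conj_mem_W1p0 hφ))
    rwa [conj_conj] at this
  have h2 : ∀ φ ∈ W1p0 Ω p, (energyPairing γ u φ).re = 0 := by
    intro φ hφ
    have h3 := h1 ((-1 : ℂ) • φ) (Submodule.smul_mem _ _ hφ)
    rw [energyPairing_smul] at h3
    simp only [neg_mul, one_mul, Complex.neg_re] at h3
    exact le_antisymm (by linarith) (h1 φ hφ)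
  intro φ hφ
  refine Complex.ext (h2 φ hφ) ?_
  have h3 := h2 (Complex.I • φ) (Submodule.smul_mem _ _ hφ)
  rw [energyPairing_smul] at h3
  simpa using h3

end Pairing

/-! ### Existence of minimizers, and equality of energies from equality of Dirichlet-to-Neumann
maps. -/

section Existence

variable {n : ℕ} {Ω : Set (E n)} {p : ℝ} [hp : Fact (1 < p)] {γ : E n → ℝ} {c M : ℝ}

/-- Hölder's inequality, as `ψ` lies in the dual Lebesgue space. It makes each condition defining a
weak gradient closed, whence `W^{1,p}` is complete. -/
lemma continuous_integral_smul_clm {F : Type*} [NormedAddCommGroup F] [NormedSpace ℝ F]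
    (L : F →L[ℝ] ℂ) {ψ : E n → ℝ} (hψ : Continuous ψ) (hc : HasCompactSupport ψ) :
    Continuous fun w : Lp F (ENNReal.ofReal p) (volume.restrict Ω) => ∫ x in Ω, ψ x • L (w x) := by
  have hpq : p.HolderConjugate (p / (p - 1)) := Real.HolderConjugate.conjExponent hp.out
  have : Fact (1 < p / (p - 1)) := ⟨hpq.symm.lt⟩
  have := hpq.symm.ennrealOfReal
  have hm : MemLp ψ (ENNReal.ofReal (p / (p - 1))) (volume.restrict Ω) :=
    memLp_restrict_of_continuous hψ hc
  have h := ((ContinuousLinearMap.lsmul ℝ ℝ : ℝ →L[ℝ] ℂ →L[ℝ] ℂ).lpPairing (volume.restrict Ω)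
    (ENNReal.ofReal (p / (p - 1))) (ENNReal.ofReal p) (hm.toLp ψ)).continuous.comp
    (ContinuousLinearMap.compLpL (ENNReal.ofReal p) (volume.restrict Ω) L).continuous
  refine h.congr fun w => ?_
  rw [Function.comp_apply, ContinuousLinearMap.lpPairing_eq_integral]
  refine integral_congr_ae ?_
  filter_upwards [hm.coeFn_toLp, ContinuousLinearMap.coeFn_compLpL L w] with x h1 h2
  rw [h1, h2]; rfl

lemma isClosed_W1p : IsClosed (W1p Ω p : Set (LpPair Ω p)) := by
  have : (W1p Ω p : Set (LpPair Ω p)) = ⋂ (φ : E n → ℝ) (_ : IsTest Ω φ) (i : Fin n),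
      {w | ∫ x in Ω, partialD φ i x • w.1 x = - ∫ x in Ω, φ x • w.2 x i} := by
    ext w
    simp only [mem_iInter]
    rfl
  rw [this]
  refine isClosed_iInter fun φ => isClosed_iInter fun hφ => isClosed_iInter fun i => ?_
  refine isClosed_eq ?_ (Continuous.neg ?_)
  · exact (continuous_integral_smul_clm (ContinuousLinearMap.id ℝ ℂ) (hφ.continuous_partialD i)
      (hφ.hasCompactSupport_partialD i)).comp continuous_fst
  · exact (continuous_integral_smul_clm
      ((EuclideanSpace.proj i : CVec n →L[ℂ] ℂ).restrictScalars ℝ) hφ.1.continuous hφ.2.1).comp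
      continuous_snd

instance : CompleteSpace (W1p Ω p) := isClosed_W1p.completeSpace_coe

/-- Elements of `u₀ + W^{1,p}_0` with almost minimal energy are close to each other. -/
lemma IsCoeff.norm_grad_sub_rpow_le (h : IsCoeff Ω γ c M) {ε : ℝ} (hε : 0 < ε) :
    ∃ C : ℝ, 0 ≤ C ∧ ∀ (u v : W1p Ω p), c * ‖((u - v : W1p Ω p) : LpPair Ω p).2‖ ^ p ≤
      ε * (energy γ u + energy γ v) +
        C * (1 / 2 * (energy γ u + energy γ v) - energy γ ((1 / 2 : ℂ) • (u + v))) := by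
  obtain ⟨C, hC, hab⟩ := exists_norm_sub_rpow_le (F := CVec n) hp.out hε
  refine ⟨C, hC, fun u v => ?_⟩
  have iu := h.integrable_mul_norm_rpow (memLp_grad u)
  have iv := h.integrable_mul_norm_rpow (memLp_grad v)
  have iw := h.integrable_mul_norm_rpow (memLp_grad ((1 / 2 : ℂ) • (u + v)))
  have id' := h.integrable_mul_norm_rpow (memLp_grad (u - v))
  have e : ‖((u - v : W1p Ω p) : LpPair Ω p).2‖ ^ p = ∫ x in Ω, ‖grad (u - v) x‖ ^ p :=
    norm_rpow_eq_integral _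
  have h1 : c * ∫ x in Ω, ‖grad (u - v) x‖ ^ p ≤ energy γ (u - v) := by
    rw [← integral_const_mul]
    refine integral_mono_ae ((integrable_norm_rpow_of_memLp (memLp_grad _)).const_mul c) id' ?_
    exact h.ae_mem.mono fun x hx => mul_le_mul_of_nonneg_right (h.le x hx) (by positivity)
  rw [e]
  refine h1.trans ?_
  unfold energy
  have iuv : Integrable (fun x => γ x * ‖grad u x‖ ^ p + γ x * ‖grad v x‖ ^ p)
      (volume.restrict Ω) := iu.add iv
  have idef : Integrable (fun x => 1 / 2 * (γ x * ‖grad u x‖ ^ p + γ x * ‖grad v x‖ ^ p) -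
      γ x * ‖grad ((1 / 2 : ℂ) • (u + v)) x‖ ^ p) (volume.restrict Ω) := (iuv.const_mul _).sub iw
  rw [← integral_add iu iv, ← integral_const_mul, ← integral_const_mul,
    ← integral_sub (iuv.const_mul _) iw, ← integral_const_mul,
    ← integral_add (iuv.const_mul _) (idef.const_mul _)]
  refine integral_mono_ae id' ((iuv.const_mul _).add
    (idef.const_mul _)) ?_
  filter_upwards [h.ae_mem, grad_sub u v, grad_smul (1 / 2 : ℂ) (u + v), grad_add u v]
    with x hx e1 e2 e3
  simp only [e1, e2, e3]
  have e4 : (1 / 2 : ℂ) • (grad u x + grad v x) = (1 / 2 : ℝ) • (grad u x + grad v x) := by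
    ext i; simp
  rw [e4]
  have := mul_le_mul_of_nonneg_left (hab (grad u x) (grad v x)) (h.nonneg x hx)
  unfold convexDefect at this
  refine this.trans (le_of_eq ?_)
  ring

lemma half_smul_add_sub {V : Type*} [AddCommGroup V] [Module ℂ V] (u v w : V) :
    (1 / 2 : ℂ) • (u + v) - w = (1 / 2 : ℂ) • ((u - w) + (v - w)) := by
  module

/-- The Poincaré inequality for the full norm of `W^{1,p}_0`. -/
lemma exists_norm_rpow_le (p : ℝ) [hp : Fact (1 < p)] (hn : 0 < n) (hΩo : IsOpen Ω)
    (hΩb : Bornology.IsBounded Ω) :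
    ∃ C : ℝ, 0 < C ∧ ∀ u ∈ W1p0 Ω p, ‖u‖ ^ p ≤ C * ‖(u : LpPair Ω p).2‖ ^ p := by
  obtain ⟨C, hC, h⟩ := exists_poincare (n := n) p hn hΩo hΩb
  refine ⟨C + 1, by positivity, fun u hu => ?_⟩
  have h1 := h u hu
  have h2 : 0 ≤ ‖(u : LpPair Ω p).2‖ ^ p := by positivity
  have h0 : ‖u‖ = max ‖(u : LpPair Ω p).1‖ ‖(u : LpPair Ω p).2‖ := rfl
  rw [h0]
  rcases max_choice ‖(u : LpPair Ω p).1‖ ‖(u : LpPair Ω p).2‖ with h3 | h3 <;> rw [h3]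
  · linarith
  · nlinarith

/-- A minimizing sequence has gradients which form a Cauchy sequence. -/
lemma IsCoeff.exists_norm_grad_sub_le (h : IsCoeff Ω γ c M) {u : ℕ → W1p Ω p} {m : ℝ}
    (hm0 : 0 ≤ m) (hu : ∀ k : ℕ, energy γ (u k) < m + 1 / ((k : ℝ) + 1))
    (hmid : ∀ i j, m ≤ energy γ ((1 / 2 : ℂ) • (u i + u j))) {δ : ℝ} (hδ : 0 < δ) :
    ∃ N : ℕ, ∀ i ≥ N, ∀ j ≥ N,
      c * ‖((u i - u j : W1p Ω p) : LpPair Ω p).2‖ ^ p ≤ δ := by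
  -- Energies along the sequence are at most `m + 1`, so this choice of `ε` makes the first term at
  -- most `δ / 2`. The midpoint energy is at least `m`, so the defect is at most `1 / (N + 1)`, and
  -- `N` is chosen next to give the other half; `C + 1` avoids dividing by zero.
  obtain ⟨C, hC, hab⟩ := h.norm_grad_sub_rpow_le (p := p)
    (ε := δ / (4 * (m + 1))) (by positivity)
  obtain ⟨N, hN⟩ := exists_nat_one_div_lt (show 0 < δ / (2 * (C + 1)) by positivity)
  refine ⟨N, fun i hi j hj => (hab _ _).trans ?_⟩
  have hle : ∀ k ≥ N, energy γ (u k) ≤ m + 1 / ((N : ℝ) + 1) := fun k hk =>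
    (hu k).le.trans (by gcongr)
  have hle1 : ∀ k ≥ N, energy γ (u k) ≤ m + 1 := fun k hk => by
    refine (hle k hk).trans ?_
    gcongr
    rw [div_le_one (by positivity)]
    linarith [(Nat.cast_nonneg N : (0 : ℝ) ≤ N)]
  have h1 : δ / (4 * (m + 1)) * (energy γ (u i) + energy γ (u j)) ≤ δ / 2 := by
    calc _ ≤ δ / (4 * (m + 1)) * ((m + 1) + (m + 1)) := by
          gcongr
          · exact hle1 i hi
          · exact hle1 j hj
      _ = δ / 2 := by field_simp; norm_num
  have h2 : C * (1 / 2 * (energy γ (u i) + energy γ (u j)) -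
      energy γ ((1 / 2 : ℂ) • (u i + u j))) ≤ δ / 2 := by
    calc _ ≤ C * (δ / (2 * (C + 1))) := by
          gcongr
          linarith [hle i hi, hle j hj, hmid i j]
      _ ≤ (C + 1) * (δ / (2 * (C + 1))) := by gcongr; linarith
      _ = δ / 2 := by field_simp
  linarith

/-- The differences lie in `W^{1,p}_0`, so by Poincaré control of their gradients controls the full
norm. -/
lemma cauchySeq_of_grad (hn : 0 < n) (hΩo : IsOpen Ω) (hΩb : Bornology.IsBounded Ω) (hc : 0 < c)
    {u : ℕ → W1p Ω p} (hsub : ∀ i j, u i - u j ∈ W1p0 Ω p)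
    (hgrad : ∀ δ > 0, ∃ N : ℕ, ∀ i ≥ N, ∀ j ≥ N,
      c * ‖((u i - u j : W1p Ω p) : LpPair Ω p).2‖ ^ p ≤ δ) : CauchySeq u := by
  have hp0 : 0 < p := by have := hp.out; linarith
  obtain ⟨CP, hCP, hP⟩ := exists_norm_rpow_le (n := n) p hn hΩo hΩb
  rw [Metric.cauchySeq_iff]
  intro ε hε
  obtain ⟨N, hN⟩ := hgrad (c * ((ε / 2) ^ p / CP)) (by positivity)
  refine ⟨N, fun i hi j hj => ?_⟩
  have h1 := le_of_mul_le_mul_left (hN i hi j hj) hc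
  have h2 := hP _ (hsub i j)
  rw [le_div_iff₀' hCP] at h1
  rw [dist_eq_norm]
  exact ((Real.rpow_le_rpow_iff (norm_nonneg _) (by positivity) hp0).1 (h2.trans h1)).trans_lt
    (half_lt_self hε)

/-- The energy attains its minimum on `u₀ + W^{1,p}_0`. -/
lemma IsCoeff.exists_minimizer (h : IsCoeff Ω γ c M) (hn : 0 < n) (hΩb : Bornology.IsBounded Ω)
    (u₀ : W1p Ω p) :
    ∃ u : W1p Ω p, u - u₀ ∈ W1p0 Ω p ∧ ∀ φ ∈ W1p0 Ω p, energy γ u ≤ energy γ (u + φ) := by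
  set m := sInf (energy γ '' {u | u - u₀ ∈ W1p0 Ω p}) with hm
  have hbdd : BddBelow (energy γ '' {u | u - u₀ ∈ W1p0 Ω p}) :=
    ⟨0, by rintro _ ⟨u, -, rfl⟩; exact h.energy_nonneg u⟩
  have hne : (energy γ '' {u | u - u₀ ∈ W1p0 Ω p}).Nonempty :=
    ⟨_, u₀, by rw [mem_ofPred_eq, sub_self]; exact Submodule.zero_mem _, rfl⟩
  have hmle : ∀ u, u - u₀ ∈ W1p0 Ω p → m ≤ energy γ u := fun u hu => csInf_le hbdd ⟨u, hu, rfl⟩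
  have hm0 : 0 ≤ m := le_csInf hne (by rintro _ ⟨u, -, rfl⟩; exact h.energy_nonneg u)
  have hseq : ∀ k : ℕ, ∃ u : W1p Ω p, u - u₀ ∈ W1p0 Ω p ∧
      energy γ u < m + 1 / ((k : ℝ) + 1) := by
    intro k
    obtain ⟨_, ⟨u, hu, rfl⟩, h1⟩ := exists_lt_of_csInf_lt hne
      (show m < m + 1 / ((k : ℝ) + 1) from lt_add_of_pos_right _ (by positivity))
    exact ⟨u, hu, h1⟩
  choose u huS hu using hseq
  have hsubS : ∀ i j, u i - u j ∈ W1p0 Ω p := fun i j => by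
    have := Submodule.sub_mem _ (huS i) (huS j)
    rwa [sub_sub_sub_cancel_right] at this
  -- Midpoints stay in the affine class. Uniform convexity then makes the minimizing sequence
  -- converge in norm, and no weak compactness is needed.
  have hmid : ∀ i j, m ≤ energy γ ((1 / 2 : ℂ) • (u i + u j)) := by
    intro i j
    refine hmle _ ?_
    rw [half_smul_add_sub]
    exact Submodule.smul_mem _ _ (Submodule.add_mem _ (huS i) (huS j))
  obtain ⟨w, hw⟩ := cauchySeq_tendsto_of_complete (cauchySeq_of_grad hn h.isOpen hΩb h.pos hsubS
    fun δ hδ => h.exists_norm_grad_sub_le hm0 hu hmid hδ)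
  have hwS : w - u₀ ∈ W1p0 Ω p :=
    isClosed_W1p0.mem_of_tendsto (hw.sub_const u₀) (.of_forall huS)
  have hwm : energy γ w ≤ m := by
    have h1 : Tendsto (fun k => energy γ (u k)) atTop (𝓝 (energy γ w)) :=
      (h.continuous_energy.tendsto w).comp hw
    have h2 : Tendsto (fun k : ℕ => m + 1 / ((k : ℝ) + 1)) atTop (𝓝 (m + 0)) :=
      tendsto_const_nhds.add tendsto_one_div_add_atTop_nhds_zero_nat
    rw [add_zero] at h2
    exact le_of_tendsto_of_tendsto' h1 h2 fun k => (hu k).le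
  refine ⟨w, hwS, fun φ hφ => hwm.trans (hmle _ ?_)⟩
  rw [add_sub_right_comm]
  exact Submodule.add_mem _ hwS hφ

/-- The Dirichlet-to-Neumann map sends the boundary values of `u₀` to the current of a weak
solution with these boundary values. -/
lemma IsCoeff.dnMap_spec (h : IsCoeff Ω γ c M) (hn : 0 < n) (hΩb : Bornology.IsBounded Ω)
    (f : TraceSpace Ω p) : IsCurrent γ f (dnMap Ω p γ f) := by
  obtain ⟨u₀, rfl⟩ := Submodule.Quotient.mk_surjective _ f
  obtain ⟨u, hu, hmin⟩ := h.exists_minimizer hn hΩb u₀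
  have hsol := h.isWeakSolution_of_minimizer hmin
  obtain ⟨ℓ, hℓ⟩ := h.exists_current hsol
  have hex : ∃ ℓ, IsCurrent γ (Submodule.Quotient.mk u₀ : TraceSpace Ω p) ℓ :=
    ⟨ℓ, u, trace_eq_trace_iff.2 hu, hsol, hℓ⟩
  -- Uniqueness of the solution plays no role: whichever current is chosen comes with a weak
  -- solution.
  rw [dnMap, dif_pos hex]
  exact hex.choose_spec

/-- If the Dirichlet-to-Neumann maps agree, then solutions with the same boundary values have
the same energy. -/
lemma exists_solution_energy_le {γ₁ γ₂ : E n → ℝ} {c₁ M₁ c₂ M₂ : ℝ} (h₁ : IsCoeff Ω γ₁ c₁ M₁)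
    (h₂ : IsCoeff Ω γ₂ c₂ M₂) (hn : 0 < n) (hΩb : Bornology.IsBounded Ω)
    (hΛ : dnMap Ω p γ₁ = dnMap Ω p γ₂) (u₀ : W1p Ω p) :
    ∃ u : W1p Ω p, u - u₀ ∈ W1p0 Ω p ∧
      ∀ w : W1p Ω p, w - u₀ ∈ W1p0 Ω p → energy γ₁ u ≤ energy γ₂ w := by
  obtain ⟨u₁, t₁, s₁, e₁⟩ := h₁.dnMap_spec hn hΩb (trace u₀ : TraceSpace Ω p)
  obtain ⟨u₂, t₂, s₂, e₂⟩ := h₂.dnMap_spec hn hΩb (trace u₀ : TraceSpace Ω p)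
  refine ⟨u₁, trace_eq_trace_iff.1 t₁, fun w hw => ?_⟩
  have htr : (trace (conj u₁) : TraceSpace Ω p) = trace (conj u₂) := by
    rw [trace_eq_trace_iff, ← conj_sub]
    exact conj_mem_W1p0 (trace_eq_trace_iff.1 (t₁.trans t₂.symm))
  -- Each energy is the real part of the common current at the trace of the conjugate solution, and
  -- these traces agree.
  have heq : energy γ₁ u₁ = energy γ₂ u₂ := by
    rw [← h₁.re_energyPairing_conj_self, ← h₂.re_energyPairing_conj_self, ← e₁, ← e₂, hΛ, htr]
  rw [heq]
  refine h₂.energy_le_of_isWeakSolution s₂ (trace_eq_trace_iff.1 ?_)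
  exact (trace_eq_trace_iff.2 hw).trans t₂.symm

end Existence

/-! ### Regularized inverse distance and logarithmic cutoffs. -/

section Cutoff

variable {n : ℕ}

lemma exists_deriv_smoothTransition_le :
    ∃ B : ℝ, 0 < B ∧ ∀ t, |deriv Real.smoothTransition t| ≤ B := by
  have hc : Continuous (deriv Real.smoothTransition) :=
    (Real.smoothTransition.contDiff (n := 1)).continuous_deriv (by simp)
  have hs : HasCompactSupport (deriv Real.smoothTransition) := by
    refine HasCompactSupport.intro (isCompact_Icc (a := (0 : ℝ)) (b := 1)) fun t ht => ?_
    rw [mem_Icc, not_and_or, not_le, not_le] at ht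
    rcases ht with ht | ht
    · have : Real.smoothTransition =ᶠ[𝓝 t] fun _ => 0 := by
        filter_upwards [Iio_mem_nhds ht] with s hs
        exact Real.smoothTransition.zero_of_nonpos (le_of_lt hs)
      rw [this.deriv_eq, deriv_const]
    · have : Real.smoothTransition =ᶠ[𝓝 t] fun _ => 1 := by
        filter_upwards [Ioi_mem_nhds ht] with s hs
        exact Real.smoothTransition.one_of_one_le (le_of_lt hs)
      rw [this.deriv_eq, deriv_const]
  obtain ⟨B, hB⟩ := hc.bounded_above_of_compact_support hs
  exact ⟨|B| + 1, by positivity, fun t => (hB t).trans ((le_abs_self B).trans (by linarith))⟩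

/-- The regularized inverse distance `(|x - x₀|² + δ²)^{-1/2}`. -/
def invDist (x₀ : E n) (δ : ℝ) (x : E n) : ℝ := (‖x - x₀‖ ^ 2 + δ ^ 2) ^ (-(1 / 2) : ℝ)

lemma normSq_add_pos (x₀ x : E n) {δ : ℝ} (hδ : 0 < δ) : 0 < ‖x - x₀‖ ^ 2 + δ ^ 2 := by
  positivity

lemma invDist_pos (x₀ x : E n) {δ : ℝ} (hδ : 0 < δ) : 0 < invDist x₀ δ x :=
  Real.rpow_pos_of_pos (normSq_add_pos x₀ x hδ) _

lemma invDist_sq (x₀ x : E n) {δ : ℝ} (hδ : 0 < δ) :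
    invDist x₀ δ x ^ 2 = (‖x - x₀‖ ^ 2 + δ ^ 2)⁻¹ := by
  have h := normSq_add_pos x₀ x hδ
  rw [invDist, ← Real.rpow_natCast, ← Real.rpow_mul h.le]
  norm_num
  rw [Real.rpow_neg_one]

lemma norm_mul_invDist_le (x₀ x : E n) {δ : ℝ} (hδ : 0 < δ) :
    ‖x - x₀‖ * invDist x₀ δ x ≤ 1 := by
  have h1 := invDist_sq x₀ x hδ
  have h := normSq_add_pos x₀ x hδ
  have h2 : (‖x - x₀‖ * invDist x₀ δ x) ^ 2 ≤ 1 := by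
    rw [mul_pow, h1, ← div_eq_mul_inv, div_le_one h]
    linarith [sq_nonneg δ]
  exact (sq_le_one_iff₀ (mul_nonneg (norm_nonneg _) (invDist_pos x₀ x hδ).le)).1 h2

lemma contDiff_normSq_sub (x₀ : E n) {k : WithTop ℕ∞} : ContDiff ℝ k fun x : E n => ‖x - x₀‖ ^ 2 :=
  (contDiff_id.sub contDiff_const).norm_sq ℝ

lemma contDiff_invDist (x₀ : E n) {δ : ℝ} (hδ : 0 < δ) {k : WithTop ℕ∞} :
    ContDiff ℝ k (invDist x₀ δ) :=
  ((contDiff_normSq_sub x₀).add contDiff_const).rpow_const_of_ne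
    fun x => (normSq_add_pos x₀ x hδ).ne'

lemma hasFDerivAt_normSq_sub (x₀ x : E n) :
    HasFDerivAt (fun x : E n => ‖x - x₀‖ ^ 2) ((2 : ℝ) • innerSL ℝ (x - x₀)) x := by
  have := ((hasFDerivAt_id x).sub_const x₀).norm_sq
  refine this.congr_fderiv ?_
  ext v
  simp

/-- Evaluate the derivative of `χ` at the gradient vector itself. -/
lemma norm_classicalGrad_ofReal_le {χ : E n → ℝ} (hχ : ContDiff ℝ 1 χ) (x : E n) :
    ‖classicalGrad (fun y => (χ y : ℂ)) x‖ ≤ ‖fderiv ℝ χ x‖ := by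
  set g : E n := WithLp.toLp 2 fun i => partialD χ i x with hg
  have h1 : ‖classicalGrad (fun y => (χ y : ℂ)) x‖ = ‖g‖ := by
    rw [EuclideanSpace.norm_eq, EuclideanSpace.norm_eq]
    congr 1
    refine Finset.sum_congr rfl fun i _ => ?_
    simp only [classicalGrad, partialD_ofReal hχ, Complex.norm_real, hg]
  have h2 : fderiv ℝ χ x g = ‖g‖ ^ 2 := by
    rw [fderiv_apply_eq_sum, EuclideanSpace.norm_sq_eq]
    refine Finset.sum_congr rfl fun i _ => ?_
    simp only [hg, smul_eq_mul, Real.norm_eq_abs, sq_abs]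
    ring
  have h3 : ‖g‖ ^ 2 ≤ ‖fderiv ℝ χ x‖ * ‖g‖ := by
    rw [← h2]
    exact (le_abs_self _).trans ((fderiv ℝ χ x).le_opNorm g)
  rw [h1]
  rcases (norm_nonneg g).eq_or_lt with h0 | h0
  · rw [← h0]; exact norm_nonneg _
  · rw [sq] at h3
    exact le_of_mul_le_mul_right h3 h0

lemma classicalGrad_eq_zero_of_eventuallyEq_const {φ : E n → ℂ} {x : E n} {a : ℂ}
    (h : φ =ᶠ[𝓝 x] fun _ => a) : classicalGrad φ x = 0 := by
  ext i
  simp [classicalGrad, partialD, h.fderiv_eq]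

/-- A logarithmic cutoff function around `x₀`. -/
lemma exists_log_cutoff (x₀ : E n) {r ε : ℝ} (hr : 0 < r) (hε : 0 < ε) :
    ∃ δ : ℝ, 0 < δ ∧ δ < r ∧ ∃ χ : E n → ℝ, ContDiff ℝ ∞ χ ∧ HasCompactSupport χ ∧
      (∀ x, 0 ≤ χ x) ∧ (∀ x, χ x ≤ 1) ∧
      (∀ x, ‖x - x₀‖ ≤ δ → χ x = 1) ∧ (∀ x, r ≤ ‖x - x₀‖ → χ x = 0) ∧
      (∀ x, ‖classicalGrad (fun y => (χ y : ℂ)) x‖ ≤ ε * invDist x₀ δ x) ∧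
      (∀ x, ‖x - x₀‖ < δ ∨ r < ‖x - x₀‖ → classicalGrad (fun y => (χ y : ℂ)) x = 0) := by
  obtain ⟨B, hB, hBt⟩ := exists_deriv_smoothTransition_le
  -- The cutoff is a transition function in the variable `log(|x - x₀|² + δ²)`, spread over a length
  -- `L ≥ T`. This logarithm has gradient at most `2 σ` with `σ = invDist x₀ δ`, so `|∇χ| ≤ (2 B /
  -- T) σ ≤ ε σ`.
  set T : ℝ := 1 + 2 * B / ε with hT
  have hT1 : 1 ≤ T := le_add_of_nonneg_right (by positivity)
  set δ : ℝ := r * Real.exp (-T) with hδ_def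
  have hδ : 0 < δ := by positivity
  have hδr : δ < r := mul_lt_of_lt_one_right hr (by rw [← Real.exp_zero]; exact Real.exp_lt_exp.2 (by linarith))
  set L : ℝ := Real.log (r ^ 2 + δ ^ 2) - Real.log (2 * δ ^ 2) with hL_def
  -- With `δ = r exp(-T)` one has `L ≥ 2 T - log 2`, and `log 2 < 1 ≤ T`.
  have hL : T ≤ L := by
    have h1 : Real.log (r ^ 2) ≤ Real.log (r ^ 2 + δ ^ 2) :=
      Real.log_le_log (by positivity) (by linarith [sq_nonneg δ])
    have h2 : Real.log (2 * δ ^ 2) = Real.log 2 + (Real.log (r ^ 2) - 2 * T) := by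
      rw [Real.log_mul (by norm_num) (by positivity), hδ_def, mul_pow,
        Real.log_mul (by positivity) (by positivity), ← Real.exp_nat_mul, Real.log_exp]
      push_cast; ring
    have h3 := Real.log_two_lt_d9
    rw [hL_def, h2]
    linarith
  have hL0 : 0 < L := by linarith
  set χ : E n → ℝ := fun x =>
    Real.smoothTransition ((Real.log (r ^ 2 + δ ^ 2) - Real.log (‖x - x₀‖ ^ 2 + δ ^ 2)) / L)
    with hχ_def
  have hpos : ∀ x, 0 < ‖x - x₀‖ ^ 2 + δ ^ 2 := fun x => normSq_add_pos x₀ x hδ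
  have hχs : ContDiff ℝ ∞ χ := by
    refine Real.smoothTransition.contDiff.comp (ContDiff.div_const (contDiff_const.sub ?_) _)
    exact ((contDiff_normSq_sub x₀).add contDiff_const).log fun x => (hpos x).ne'
  have hone : ∀ x, ‖x - x₀‖ ≤ δ → χ x = 1 := by
    intro x hx
    refine Real.smoothTransition.one_of_one_le ?_
    rw [le_div_iff₀ hL0, one_mul, hL_def]
    have : Real.log (‖x - x₀‖ ^ 2 + δ ^ 2) ≤ Real.log (2 * δ ^ 2) :=
      Real.log_le_log (hpos x) (by nlinarith [norm_nonneg (x - x₀)])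
    linarith
  have hzero : ∀ x, r ≤ ‖x - x₀‖ → χ x = 0 := by
    intro x hx
    refine Real.smoothTransition.zero_of_nonpos (div_nonpos_of_nonpos_of_nonneg ?_ hL0.le)
    have : Real.log (r ^ 2 + δ ^ 2) ≤ Real.log (‖x - x₀‖ ^ 2 + δ ^ 2) :=
      Real.log_le_log (by positivity) (by nlinarith)
    linarith
  refine ⟨δ, hδ, hδr, χ, hχs, ?_, fun x => Real.smoothTransition.nonneg _,
    fun x => Real.smoothTransition.le_one _, hone, hzero, fun x => ?_, fun x hx => ?_⟩
  · refine HasCompactSupport.intro (isCompact_closedBall x₀ r) fun x hx => hzero x ?_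
    rw [mem_closedBall_iff_norm, not_le] at hx
    exact hx.le
  · refine (norm_classicalGrad_ofReal_le (hχs.of_le (by simp)) x).trans ?_
    set t := (Real.log (r ^ 2 + δ ^ 2) - Real.log (‖x - x₀‖ ^ 2 + δ ^ 2)) / L with ht
    have hd : HasFDerivAt χ (deriv Real.smoothTransition t •
        (L⁻¹ • -((‖x - x₀‖ ^ 2 + δ ^ 2)⁻¹ • ((2 : ℝ) • innerSL ℝ (x - x₀))))) x := by
      have h1 := ((hasFDerivAt_normSq_sub x₀ x).add_const (δ ^ 2)).log (hpos x).ne'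
      have h2 := (h1.const_sub (Real.log (r ^ 2 + δ ^ 2))).mul_const L⁻¹
      have h3 : HasDerivAt Real.smoothTransition (deriv Real.smoothTransition t) t :=
        (((Real.smoothTransition.contDiff (n := 1)).differentiable (by simp)) t).hasDerivAt
      exact h3.comp_hasFDerivAt x h2
    rw [hd.fderiv, norm_smul, norm_smul, norm_neg, norm_smul, norm_smul, innerSL_apply_norm,
      ← invDist_sq x₀ x hδ]
    have hσ := invDist_pos x₀ x hδ
    rw [Real.norm_of_nonneg (by positivity : 0 ≤ L⁻¹), Real.norm_of_nonneg (sq_nonneg _),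
      Real.norm_of_nonneg (by norm_num : (0 : ℝ) ≤ 2), Real.norm_eq_abs]
    calc |deriv Real.smoothTransition t| * (L⁻¹ * (invDist x₀ δ x ^ 2 * (2 * ‖x - x₀‖)))
        ≤ B * (T⁻¹ * (invDist x₀ δ x * (2 * 1))) := by
          gcongr ?_ * (?_ * ?_)
          · exact hBt t
          · gcongr
          · have := norm_mul_invDist_le x₀ x hδ
            nlinarith
      _ = 2 * B / T * invDist x₀ δ x := by ring
      _ ≤ ε * invDist x₀ δ x := by
          gcongr
          rw [div_le_iff₀ (by linarith), hT, mul_add, mul_one, mul_div_cancel₀ _ hε.ne']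
          linarith
  · rcases hx with hx | hx
    · refine classicalGrad_eq_zero_of_eventuallyEq_const (a := 1) ?_
      have : ∀ᶠ y in 𝓝 x, ‖y - x₀‖ < δ :=
        (continuous_id.sub continuous_const).norm.continuousAt.eventually_lt continuousAt_const hx
      filter_upwards [this] with y hy
      rw [hone y hy.le, Complex.ofReal_one]
    · refine classicalGrad_eq_zero_of_eventuallyEq_const (a := 0) ?_
      have : ∀ᶠ y in 𝓝 x, r < ‖y - x₀‖ :=
        continuousAt_const.eventually_lt (continuous_id.sub continuous_const).norm.continuousAt hx
      filter_upwards [this] with y hy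
      rw [hzero y hy.le, Complex.ofReal_zero]

end Cutoff

/-! ### The tangential vector field behind the Hardy inequality on shells. -/

section Field

variable {n : ℕ}

lemma divergence_eq_of_hasFDerivAt {V : E n → E n} {L : E n →L[ℝ] E n} {x : E n}
    (h : HasFDerivAt V L x) : divergence V x = ∑ i, L (EuclideanSpace.single i 1) i := by
  refine Finset.sum_congr rfl fun i _ => ?_
  have : HasFDerivAt (fun y => V y i) ((EuclideanSpace.proj (𝕜 := ℝ) i).comp L) x :=
    (EuclideanSpace.proj (𝕜 := ℝ) i).hasFDerivAt.comp x h
  rw [partialD, this.fderiv]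
  rfl

open scoped InnerProductSpace in
/-- The divergence of a field which is tangent to the spheres around `x₀` and points away
from `e`. -/
lemma divergence_tangential (e x₀ x : E n) (he : ‖e‖ = 1) {k₁ k₂ : ℝ → ℝ} {a₁ a₂ : ℝ}
    (h₁ : HasDerivAt k₁ a₁ (‖x - x₀‖ ^ 2)) (h₂ : HasDerivAt k₂ a₂ (‖x - x₀‖ ^ 2)) :
    divergence (fun x => (⟪e, x - x₀⟫_ℝ * k₂ (‖x - x₀‖ ^ 2) - 2 * k₁ (‖x - x₀‖ ^ 2)) •
        (‖x - x₀‖ ^ 2 • e - ⟪e, x - x₀⟫_ℝ • (x - x₀))) x =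
      k₂ (‖x - x₀‖ ^ 2) * (‖x - x₀‖ ^ 2 - ⟪e, x - x₀⟫_ℝ ^ 2) +
        (n - 1) * ⟪e, x - x₀⟫_ℝ *
          (2 * k₁ (‖x - x₀‖ ^ 2) - ⟪e, x - x₀⟫_ℝ * k₂ (‖x - x₀‖ ^ 2)) := by
  have dN := hasFDerivAt_normSq_sub x₀ x
  have dI : HasFDerivAt (fun x => ⟪e, x - x₀⟫_ℝ) (innerSL ℝ e) x :=
    (innerSL ℝ e).hasFDerivAt.comp x ((hasFDerivAt_id x).sub_const x₀)
  have dX : HasFDerivAt (fun x => x - x₀) (ContinuousLinearMap.id ℝ (E n)) x :=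
    (hasFDerivAt_id x).sub_const x₀
  have d1 := h₁.comp_hasFDerivAt x dN
  have d2 := h₂.comp_hasFDerivAt x dN
  have dΘ := (dI.mul d2).sub (d1.const_mul 2)
  have dT := (dN.smul_const e).sub (dI.smul dX)
  refine (divergence_eq_of_hasFDerivAt (V := fun x =>
    (⟪e, x - x₀⟫_ℝ * k₂ (‖x - x₀‖ ^ 2) - 2 * k₁ (‖x - x₀‖ ^ 2)) •
        (‖x - x₀‖ ^ 2 • e - ⟪e, x - x₀⟫_ℝ • (x - x₀))) (dΘ.smul dT)).trans ?_
  set y := x - x₀ with hy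
  set q := ⟪e, y⟫_ℝ with hq
  set T : E n := ‖y‖ ^ 2 • e - q • y with hT
  -- The derivatives `a₁`, `a₂` of the radial factors enter the divergence only through `⟪y, T⟫`,
  -- which vanishes. Hence radial cutoffs cost nothing.
  have hyT : ⟪y, T⟫_ℝ = 0 := by
    rw [hT, inner_sub_right, inner_smul_right, inner_smul_right, real_inner_self_eq_norm_sq,
      real_inner_comm, ← hq]
    ring
  have heT : ⟪e, T⟫_ℝ = ‖y‖ ^ 2 - q ^ 2 := by
    rw [hT, inner_sub_right, inner_smul_right, inner_smul_right, real_inner_self_eq_norm_sq, he,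
      ← hq]
    ring
  have hin : ∀ a b : E n, ⟪a, b⟫_ℝ = ∑ i, a i * b i := fun a b => by
    simp [PiLp.inner_apply, mul_comm]
  have hsingle : ∀ (a : E n) (i : Fin n), ⟪a, EuclideanSpace.single i (1 : ℝ)⟫_ℝ = a i := by
    intro a i
    rw [EuclideanSpace.inner_single_right]
    simp
  set Θ : ℝ := q * k₂ (‖y‖ ^ 2) - 2 * k₁ (‖y‖ ^ 2) with hΘ
  have hterm : ∀ i : Fin n, (Θ • ((((2 : ℝ) • innerSL ℝ y).smulRight e) -
        (q • ContinuousLinearMap.id ℝ (E n) + (innerSL ℝ e).smulRight y)) +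
      (q • a₂ • (2 : ℝ) • innerSL ℝ y + k₂ (‖y‖ ^ 2) • innerSL ℝ e -
        (2 : ℝ) • a₁ • (2 : ℝ) • innerSL ℝ y).smulRight T) (EuclideanSpace.single i (1 : ℝ)) i =
      Θ * (y i * e i) + Θ * (-q) + (2 * q * a₂ - 4 * a₁) * (y i * T i) +
        k₂ (‖y‖ ^ 2) * (e i * T i) := by
    intro i
    simp only [add_apply, smul_apply, sub_apply, ContinuousLinearMap.smulRight_apply,
      ContinuousLinearMap.id_apply, innerSL_apply_apply, hsingle, PiLp.add_apply, PiLp.sub_apply,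
      PiLp.smul_apply, smul_eq_mul, PiLp.single_apply, if_true]
    ring
  refine (Finset.sum_congr rfl fun i _ => hterm i).trans ?_
  rw [Finset.sum_add_distrib, Finset.sum_add_distrib, Finset.sum_add_distrib, ← Finset.mul_sum,
    ← Finset.mul_sum, ← Finset.mul_sum, ← Finset.mul_sum, ← hin, ← hin, ← hin, hyT, heT, real_inner_comm, ← hq,
    Finset.sum_const, Finset.card_univ, Fintype.card_fin, nsmul_eq_mul, hΘ]
  ring

/-- A radial cutoff, as a function of `t = |x - x₀|²`, which is one for `δ² ≤ t ≤ r²` and zero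
unless `δ² / 4 < t < 4 r²`. -/
def shellCutoff (δ r t : ℝ) : ℝ :=
  Real.smoothTransition ((4 * t / δ ^ 2 - 1) / 3) * Real.smoothTransition ((4 - t / r ^ 2) / 3)

lemma shellCutoff_nonneg (δ r t : ℝ) : 0 ≤ shellCutoff δ r t :=
  mul_nonneg (Real.smoothTransition.nonneg _) (Real.smoothTransition.nonneg _)

lemma shellCutoff_le_one (δ r t : ℝ) : shellCutoff δ r t ≤ 1 :=
  mul_le_one₀ (Real.smoothTransition.le_one _) (Real.smoothTransition.nonneg _)
    (Real.smoothTransition.le_one _)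

lemma shellCutoff_eq_one {δ r t : ℝ} (hδ : 0 < δ) (hr : 0 < r) (h1 : δ ^ 2 ≤ t)
    (h2 : t ≤ r ^ 2) : shellCutoff δ r t = 1 := by
  have e1 : 1 ≤ t / δ ^ 2 := (one_le_div (by positivity)).2 h1
  have e2 : t / r ^ 2 ≤ 1 := (div_le_one (by positivity)).2 h2
  rw [shellCutoff, Real.smoothTransition.one_of_one_le, Real.smoothTransition.one_of_one_le,
    one_mul]
  · linarith
  · rw [mul_div_assoc]; linarith

lemma shellCutoff_eq_zero_of_le {δ r t : ℝ} (hδ : 0 < δ) (h : t ≤ δ ^ 2 / 4) :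
    shellCutoff δ r t = 0 := by
  have e1 : t / δ ^ 2 ≤ 1 / 4 := by rw [div_le_iff₀ (by positivity)]; linarith
  rw [shellCutoff, Real.smoothTransition.zero_of_nonpos, zero_mul]
  rw [mul_div_assoc]; linarith

lemma shellCutoff_eq_zero_of_ge {δ r t : ℝ} (hr : 0 < r) (h : 4 * r ^ 2 ≤ t) :
    shellCutoff δ r t = 0 := by
  have e1 : 4 ≤ t / r ^ 2 := by rw [le_div_iff₀ (by positivity)]; linarith
  rw [shellCutoff, Real.smoothTransition.zero_of_nonpos (x := (4 - t / r ^ 2) / 3), mul_zero]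
  linarith

lemma contDiff_shellCutoff (δ r : ℝ) {k : ℕ∞} : ContDiff ℝ k (shellCutoff δ r) :=
  (Real.smoothTransition.contDiff.comp
    ((((contDiff_const.mul contDiff_id).div_const _).sub contDiff_const).div_const _)).mul
  (Real.smoothTransition.contDiff.comp
    ((contDiff_const.sub (contDiff_id.div_const _)).div_const _))

/-- This is the divergence of the tangential field in scaled variables `m = |x - x₀| σ` and `s = ⟪e,
x - x₀⟫ σ`. For `s ≥ 0` the last term is at least `s ^ 2`, because `N - 1 ≥ 1`, and it compensates
`-s ^ 2`. For `s < 0` the cone condition makes `N s` at least `-1 / 40`, so the loss is small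
compared with `m ^ 2 ≥ 1 / 5`. -/
lemma angular_lower_bound {N s m : ℝ} (hN : 2 ≤ N) (hm : 1 / 5 ≤ m ^ 2) (hm1 : m ≤ 1)
    (hs : -(1 / (40 * N)) * m ≤ s) (hsm : s ≤ m) :
    1 / 10 ≤ (m ^ 2 - s ^ 2) + (N - 1) * s * (2 - s) := by
  rcases le_total 0 s with h | h
  · have h1 : s * s ≤ s * (2 - s) := mul_le_mul_of_nonneg_left (by linarith) h
    have h2 : 0 ≤ s * (2 - s) := mul_nonneg h (by linarith)
    nlinarith
  · have hN0 : 0 < N := by linarith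
    have h1 : -(1 / (40 * N)) ≤ s := by
      refine le_trans ?_ hs
      have : 0 ≤ 1 / (40 * N) := by positivity
      nlinarith
    have h2 : -(1 / 40) ≤ N * s := by
      have := mul_le_mul_of_nonneg_left h1 hN0.le
      have e : N * -(1 / (40 * N)) = -(1 / 40) := by field_simp
      linarith
    have h3 : -(1 / 80) ≤ s := by nlinarith
    have h4 : -(1 / 40) ≤ (N - 1) * s := by nlinarith
    have h5 : s ^ 2 ≤ 1 / 80 := by nlinarith
    nlinarith

open scoped InnerProductSpace in
/-- The tangential field used for the Hardy inequality near a boundary point `x₀` at which `Ω`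
satisfies an exterior cone condition. -/
lemma exists_hardyField (hn : 2 ≤ n) {p : ℝ} {Ω : Set (E n)} {e x₀ : E n}
    (he : ‖e‖ = 1) {δ r : ℝ} (hδ : 0 < δ) (hr : 0 < r)
    (hcone : ∀ x ∈ Ω, ‖x - x₀‖ ≤ 2 * r → -(1 / (40 * n)) * ‖x - x₀‖ ≤ ⟪e, x - x₀⟫_ℝ) :
    ∃ V, HardyField Ω p 60 V (fun x => shellCutoff δ r (‖x - x₀‖ ^ 2)) (invDist x₀ δ) := by
  have hn' : (2 : ℝ) ≤ n := by exact_mod_cast hn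
  set σ : ℝ → ℝ := fun t => (t + δ ^ 2) ^ (-(1 / 2) : ℝ) with hσ_def
  -- The exponents `p + 1` and `p + 2` used for `k` below give the field the size `σ ^ (p - 1)` and
  -- its divergence the size `σ ^ p`.
  set k : ℝ → ℝ → ℝ := fun a t => shellCutoff δ r t * σ t ^ a with hk_def
  have hσpos : ∀ t, 0 ≤ t → 0 < σ t := fun t ht => Real.rpow_pos_of_pos (by positivity) _
  have hkd : ∀ a t, 0 ≤ t → DifferentiableAt ℝ (k a) t := by
    intro a t ht
    have h1 : DifferentiableAt ℝ σ t :=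
      (differentiableAt_id.add_const _).rpow_const (Or.inl (by simp only [id]; positivity))
    exact ((contDiff_shellCutoff δ r (k := 1)).differentiable (by simp) t).mul
      (h1.rpow_const (Or.inl (hσpos t ht).ne'))
  have hsm : ContDiff ℝ 1 fun x : E n => shellCutoff δ r (‖x - x₀‖ ^ 2) :=
    (contDiff_shellCutoff δ r (k := 1)).comp (contDiff_normSq_sub x₀)
  have hks : ∀ a, ContDiff ℝ 1 fun x : E n => k a (‖x - x₀‖ ^ 2) := fun a =>
    hsm.mul ((contDiff_invDist x₀ hδ).rpow_const_of_ne fun x => (invDist_pos x₀ x hδ).ne')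
  have hinner : ContDiff ℝ 1 fun x : E n => ⟪e, x - x₀⟫_ℝ :=
    contDiff_const.inner ℝ (contDiff_id.sub contDiff_const)
  -- The factor 10 turns the lower bound `1 / 10` of `angular_lower_bound` into one.
  set V : E n → E n := fun x =>
    (10 : ℝ) • ((⟪e, x - x₀⟫_ℝ * k (p + 2) (‖x - x₀‖ ^ 2) - 2 * k (p + 1) (‖x - x₀‖ ^ 2)) •
      (‖x - x₀‖ ^ 2 • e - ⟪e, x - x₀⟫_ℝ • (x - x₀))) with hV_def
  have hV0 : ContDiff ℝ 1 fun x : E n =>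
      (⟪e, x - x₀⟫_ℝ * k (p + 2) (‖x - x₀‖ ^ 2) - 2 * k (p + 1) (‖x - x₀‖ ^ 2)) •
      (‖x - x₀‖ ^ 2 • e - ⟪e, x - x₀⟫_ℝ • (x - x₀)) :=
    ((hinner.mul (hks _)).sub (contDiff_const.mul (hks _))).smul
      (((contDiff_normSq_sub x₀).smul contDiff_const).sub
        (hinner.smul (contDiff_id.sub contDiff_const)))
  have hq : ∀ x, |⟪e, x - x₀⟫_ℝ| ≤ ‖x - x₀‖ := fun x => by
    simpa [he] using abs_real_inner_le_norm e (x - x₀)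
  refine ⟨V, ?_, hsm.continuous, (contDiff_invDist x₀ hδ (k := 1)).continuous,
    fun x => shellCutoff_nonneg _ _ _, fun x => (invDist_pos x₀ x hδ).le, fun x hx => ?_,
    fun x hx => ?_⟩
  · exact hV0.const_smul (10 : ℝ)
  · have hdiv : divergence V x = 10 * (k (p + 2) (‖x - x₀‖ ^ 2) *
        (‖x - x₀‖ ^ 2 - ⟪e, x - x₀⟫_ℝ ^ 2) + (n - 1) * ⟪e, x - x₀⟫_ℝ *
          (2 * k (p + 1) (‖x - x₀‖ ^ 2) - ⟪e, x - x₀⟫_ℝ * k (p + 2) (‖x - x₀‖ ^ 2))) := by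
      rw [← divergence_tangential e x₀ x he (hkd (p + 1) _ (sq_nonneg _)).hasDerivAt
        (hkd (p + 2) _ (sq_nonneg _)).hasDerivAt]
      have hd := (hV0.differentiable (by simp) x).hasFDerivAt
      rw [divergence_eq_of_hasFDerivAt hd, divergence_eq_of_hasFDerivAt (V := V) (hd.const_smul (10 : ℝ)),
        Finset.mul_sum]
      rfl
    rw [hdiv]
    by_cases hw : shellCutoff δ r (‖x - x₀‖ ^ 2) = 0
    · simp [hk_def, hw]
    -- Where the cutoff is nonzero, `δ² < 4 |x - x₀|²`, which gives `m ^ 2 ≥ 1 / 5`, and `|x - x₀| <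
    -- 2 r`, which gives the cone condition.
    have ht1 : δ ^ 2 / 4 < ‖x - x₀‖ ^ 2 := by
      by_contra! h
      exact hw (shellCutoff_eq_zero_of_le hδ h)
    have ht2 : ‖x - x₀‖ ^ 2 < 4 * r ^ 2 := by
      by_contra! h
      exact hw (shellCutoff_eq_zero_of_ge hr h)
    have hx2 : ‖x - x₀‖ ≤ 2 * r := by nlinarith [norm_nonneg (x - x₀)]
    have hσ := invDist_pos x₀ x hδ
    have hσe : σ (‖x - x₀‖ ^ 2) = invDist x₀ δ x := rfl
    have hm := norm_mul_invDist_le x₀ x hδ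
    have hlow := angular_lower_bound (N := n) (s := ⟪e, x - x₀⟫_ℝ * invDist x₀ δ x)
      (m := ‖x - x₀‖ * invDist x₀ δ x) hn' (by
        rw [mul_pow, invDist_sq x₀ x hδ, ← div_eq_mul_inv, le_div_iff₀ (normSq_add_pos x₀ x hδ)]
        linarith) hm (by
        rw [← mul_assoc]
        exact mul_le_mul_of_nonneg_right (hcone x hx hx2) hσ.le)
      (mul_le_mul_of_nonneg_right ((le_abs_self _).trans (hq x)) hσ.le)
    have hw0 := shellCutoff_nonneg δ r (‖x - x₀‖ ^ 2)
    have e1 : σ (‖x - x₀‖ ^ 2) ^ (p + 1) = invDist x₀ δ x ^ p * invDist x₀ δ x := by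
      rw [hσe, Real.rpow_add_one hσ.ne']
    have e2 : σ (‖x - x₀‖ ^ 2) ^ (p + 2) = invDist x₀ δ x ^ p * invDist x₀ δ x ^ 2 := by
      rw [hσe, Real.rpow_add hσ, Real.rpow_two]
    simp only [hk_def, e1, e2]
    have hp0 : 0 ≤ shellCutoff δ r (‖x - x₀‖ ^ 2) * invDist x₀ δ x ^ p := by positivity
    have := mul_le_mul_of_nonneg_left hlow hp0
    linarith
  · have hσ := invDist_pos x₀ x hδ
    have hσe : σ (‖x - x₀‖ ^ 2) = invDist x₀ δ x := rfl
    have hm := norm_mul_invDist_le x₀ x hδ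
    have hw0 := shellCutoff_nonneg δ r (‖x - x₀‖ ^ 2)
    have hT : ‖‖x - x₀‖ ^ 2 • e - ⟪e, x - x₀⟫_ℝ • (x - x₀)‖ ≤ 2 * ‖x - x₀‖ ^ 2 := by
      refine (norm_sub_le _ _).trans ?_
      rw [norm_smul, norm_smul, he, Real.norm_eq_abs, Real.norm_eq_abs, abs_of_nonneg (sq_nonneg _)]
      nlinarith [hq x, norm_nonneg (x - x₀)]
    have e1 : σ (‖x - x₀‖ ^ 2) ^ (p + 1) = invDist x₀ δ x ^ (p - 1) * invDist x₀ δ x ^ 2 := by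
      rw [hσe, ← Real.rpow_two, ← Real.rpow_add hσ]; ring_nf
    have e2 : σ (‖x - x₀‖ ^ 2) ^ (p + 2) =
        invDist x₀ δ x ^ (p - 1) * invDist x₀ δ x ^ 2 * invDist x₀ δ x := by
      rw [hσe, ← Real.rpow_two, ← Real.rpow_add hσ, ← Real.rpow_add_one hσ.ne']; ring_nf
    set w := shellCutoff δ r (‖x - x₀‖ ^ 2) with hw_def
    set A := w * invDist x₀ δ x ^ (p - 1) with hA
    have hA0 : 0 ≤ A := by positivity
    have hΘ : |⟪e, x - x₀⟫_ℝ * k (p + 2) (‖x - x₀‖ ^ 2) - 2 * k (p + 1) (‖x - x₀‖ ^ 2)| ≤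
        3 * (A * invDist x₀ δ x ^ 2) := by
      have e3 : ⟪e, x - x₀⟫_ℝ * k (p + 2) (‖x - x₀‖ ^ 2) - 2 * k (p + 1) (‖x - x₀‖ ^ 2) =
          (A * invDist x₀ δ x ^ 2) * (⟪e, x - x₀⟫_ℝ * invDist x₀ δ x - 2) := by
        simp only [hk_def, e1, e2, hA, hw_def]; ring
      have h4 : |⟪e, x - x₀⟫_ℝ * invDist x₀ δ x| ≤ 1 := by
        rw [abs_mul, abs_of_pos hσ]
        exact (mul_le_mul_of_nonneg_right (hq x) hσ.le).trans hm
      rw [e3, abs_mul, abs_of_nonneg (by positivity : 0 ≤ A * invDist x₀ δ x ^ 2), mul_comm 3]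
      refine mul_le_mul_of_nonneg_left ?_ (by positivity)
      rw [abs_le] at h4 ⊢
      constructor <;> linarith
    -- The constant 60 is `10 * 3 * 2`: the normalization, the bound on `|⟪e, x - x₀⟫ σ - 2|`, and
    -- the bound on the tangential vector.
    rw [hV_def]
    simp only [norm_smul]
    rw [Real.norm_of_nonneg (by norm_num : (0 : ℝ) ≤ 10), Real.norm_eq_abs]
    calc 10 * (|⟪e, x - x₀⟫_ℝ * k (p + 2) (‖x - x₀‖ ^ 2) - 2 * k (p + 1) (‖x - x₀‖ ^ 2)| *
          ‖‖x - x₀‖ ^ 2 • e - ⟪e, x - x₀⟫_ℝ • (x - x₀)‖)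
        ≤ 10 * ((3 * (A * invDist x₀ δ x ^ 2)) * (2 * ‖x - x₀‖ ^ 2)) := by gcongr
      _ = 60 * (A * (‖x - x₀‖ * invDist x₀ δ x) ^ 2) := by ring
      _ ≤ 60 * (A * 1 ^ 2) := by gcongr
      _ = 60 * A := by ring

end Field

/-! ### Normals of a `C¹` boundary, and test functions that detect the boundary. -/

section BoundaryGeometry

variable {n : ℕ} {Ω : Set (E n)}

open scoped InnerProductSpace in
/-- At a boundary point of a `C¹` domain, the domain is asymptotically contained in a half space,
and the exterior of the domain accumulates at the point. -/
lemma HasC1Boundary.exists_normal (hΩ : HasC1Boundary Ω) {x₀ : E n} (hx₀ : x₀ ∈ frontier Ω) :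
    ∃ e : E n, ‖e‖ = 1 ∧
      (∀ κ > 0, ∃ s > 0, ∀ x ∈ Ω, ‖x - x₀‖ ≤ s → -κ * ‖x - x₀‖ ≤ ⟪e, x - x₀⟫_ℝ) ∧
      ∀ s > 0, ∃ z ∈ Metric.ball x₀ s, z ∉ closure Ω := by
  obtain ⟨U, hUo, hxU, ρ, hρ, hρ', hin, hfr⟩ := hΩ x₀ hx₀
  have hρ0 : ρ x₀ = 0 := (hfr x₀ hxU).1 hx₀
  set g : E n := (InnerProductSpace.toDual ℝ (E n)).symm (fderiv ℝ ρ x₀) with hg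
  have hgL : ∀ v, fderiv ℝ ρ x₀ v = ⟪g, v⟫_ℝ := fun v => by
    rw [hg, InnerProductSpace.toDual_symm_apply]
  have hg0 : g ≠ 0 := by
    intro h
    refine hρ' x₀ hxU (ContinuousLinearMap.ext fun v => ?_)
    rw [hgL, h, inner_zero_left]; rfl
  have hgn : 0 < ‖g‖ := norm_pos_iff.2 hg0
  have hd : HasFDerivAt ρ (fderiv ℝ ρ x₀) x₀ := (hρ.differentiable (by simp) x₀).hasFDerivAt
  -- First-order Taylor expansion of `ρ` at `x₀`, with the error measured in units of `‖g‖`. The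
  -- inner normal is `g / ‖g‖`.
  have key : ∀ κ > 0, ∃ s > 0, ∀ x, ‖x - x₀‖ < s →
      x ∈ U ∧ |ρ x - ⟪g, x - x₀⟫_ℝ| ≤ κ * ‖g‖ * ‖x - x₀‖ := by
    intro κ hκ
    have h1 := hd.isLittleO.def (show 0 < κ * ‖g‖ by positivity)
    obtain ⟨s, hs, h⟩ := Metric.eventually_nhds_iff.1 ((hUo.eventually_mem hxU).and h1)
    refine ⟨s, hs, fun x hx => ?_⟩
    have h2 := h (y := x) (by rwa [dist_eq_norm])
    rw [hρ0, sub_zero, hgL, Real.norm_eq_abs] at h2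
    exact h2
  refine ⟨‖g‖⁻¹ • g, ?_, fun κ hκ => ?_, fun s hs => ?_⟩
  · rw [norm_smul, norm_inv, norm_norm, inv_mul_cancel₀ hgn.ne']
  · obtain ⟨s, hs, h⟩ := key κ hκ
    refine ⟨s / 2, by positivity, fun x hx hxs => ?_⟩
    obtain ⟨h1, h2⟩ := h x (by linarith)
    have h3 := (hin x h1).1 hx
    have h4 := (abs_le.1 h2).2
    rw [inner_smul_left, RCLike.conj_to_real, ← div_eq_inv_mul, le_div_iff₀ hgn]
    linarith
  · obtain ⟨s', hs', h⟩ := key (1 / 2) (by norm_num)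
    set t : ℝ := min s s' / 2 with ht
    have ht0 : 0 < t := by positivity
    have hts : t < s := (half_lt_self (lt_min hs hs')).trans_le (min_le_left _ _)
    have hts' : t < s' := (half_lt_self (lt_min hs hs')).trans_le (min_le_right _ _)
    -- Moving outwards by `t`, the expansion with relative error `1 / 2` gives `ρ z ≤ -t ‖g‖ / 2 <
    -- 0`, so `z` is neither in `Ω` nor on its boundary.
    set z : E n := x₀ - (t * ‖g‖⁻¹) • g with hz
    have hzx : z - x₀ = -((t * ‖g‖⁻¹) • g) := by rw [hz]; abel
    have hzn : ‖z - x₀‖ = t := by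
      rw [hzx, norm_neg, norm_smul, norm_mul, norm_inv, norm_norm, Real.norm_of_nonneg ht0.le,
        mul_assoc, inv_mul_cancel₀ hgn.ne', mul_one]
    obtain ⟨h1, h2⟩ := h z (by rwa [hzn])
    have h3 : ⟪g, z - x₀⟫_ℝ = -(t * ‖g‖) := by
      rw [hzx, inner_neg_right, inner_smul_right, real_inner_self_eq_norm_sq]
      field_simp
    have h4 : ρ z < 0 := by
      have h5 := (abs_le.1 h2).2
      rw [h3, hzn] at h5
      nlinarith [mul_pos ht0 hgn]
    refine ⟨z, by rwa [mem_ball_iff_norm, hzn], fun hcl => ?_⟩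
    by_cases hzΩ : z ∈ Ω
    · linarith [(hin z h1).1 hzΩ]
    · have : z ∈ frontier Ω := ⟨hcl, fun hi => hzΩ (interior_subset hi)⟩
      linarith [(hfr z h1).1 this]

/-- Near a boundary point at which the exterior of `Ω` accumulates, the divergence theorem produces
boundary terms. -/
lemma exists_integral_partialD_ne_zero (hΩo : IsOpen Ω) {x₀ : E n} (hx₀ : x₀ ∈ closure Ω)
    (hext : ∀ s > 0, ∃ z ∈ Metric.ball x₀ s, z ∉ closure Ω) {s : ℝ} (hs : 0 < s) :
    ∃ v : E n → ℝ, ContDiff ℝ ∞ v ∧ HasCompactSupport v ∧ tsupport v ⊆ Metric.ball x₀ s ∧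
      ∃ i, ∫ x in Ω, partialD v i x ≠ 0 := by
  -- If all these integrals vanish, the indicator of `Ω` has zero distributional gradient in the
  -- ball, so its mollification `G` is constant on the half ball. But `G` is `∫ ψ > 0` at a point
  -- deep enough inside `Ω` and zero at one deep enough outside.
  by_contra! hcon
  obtain ⟨z₁, hz₁Ω, hz₁⟩ : ∃ z ∈ Ω, z ∈ Metric.ball x₀ (s / 2) := by
    obtain ⟨z, hz, hzs⟩ := Metric.mem_closure_iff.1 hx₀ (s / 2) (by positivity)
    exact ⟨z, hz, by rwa [Metric.mem_ball, dist_comm]⟩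
  obtain ⟨z₂, hz₂, hz₂Ω⟩ := hext (s / 2) (by positivity)
  obtain ⟨η₁, hη₁, hb₁⟩ := Metric.isOpen_iff.1 hΩo z₁ hz₁Ω
  obtain ⟨η₂, hη₂, hb₂⟩ := Metric.isOpen_iff.1 isClosed_closure.isOpen_compl z₂ hz₂Ω
  -- The mollification radius keeps the ball around `z₁` in `Ω`, the one around `z₂` in the
  -- exterior, and those centred in the half ball inside the ball of radius `s`.
  set η : ℝ := min (min η₁ η₂) (s / 2) / 2 with hη_def
  have hη : 0 < η := by positivity
  have hη1 : η < η₁ := (half_lt_self (by positivity)).trans_le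
    ((min_le_left _ _).trans (min_le_left _ _))
  have hη2 : η < η₂ := (half_lt_self (by positivity)).trans_le
    ((min_le_left _ _).trans (min_le_right _ _))
  have hηs : η < s / 2 := (half_lt_self (by positivity)).trans_le (min_le_right _ _)
  let ψ : ContDiffBump (0 : E n) := ⟨η / 2, η, by positivity, by linarith⟩
  have hψs : ∀ y : E n, η ≤ ‖y‖ → ψ y = 0 := fun y hy =>
    ψ.zero_of_le_dist (by rw [dist_zero_right]; exact hy)
  set f : E n → ℝ := Ω.indicator fun _ => 1 with hf
  have hfloc : LocallyIntegrable f volume :=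
    (locallyIntegrable_const 1).indicator hΩo.measurableSet
  set G : E n → ℝ := convolution f ψ (ContinuousLinearMap.lsmul ℝ ℝ) volume with hG
  have hGe : ∀ z, G z = ∫ t in Ω, ψ (z - t) := by
    intro z
    rw [hG, convolution_def, ← integral_indicator hΩo.measurableSet]
    congr 1 with t
    by_cases ht : t ∈ Ω <;> simp [hf, ht]
  have hψ1 : ContDiff ℝ 1 (ψ : E n → ℝ) := ψ.contDiff
  have hGd : ∀ z, HasFDerivAt G (convolution f (fderiv ℝ ψ)
      (ContinuousLinearMap.precompR (E n) (ContinuousLinearMap.lsmul ℝ ℝ)) volume z) z := fun z =>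
    ψ.hasCompactSupport.hasFDerivAt_convolution_right _ hfloc hψ1 z
  have hG0 : ∀ z ∈ Metric.ball x₀ (s / 2), fderiv ℝ G z = 0 := by
    intro z hz
    rw [(hGd z).fderiv]
    set v : E n → ℝ := fun t => ψ (z - t) with hv
    have hvs : ContDiff ℝ ∞ v := ψ.contDiff.comp (contDiff_const.sub contDiff_id)
    have hvt : tsupport v ⊆ Metric.closedBall z η := by
      refine closure_minimal (fun t ht => ?_) Metric.isClosed_closedBall
      by_contra h
      rw [mem_closedBall_iff_norm, not_le, norm_sub_rev] at h
      exact ht (hψs _ h.le)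
    have hvc : HasCompactSupport v :=
      HasCompactSupport.intro (isCompact_closedBall z η) fun t ht =>
        image_eq_zero_of_notMem_tsupport fun h => ht (hvt h)
    have hvb : tsupport v ⊆ Metric.ball x₀ s := by
      refine hvt.trans fun t ht => ?_
      rw [Metric.mem_closedBall] at ht
      rw [Metric.mem_ball] at hz ⊢
      linarith [dist_triangle t z x₀]
    have hd : ∀ t w, fderiv ℝ v t w = - fderiv ℝ ψ (z - t) w := by
      intro t w
      have h1 : HasFDerivAt (ψ : E n → ℝ) (fderiv ℝ ψ (z - t)) (z - t) :=
        (hψ1.differentiable (by simp) _).hasFDerivAt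
      have h2 : HasFDerivAt v ((fderiv ℝ ψ (z - t)).comp (-ContinuousLinearMap.id ℝ (E n))) t :=
        h1.comp t ((hasFDerivAt_id t).const_sub z)
      rw [h2.fderiv]
      simp
    refine ContinuousLinearMap.ext fun w => ?_
    have hcl : convolution f (fderiv ℝ ψ)
        (ContinuousLinearMap.precompR (E n) (ContinuousLinearMap.lsmul ℝ ℝ)) volume z w =
        convolution f (fun a => fderiv ℝ ψ a w) (ContinuousLinearMap.lsmul ℝ ℝ) volume z :=
      convolution_precompR_apply (L := ContinuousLinearMap.lsmul ℝ ℝ) hfloc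
        (ψ.hasCompactSupport.fderiv (𝕜 := ℝ)) (hψ1.continuous_fderiv (by simp)) z w
    have hint : convolution f (fun a => fderiv ℝ ψ a w) (ContinuousLinearMap.lsmul ℝ ℝ) volume z =
        ∫ t in Ω, - fderiv ℝ v t w := by
      rw [convolution_def, ← integral_indicator hΩo.measurableSet]
      congr 1 with t
      by_cases ht : t ∈ Ω <;> simp [hf, ht, hd]
    have hz0 : ∫ t in Ω, fderiv ℝ v t w = 0 := by
      simp_rw [fderiv_apply_eq_sum]
      rw [integral_finsetSum]
      · refine Finset.sum_eq_zero fun i _ => ?_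
        rw [integral_smul, hcon v hvs hvc hvb i, smul_zero]
      · intro i _
        have hint : Integrable (partialD v i) (volume : Measure (E n)) :=
          (continuous_partialD (hvs.of_le (by simp)) i).integrable_of_hasCompactSupport
            (hasCompactSupport_partialD hvc i)
        exact (hint.smul (w i)).integrableOn
    rw [hcl, hint, integral_neg, hz0, neg_zero]
    rfl
  have hconst : G z₁ = G z₂ := by
    refine (Metric.isOpen_ball).is_const_of_fderiv_eq_zero
      (convex_ball x₀ (s / 2)).isPreconnected
      (fun z _ => (hGd z).differentiableAt.differentiableWithinAt) hG0 hz₁ hz₂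
  have h1 : G z₁ = ∫ t, ψ t := by
    rw [hGe, setIntegral_eq_integral_of_forall_compl_eq_zero, integral_sub_left_eq_self]
    intro t ht
    refine hψs _ ?_
    by_contra! h
    exact ht (hb₁ (by rw [mem_ball_iff_norm, norm_sub_rev]; linarith))
  have h2 : G z₂ = 0 := by
    rw [hGe]
    refine setIntegral_eq_zero_of_forall_eq_zero fun t ht => hψs _ ?_
    by_contra! h
    exact hb₂ (show t ∈ Metric.ball z₂ η₂ by rw [mem_ball_iff_norm, norm_sub_rev]; linarith)
      (subset_closure ht)
  have h3 : 0 < ∫ t, ψ t := ψ.integral_pos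
  rw [← h1, hconst, h2] at h3
  exact lt_irrefl _ h3

end BoundaryGeometry

/-! ### Positive energy for suitable boundary data. -/

section Positivity

variable {n : ℕ} {Ω : Set (E n)} {p : ℝ} [hp : Fact (1 < p)] {γ : E n → ℝ} {c M : ℝ}

lemma integral_partialD_eq_zero {F : Type*} [NormedAddCommGroup F] [NormedSpace ℝ F]
    {φ : E n → F} (hφ : ContDiff ℝ 1 φ) (hc : HasCompactSupport φ) (i : Fin n) :
    ∫ x, partialD φ i x = 0 := by
  have h := integral_smul_fderiv_eq_neg_fderiv_smul_of_integrable (μ := (volume : Measure (E n)))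
    (f := fun _ : E n => (1 : ℝ)) (g := φ) (v := EuclideanSpace.single i 1)
    (by simp) ?_ ?_ (fun _ _ => differentiableAt_const _)
    (fun x _ => hφ.differentiable (by simp) x)
  · simpa [partialD] using h
  · simp only [one_smul]
    exact (continuous_partialD hφ i).integrable_of_hasCompactSupport
      (hasCompactSupport_partialD hc i)
  · simp only [one_smul]
    exact hφ.continuous.integrable_of_hasCompactSupport hc

/-- Functions in `W^{1,p}_0` have gradients with vanishing mean. -/
lemma setIntegral_grad_eq_zero (hΩb : Bornology.IsBounded Ω) (hΩo : IsOpen Ω) (i : Fin n) :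
    ∀ u ∈ W1p0 Ω p, ∫ x in Ω, grad u x i = 0 := by
  obtain ⟨R, hR0, hR⟩ := hΩb.exists_pos_norm_le
  -- A bump equal to one on `Ω` writes the mean as a pairing with a compactly supported function,
  -- which is continuous in `u`.
  let ψ : ContDiffBump (0 : E n) := ⟨R, R + 1, hR0, by linarith⟩
  have hψ : ∀ x ∈ Ω, ψ x = 1 := fun x hx =>
    ψ.one_of_mem_closedBall (by rw [mem_closedBall_zero_iff]; exact hR x hx)
  have hcont : Continuous fun u : W1p Ω p => ∫ x in Ω, grad u x i := by
    have h1 : Continuous fun u : W1p Ω p => ∫ x in Ω, ψ x • grad u x i :=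
      (continuous_integral_smul_clm ((EuclideanSpace.proj i : CVec n →L[ℂ] ℂ).restrictScalars ℝ)
        ψ.continuous ψ.hasCompactSupport).comp (continuous_snd.comp continuous_subtype_val)
    refine h1.congr fun u => setIntegral_congr_fun hΩo.measurableSet fun x hx => ?_
    simp only [hψ x hx, one_smul]
  refine W1p0_induction (isClosed_eq hcont continuous_const) ?_
  rintro u ⟨φ, hφ, -, h2⟩
  have e1 : ∫ x in Ω, grad u x i = ∫ x in Ω, partialD φ i x :=
    integral_congr_ae (h2.mono fun x hx => by simp only [hx]; rfl)
  rw [e1, setIntegral_eq_integral_of_tsupport hφ.2.2 fun x hx =>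
    partialD_eq_zero_of_notMem_tsupport hx i]
  exact integral_partialD_eq_zero (hφ.1.of_le (by simp)) hφ.2.1 i

/-- Zero energy would force `∇u = 0`. Then `u - v`, being in `W^{1,p}_0`, would have a gradient of
mean zero whose `i`-th component is `-∂ᵢ v`. -/
lemma IsCoeff.energy_pos (h : IsCoeff Ω γ c M) (hΩb : Bornology.IsBounded Ω) {v : E n → ℝ}
    (hv : ContDiff ℝ ∞ v) (hc : HasCompactSupport v) {i : Fin n}
    (hi : ∫ x in Ω, partialD v i x ≠ 0) {u : W1p Ω p}
    (hu : u - ofSmooth Ω p (fun x => (v x : ℂ)) (contDiff_ofReal hv) (hasCompactSupport_ofReal hc)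
      ∈ W1p0 Ω p) : 0 < energy γ u := by
  refine lt_of_le_of_ne (h.energy_nonneg u) fun h0 => hi ?_
  have hz := (integral_eq_zero_iff_of_nonneg_ae (h.ae_mem.mono fun x hx => by
    have := h.nonneg x hx
    simp only [Pi.zero_apply]
    positivity) (h.integrable_mul_norm_rpow (memLp_grad u))).1 h0.symm
  have hgrad : ∀ᵐ x ∂volume.restrict Ω, grad u x = 0 := by
    filter_upwards [hz, h.ae_mem] with x hx hxΩ
    have h1 : 0 < γ x := h.pos.trans_le (h.le x hxΩ)
    simp only [Pi.zero_apply, mul_eq_zero, h1.ne', false_or] at hx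
    rw [Real.rpow_eq_zero (norm_nonneg _) (by have := hp.out; linarith)] at hx
    exact norm_eq_zero.1 hx
  have h2 := setIntegral_grad_eq_zero hΩb h.isOpen i _ hu
  have h3 : ∫ x in Ω, grad (u - ofSmooth Ω p (fun x => (v x : ℂ)) (contDiff_ofReal hv)
      (hasCompactSupport_ofReal hc)) x i = ∫ x in Ω, ((-partialD v i x : ℝ) : ℂ) := by
    refine integral_congr_ae ?_
    filter_upwards [grad_sub u (ofSmooth Ω p (fun x => (v x : ℂ)) (contDiff_ofReal hv)
      (hasCompactSupport_ofReal hc)), hgrad, grad_ofSmooth (Ω := Ω) (p := p) (contDiff_ofReal hv)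
      (hasCompactSupport_ofReal hc)] with x e1 e2 e3
    rw [e1, e2, e3, zero_sub, PiLp.neg_apply, classicalGrad]
    simp only [partialD_ofReal (hv.of_le (by simp)), Complex.ofReal_neg]
  rw [h3, integral_complex_ofReal, integral_neg, Complex.ofReal_eq_zero, neg_eq_zero] at h2
  exact h2

end Positivity

/-! ### Comparison of energies and determination of the coefficient at the boundary. -/

section BoundaryDetermination

variable {n : ℕ} {Ω : Set (E n)} {p : ℝ} [hp : Fact (1 < p)]

lemma isCoeff_of_continuousOn (hΩo : IsOpen Ω) (hΩb : Bornology.IsBounded Ω) {γ : E n → ℝ}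
    (hγ : ContinuousOn γ (closure Ω)) (hpos : ∀ x ∈ closure Ω, 0 < γ x) :
    ∃ c M, IsCoeff Ω γ c M := by
  have hK : IsCompact (closure Ω) := hΩb.isCompact_closure
  have hm : AEStronglyMeasurable γ (volume.restrict Ω) :=
    (hγ.mono subset_closure).aestronglyMeasurable hΩo.measurableSet
  rcases (closure Ω).eq_empty_or_nonempty with he | hne
  · have : ∀ x, x ∉ Ω := fun x hx => by
      have := subset_closure hx
      rw [he] at this
      exact this
    exact ⟨1, 1, hΩo, hm, one_pos, fun x hx => absurd hx (this x), fun x hx => absurd hx (this x)⟩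
  · obtain ⟨a, ha, hamin⟩ := hK.exists_isMinOn hne hγ
    obtain ⟨b, hb, hbmax⟩ := hK.exists_isMaxOn hne hγ
    exact ⟨γ a, γ b, hΩo, hm, hpos a ha, fun x hx => hamin (subset_closure hx),
      fun x hx => hbmax (subset_closure hx)⟩

lemma mulSmooth_ofSmooth_eq_self {χ : E n → ℝ} (hχ : ContDiff ℝ ∞ χ) (hc : HasCompactSupport χ)
    {v : E n → ℂ} (hv : ContDiff ℝ ∞ v) (hvc : HasCompactSupport v)
    (h : ∀ x, (χ x : ℂ) * v x = v x) :
    mulSmooth hχ hc (ofSmooth Ω p v hv hvc) = ofSmooth Ω p v hv hvc := by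
  refine Subtype.ext (Prod.ext (Lp.ext ?_) (Lp.ext ?_))
  · have h1 := val_mulSmooth hχ hc (ofSmooth Ω p v hv hvc)
    have h2 := val_ofSmooth (Ω := Ω) (p := p) hv hvc
    filter_upwards [h1, h2] with x e1 e2
    exact e1.trans (by rw [e2, h]; exact e2.symm)
  · have h1 := grad_mulSmooth hχ hc (ofSmooth Ω p v hv hvc)
    have h2 := val_ofSmooth (Ω := Ω) (p := p) hv hvc
    have h3 := grad_ofSmooth (Ω := Ω) (p := p) hv hvc
    filter_upwards [h1, h2, h3] with x e1 e2 e3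
    refine e1.trans (Eq.trans ?_ e3.symm)
    rw [e2, e3, ← classicalGrad_mul (hv.of_le (by simp)) (hχ.of_le (by simp))]
    congr 1
    exact funext h

set_option maxHeartbeats 1000000 in
/-- Comparison of the energy of a cut-off function with the energy of the function, if the
coefficient of the former is smaller on the support of the cutoff function. -/
lemma energy_mulSmooth_le {γ₁ γ₂ : E n → ℝ} {c₁ M₁ c₂ M₂ : ℝ} (h₁ : IsCoeff Ω γ₁ c₁ M₁)
    (h₂ : IsCoeff Ω γ₂ c₂ M₂) {a b : ℝ} (ha : 0 < a) {x₀ : E n} {δ r ε : ℝ}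
    (hδ : 0 < δ) (hr : 0 < r) (hε : 0 ≤ ε)
    (hγ₁ : ∀ x ∈ Ω, ‖x - x₀‖ ≤ 2 * r → a ≤ γ₁ x)
    (hγ₂ : ∀ x ∈ Ω, ‖x - x₀‖ ≤ 2 * r → γ₂ x ≤ b)
    {χ : E n → ℝ} (hχ : ContDiff ℝ ∞ χ) (hc : HasCompactSupport χ)
    (hχ0 : ∀ x, 0 ≤ χ x) (hχ1 : ∀ x, χ x ≤ 1) (hχr : ∀ x, r ≤ ‖x - x₀‖ → χ x = 0)
    (hχg : ∀ x, ‖classicalGrad (fun y => (χ y : ℂ)) x‖ ≤ ε * invDist x₀ δ x)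
    (hχg0 : ∀ x, ‖x - x₀‖ < δ ∨ r < ‖x - x₀‖ → classicalGrad (fun y => (χ y : ℂ)) x = 0)
    {C H κ : ℝ} (hC : 0 ≤ C) (hκ : 0 ≤ κ)
    (hadd : ∀ s t : ℝ, 0 ≤ s → 0 ≤ t → (s + t) ^ p ≤ (1 + κ) * s ^ p + C * t ^ p)
    (u φ : W1p Ω p) (hval : ∀ᵐ x ∂volume.restrict Ω, δ / 2 ≤ ‖x - x₀‖ → val φ x = val u x)
    (hgrad : ∀ᵐ x ∂volume.restrict Ω, δ / 2 ≤ ‖x - x₀‖ → grad φ x = grad u x)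
    (hH : 0 ≤ H) (hardy : ∫ x in Ω, (shellCutoff δ r (‖x - x₀‖ ^ 2) * invDist x₀ δ x ^ p) *
      ‖val φ x‖ ^ p ≤ H * ∫ x in Ω, shellCutoff δ r (‖x - x₀‖ ^ 2) * ‖grad φ x‖ ^ p)
    (hb : 0 ≤ b) :
    energy γ₂ (mulSmooth hχ hc u) ≤ (b * (1 + κ) + b * C * ε ^ p * H) / a * energy γ₁ u := by
  have hp0 : 0 < p := by have := hp.out; linarith
  set w : E n → ℝ := fun x => shellCutoff δ r (‖x - x₀‖ ^ 2) with hw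
  have hw0 : ∀ x, 0 ≤ w x := fun x => shellCutoff_nonneg _ _ _
  have hw1 : ∀ x, w x ≤ 1 := fun x => shellCutoff_le_one _ _ _
  have hwc : Continuous w := ((contDiff_shellCutoff δ r (k := 1)).comp
    (contDiff_normSq_sub x₀)).continuous
  have hσ : ∀ x, 0 < invDist x₀ δ x := fun x => invDist_pos x₀ x hδ
  have hσb : ∀ x, invDist x₀ δ x ≤ δ⁻¹ := fun x => by
    have h1 : invDist x₀ δ x ^ 2 ≤ δ⁻¹ ^ 2 := by
      rw [invDist_sq x₀ x hδ, inv_pow]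
      gcongr
      linarith [sq_nonneg ‖x - x₀‖]
    exact (sq_le_sq₀ (hσ x).le (by positivity)).1 h1
  have hqc : Continuous fun x => w x * invDist x₀ δ x ^ p :=
    hwc.mul ((contDiff_invDist x₀ hδ (k := 1)).continuous.rpow_const fun _ => Or.inr hp0.le)
  have i1 := h₁.integrable_mul_norm_rpow (memLp_grad u)
  have i2 := h₂.integrable_mul_norm_rpow (memLp_grad (mulSmooth hχ hc u))
  have i3 : Integrable (fun x => (w x * invDist x₀ δ x ^ p) * ‖val φ x‖ ^ p)
      (volume.restrict Ω) := by
    refine integrable_weight_mul_norm_rpow (M := δ⁻¹ ^ p) hqc.aestronglyMeasurable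
      (.of_forall fun x => ?_) (memLp_val φ)
    have h0 := hσ x
    have h1 := hw0 x
    rw [Real.norm_of_nonneg (by positivity)]
    calc w x * invDist x₀ δ x ^ p ≤ 1 * δ⁻¹ ^ p := by
          gcongr
          · exact hw1 x
          · exact hσb x
      _ = δ⁻¹ ^ p := one_mul _
  have i4 : Integrable (fun x => w x * ‖grad φ x‖ ^ p) (volume.restrict Ω) :=
    integrable_weight_mul_norm_rpow (M := 1) hwc.aestronglyMeasurable
      (.of_forall fun x => by rw [Real.norm_of_nonneg (hw0 x)]; exact hw1 x) (memLp_grad φ)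
  -- The weight vanishes within `δ / 2` of `x₀` and beyond `2 r`. In between `∇φ = ∇u` and `γ₁ ≥ a`.
  have hG : ∫ x in Ω, w x * ‖grad φ x‖ ^ p ≤ a⁻¹ * energy γ₁ u := by
    rw [energy, ← integral_const_mul]
    refine integral_mono_ae i4 (i1.const_mul _) ?_
    filter_upwards [hgrad, h₁.ae_mem] with x e1 hx
    have hγ0 := h₁.nonneg x hx
    by_cases hx1 : ‖x - x₀‖ < δ / 2
    · have : w x = 0 := shellCutoff_eq_zero_of_le hδ (by nlinarith [norm_nonneg (x - x₀)])
      rw [this, zero_mul]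
      positivity
    by_cases hx2 : 2 * r < ‖x - x₀‖
    · have : w x = 0 := shellCutoff_eq_zero_of_ge hr (by nlinarith)
      rw [this, zero_mul]
      positivity
    rw [e1 (not_lt.1 hx1), ← mul_assoc]
    refine mul_le_mul_of_nonneg_right ?_ (by positivity)
    rw [← div_eq_inv_mul, le_div_iff₀ ha]
    have := hγ₁ x hx (not_lt.1 hx2)
    nlinarith [hw0 x, hw1 x]
  have hmain : energy γ₂ (mulSmooth hχ hc u) ≤ b * (1 + κ) / a * energy γ₁ u +
      b * C * ε ^ p * ∫ x in Ω, (w x * invDist x₀ δ x ^ p) * ‖val φ x‖ ^ p := by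
    rw [energy, energy, ← integral_const_mul, ← integral_const_mul,
      ← integral_add (i1.const_mul _) (i3.const_mul _)]
    refine integral_mono_ae i2 ((i1.const_mul _).add (i3.const_mul _)) ?_
    filter_upwards [h₁.ae_mem, grad_mulSmooth hχ hc u, hval] with x hx e1 e2
    have hγ0 := h₁.nonneg x hx
    have h0 := hσ x
    have h1 := hw0 x
    have hR : 0 ≤ b * (1 + κ) / a * (γ₁ x * ‖grad u x‖ ^ p) := by positivity
    have hR' : 0 ≤ b * C * ε ^ p * ((w x * invDist x₀ δ x ^ p) * ‖val φ x‖ ^ p) := by positivity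
    rw [e1]
    by_cases hxr : r < ‖x - x₀‖
    · rw [hχr x hxr.le, hχg0 x (Or.inr hxr), smul_zero, add_zero, Complex.ofReal_zero, zero_smul,
        norm_zero, Real.zero_rpow hp0.ne', mul_zero]
      exact add_nonneg hR hR'
    have hx2 : ‖x - x₀‖ ≤ 2 * r := (not_lt.1 hxr).trans (by linarith)
    set g := classicalGrad (fun y => (χ y : ℂ)) x with hg
    have hn : ‖(χ x : ℂ) • grad u x + val u x • g‖ ≤ ‖grad u x‖ + ‖val u x‖ * ‖g‖ := by
      refine (norm_add_le _ _).trans ?_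
      rw [norm_smul, norm_smul, Complex.norm_real, Real.norm_of_nonneg (hχ0 x)]
      gcongr
      exact mul_le_of_le_one_left (norm_nonneg _) (hχ1 x)
    -- The gradient of `χ` lives on the shell from `δ` to `r`, where the Hardy weight is one and `φ
    -- = u`.
    have hcut : (‖val u x‖ * ‖g‖) ^ p ≤
        ε ^ p * ((w x * invDist x₀ δ x ^ p) * ‖val φ x‖ ^ p) := by
      by_cases hxδ : ‖x - x₀‖ < δ
      · rw [hg, hχg0 x (Or.inl hxδ), norm_zero, mul_zero, Real.zero_rpow hp0.ne']
        positivity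
      · have hw1' : w x = 1 := shellCutoff_eq_one hδ hr (by nlinarith [not_lt.1 hxδ])
          (by nlinarith [not_lt.1 hxr, norm_nonneg (x - x₀)])
        rw [e2 (by linarith [not_lt.1 hxδ]), hw1', one_mul, ← mul_assoc,
          ← Real.mul_rpow hε h0.le, ← Real.mul_rpow (by positivity) (norm_nonneg _), mul_comm]
        gcongr
        exact hχg x
    have hγb : γ₂ x ≤ b := hγ₂ x hx hx2
    have ha1 : 1 ≤ γ₁ x / a := (one_le_div ha).2 (hγ₁ x hx hx2)
    calc γ₂ x * ‖(χ x : ℂ) • grad u x + val u x • g‖ ^ p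
        ≤ b * ((1 + κ) * ‖grad u x‖ ^ p + C * (‖val u x‖ * ‖g‖) ^ p) := by
          refine mul_le_mul hγb ?_ (by positivity) hb
          exact (Real.rpow_le_rpow (norm_nonneg _) hn hp0.le).trans
            (hadd _ _ (norm_nonneg _) (by positivity))
      _ ≤ b * ((1 + κ) * (γ₁ x / a * ‖grad u x‖ ^ p) +
          C * (ε ^ p * ((w x * invDist x₀ δ x ^ p) * ‖val φ x‖ ^ p))) := by
          gcongr
          exact le_mul_of_one_le_left (by positivity) ha1
      _ = _ := by ring
  calc energy γ₂ (mulSmooth hχ hc u) ≤ _ := hmain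
    _ ≤ b * (1 + κ) / a * energy γ₁ u + b * C * ε ^ p * (H * (a⁻¹ * energy γ₁ u)) := by
        gcongr
        exact hardy.trans (by gcongr)
    _ = _ := by field_simp

/-- One half of boundary determination: the coefficient `γ₁` does not exceed `γ₂` on the
boundary. -/
lemma le_on_frontier_of_dnMap_eq (hn : 2 ≤ n) (hΩo : IsOpen Ω) (hΩb : Bornology.IsBounded Ω)
    (hΩ : HasC1Boundary Ω) {γ₁ γ₂ : E n → ℝ}
    (hγ₁c : ContinuousOn γ₁ (closure Ω)) (hγ₂c : ContinuousOn γ₂ (closure Ω))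
    (hγ₁pos : ∀ x ∈ closure Ω, 0 < γ₁ x) (hγ₂pos : ∀ x ∈ closure Ω, 0 < γ₂ x)
    (hΛ : dnMap Ω p γ₁ = dnMap Ω p γ₂) {x₀ : E n} (hx₀ : x₀ ∈ frontier Ω) : γ₁ x₀ ≤ γ₂ x₀ := by
  by_contra! hlt
  have hp0 : 0 < p := by have := hp.out; linarith
  have hn' : (0 : ℝ) < n := by exact_mod_cast (by omega : 0 < n)
  have hx₀c : x₀ ∈ closure Ω := frontier_subset_closure hx₀
  obtain ⟨c₁, M₁, h₁⟩ := isCoeff_of_continuousOn hΩo hΩb hγ₁c hγ₁pos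
  obtain ⟨c₂, M₂, h₂⟩ := isCoeff_of_continuousOn hΩo hΩb hγ₂c hγ₂pos
  obtain ⟨b, hb2, hb1⟩ := exists_between hlt
  obtain ⟨a, hba, ha1⟩ := exists_between hb1
  have hb : 0 < b := (hγ₂pos x₀ hx₀c).trans hb2
  have ha : 0 < a := hb.trans hba
  obtain ⟨s₁, hs₁, hab⟩ : ∃ s > 0, ∀ x ∈ Ω, ‖x - x₀‖ < s → a ≤ γ₁ x ∧ γ₂ x ≤ b := by
    have e1 := (hγ₁c x₀ hx₀c).eventually (eventually_ge_nhds ha1)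
    have e2 := (hγ₂c x₀ hx₀c).eventually (eventually_le_nhds hb2)
    obtain ⟨s, hs, h⟩ := Metric.mem_nhdsWithin_iff.1 (e1.and e2)
    exact ⟨s, hs, fun x hx hxs => h ⟨by rwa [mem_ball_iff_norm], subset_closure hx⟩⟩
  obtain ⟨e, he, hcone, hext⟩ := hΩ.exists_normal hx₀
  obtain ⟨s₂, hs₂, hcone⟩ := hcone (1 / (40 * n)) (by positivity)
  set r : ℝ := min s₁ s₂ / 3 with hr_def
  have hr : 0 < r := by positivity
  have hrs₁ : 2 * r < s₁ := by linarith [min_le_left s₁ s₂]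
  have hrs₂ : 2 * r ≤ s₂ := by linarith [min_le_right s₁ s₂]
  -- Chosen so that `b (1 + κ) = (a + b) / 2`, half of the gap between `b` and `a`.
  set κ : ℝ := (a - b) / (2 * b) with hκ_def
  have hκ : 0 < κ := div_pos (by linarith) (by positivity)
  obtain ⟨C, hC, hadd⟩ := exists_add_rpow_le hp.out hκ
  -- `H` is fixed before `ε` and `δ`, which is possible because 60 bounds the field for every shell.
  obtain ⟨H, hH, hardy⟩ := exists_hardy (n := n) (Ω := Ω) p hΩo (K := 60) (by norm_num)
  -- With `ε ^ p = t` the Hardy error takes at most another quarter of the gap; the added one keeps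
  -- the denominator positive.
  set t : ℝ := (a - b) / (4 * (b * C * H + 1)) with ht_def
  have ht : 0 < t := div_pos (by linarith) (by positivity)
  set ε : ℝ := t ^ (1 / p) with hε_def
  have hε : 0 < ε := by positivity
  have hεp : ε ^ p = t := by
    rw [hε_def, ← Real.rpow_mul ht.le, one_div, inv_mul_cancel₀ hp0.ne', Real.rpow_one]
  obtain ⟨δ, hδ, hδr, χ, hχ, hχc, hχ0, hχ1, hχδ, hχr, hχg, hχg0⟩ := exists_log_cutoff x₀ hr hε
  -- The datum is supported within `δ / 2` of `x₀`, so `u - u₀` agrees with `u` on the shell while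
  -- `χ = 1` on the support of `v`.
  obtain ⟨v, hv, hvc, hvs, i, hvi⟩ :=
    exists_integral_partialD_ne_zero hΩo hx₀c hext (s := δ / 2) (by positivity)
  have hvC := contDiff_ofReal hv
  have hvcC := hasCompactSupport_ofReal hvc
  have hvt : ∀ x, δ / 2 ≤ ‖x - x₀‖ → x ∉ tsupport v := fun x hx h => by
    have := hvs h
    rw [mem_ball_iff_norm] at this
    linarith
  set u₀ : W1p Ω p := ofSmooth Ω p (fun x => (v x : ℂ)) hvC hvcC with hu₀
  obtain ⟨u, hu, hmin⟩ := exists_solution_energy_le h₁ h₂ (by omega) hΩb hΛ u₀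
  have hpos : 0 < energy γ₁ u := h₁.energy_pos hΩb hv hvc hvi hu
  -- Because `χ v = v`, the difference is `χ (u - u₀)`.
  have hcomp : mulSmooth hχ hχc u - u₀ ∈ W1p0 Ω p := by
    have h1 := mulSmooth_mem_W1p0 hχ hχc hu
    rw [map_sub, hu₀, mulSmooth_ofSmooth_eq_self hχ hχc hvC hvcC] at h1
    · exact h1
    · intro x
      by_cases hx : δ / 2 ≤ ‖x - x₀‖
      · rw [image_eq_zero_of_notMem_tsupport (hvt x hx), Complex.ofReal_zero, mul_zero]
      · rw [hχδ x (by linarith [not_le.1 hx]), Complex.ofReal_one, one_mul]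
  obtain ⟨V, hV⟩ := exists_hardyField hn (p := p) (Ω := Ω) he hδ hr
    fun x hx hx2 => hcone x hx (hx2.trans hrs₂)
  have hσb : ∃ M, ∀ x ∈ Ω, invDist x₀ δ x ≤ M := by
    obtain ⟨M, hM⟩ := (hΩb.isCompact_closure.image_of_continuousOn
      (contDiff_invDist x₀ hδ (k := 1)).continuous.continuousOn).bddAbove
    exact ⟨M, fun x hx => hM ⟨x, subset_closure hx, rfl⟩⟩
  have hle := energy_mulSmooth_le h₁ h₂ ha hδ hr hε.le
    (fun x hx hx2 => (hab x hx (hx2.trans_lt hrs₁)).1)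
    (fun x hx hx2 => (hab x hx (hx2.trans_lt hrs₁)).2) hχ hχc hχ0 hχ1 hχr hχg hχg0 hC hκ.le hadd
    u (u - u₀) ?_ ?_ hH
    (hardy V _ _ hV ⟨1, fun x _ => shellCutoff_le_one _ _ _⟩ hσb _ hu) hb.le
  · have hfac : (b * (1 + κ) + b * C * ε ^ p * H) / a < 1 := by
      rw [div_lt_one ha, hεp]
      have e1 : b * (1 + κ) = (a + b) / 2 := by rw [hκ_def]; field_simp; ring
      have e2 : b * C * t * H ≤ (a - b) / 4 := by
        calc b * C * t * H = (b * C * H) * t := by ring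
          _ ≤ (b * C * H + 1) * t := by gcongr; linarith
          _ = (a - b) / 4 := by rw [ht_def]; field_simp
      linarith
    have := (hmin _ hcomp).trans hle
    nlinarith
  · filter_upwards [val_sub u u₀, val_ofSmooth (Ω := Ω) (p := p) hvC hvcC] with x e1 e2 hx
    rw [e1, e2, image_eq_zero_of_notMem_tsupport (hvt x hx), Complex.ofReal_zero, sub_zero]
  · filter_upwards [grad_sub u u₀, grad_ofSmooth (Ω := Ω) (p := p) hvC hvcC] with x e1 e2 hx
    have : classicalGrad (fun x => (v x : ℂ)) x = 0 := by
      ext j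
      simp only [classicalGrad, partialD_ofReal (hv.of_le (by simp)),
        partialD_eq_zero_of_notMem_tsupport (hvt x hx), Complex.ofReal_zero, PiLp.zero_apply]
    rw [e1, e2, this, sub_zero]

end BoundaryDetermination

end PCalderon

end

theorem theorem1p2 (n : ℕ) (hn : 2 ≤ n) (p : ℝ) [Fact (1 < p)]
    (Ω : Set (PCalderon.E n)) (hΩo : IsOpen Ω) (hΩb : Bornology.IsBounded Ω)
    (hΩ : PCalderon.HasC1Boundary Ω)
    (γ₁ γ₂ : PCalderon.E n → ℝ)
    (hγ₁c : ContinuousOn γ₁ (closure Ω)) (hγ₂c : ContinuousOn γ₂ (closure Ω))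
    (hγ₁pos : ∀ x ∈ closure Ω, 0 < γ₁ x) (hγ₂pos : ∀ x ∈ closure Ω, 0 < γ₂ x)
    (hΛ : PCalderon.dnMap Ω p γ₁ = PCalderon.dnMap Ω p γ₂) :
    ∀ x ∈ frontier Ω, γ₁ x = γ₂ x := fun _ hx =>
  le_antisymm
    (PCalderon.le_on_frontier_of_dnMap_eq hn hΩo hΩb hΩ hγ₁c hγ₂c hγ₁pos hγ₂pos hΛ hx)
    (PCalderon.le_on_frontier_of_dnMap_eq hn hΩo hΩb hΩ hγ₂c hγ₁c hγ₂pos hγ₁pos hΛ.symm hx)
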